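/- **Setting.** Pair $\mathbb R^3$ with its dual $\mathbb R_3$ by $\langle\cdot,\cdot\rangle$. Let $\mathbb{D}P^2=\{([x],[\chi])\in\mathbb RP^2\times\mathbb RP_2 : \langle x,\chi\rangle>0 \text{ for some representatives}\}$, let $\mathcal C=\{(x,\chi)\in\mathbb R^3\times\mathbb R_3:\langle x,\chi\rangle=1\}$ (of dimension 5), and let $\pi:\mathcal C\to\mathbb{D}P^2$, $(x,\chi)\mapsto([x],[\chi])$. A lift of a map $f$ into $\mathbb{D}P^2$ is a smooth map $(x,\chi)$ into $\mathcal C$ with $\pi\circ(x,\chi)=f$; smooth maps into $\mathbb{D}P^2$ are those that locally have lifts. Given a lift, put $\xi=dx-\langle dx,\chi\rangle x$ and $\eta=d\chi-\langle x,d\chi\rangle\chi$. The metric $g$ and the symplectic form $\omega$ of $\mathbb{D}P^2$ are determined by $f^*(g+\omega)(X,Y)=h(X,Y):=\langle\xi(X),\eta(Y)\rangle$, with $g$ the symmetric and $\omega$ the skew-symmetric part. Let $M$ be a Riemann surface and let $f:M\to\mathbb{D}P^2$ be a smooth immersion whose induced metric is definite and conformal, that is, in every complex coordinate $z=y^1+iy^2$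 of the atlas it is $2He^u|dz|^2$ with $u$ real and a constant $H\in\{1,-1\}$. Write $a=g(\partial_1,\partial_1)=2He^u$, $b=\omega(\partial_1,\partial_2)$, $\xi_z=\frac12(\xi(\partial_1)-i\xi(\partial_2))$ and $\eta_z=\frac12(\eta(\partial_1)-i\eta(\partial_2))$, and extend $\langle\cdot,\cdot\rangle$ complex bilinearly. The para-Kähler angle is $\theta=\arctan(b/a)+\pi/2\in(0,\pi)$. The mean curvature form $\phi\,dz$ and the cubic form $Q\,dz^3$ are given by $$\phi=He^{-u}\langle\partial_{\bar z}\xi_z,\eta_z\rangle,\qquad Q=\langle\partial_z\xi_z,\eta_z\rangle .$$ The invariants $H,u,\theta,\phi,Q$ do not depend on the lift. For a given lift put $\rho=\langle\partial_z x,\chi\rangle$. Finally let $c=1+i\tan(\theta-\pi/2)$. **Theorem.** (1) If $f$ as above has a global lift $(x,\chi):M\to\mathcal C$, then $2He^u|dz|^2$, $\theta$, $\phi\,dz$ and $Q\,dz^3$ are, respectively, a well-defined smooth metric, a smooth function $M\to(0,\pi)$, a smooth form and a smooth cubic form on $M$, and in every coordinate of the atlas $$\operatorname{Im}(\partial_{\bar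 z}\rho)=He^u\operatorname{Im}c,\tag{a}$$ $$|c|^{-2}|\phi|^2-|c|^{-2}e^{-2u}|Q|^2+H(\bar c-2c)e^u+\partial_z(c^{-1}\bar\phi)-\partial_{\bar z}(c^{-1}\phi)-\partial_z\partial_{\bar z}(\log c+u)=0,\tag{b}$$ $$(c^{-1}-\bar c^{-1})(e^u\bar\phi^2-H\bar Q\phi)-e^u\bar\phi\,\partial_{\bar z}\log|c|^2+e^u(\partial_{\bar z}\bar\phi-\bar\phi\,\partial_{\bar z}u)-H\,\partial_z\bar Q=0.\tag{c}$$ (2) Conversely, let $M$ be a simply connected Riemann surface with a smooth definite conformal metric $2He^u|dz|^2$ ($H\in\{1,-1\}$ constant), a smooth function $\theta:M\to(0,\pi)$, a smooth form $\phi\,dz$ and a smooth cubic form $Q\,dz^3$, and suppose that (b) and (c) hold in every coordinate of the atlas. Then there is a smooth immersion $f:M\to\mathbb{D}P^2$ with induced metric $2He^u|dz|^2$, para-Kähler angle $\theta$, mean curvature form $\phi\,dz$ and cubic form $Q\,dz^3$. It has a global lift, and every smooth form $\rho\,dz$ on $M$ that satisfies (a) is the form $\langle\partial_zx,\chi\rangle\,dz$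 of some global lift of $f$. The immersion is unique up to isometries of $\mathbb{D}P^2$: if $f'$ is another smooth immersion with the same invariants, then $f'=\Phi\circ f$ for an isometry $\Phi$ of $\mathbb{D}P^2$, which can be taken of the form $([x],[\chi])\mapsto([Ax],[A^{-T}\chi])$ with $A\in \mathrm{SL}(3,\mathbb R)$. -/

import Mathlib

open scoped ContDiff Manifold Topology Matrix

noncomputable section

namespace DefiniteSurface

/-! ### The para-complex projective plane, the quadric and the projection -/

/-- `ℝ³`, and also its dual space; the pairing of the two is the dot product `x ⬝ᵥ χ`. -/
abbrev Vec : Type := Fin 3 → ℝ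

/-- The para-complex projective plane: pairs `([x], [χ])` of a point of the real projective plane
and a point of the dual projective plane that have representatives with `⟨x, χ⟩ > 0`. -/
def DP2 : Type :=
  {p : Projectivization ℝ Vec × Projectivization ℝ Vec //
    ∃ (x χ : Vec) (hx : x ≠ 0) (hχ : χ ≠ 0),
      Projectivization.mk ℝ x hx = p.1 ∧ Projectivization.mk ℝ χ hχ = p.2 ∧ 0 < x ⬝ᵥ χ}

/-- The quadric `⟨x, χ⟩ = 1` in `ℝ³ × ℝ₃`. -/
def CM5 : Set (Vec × Vec) := {s | s.1 ⬝ᵥ s.2 = 1}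

theorem CM5.fst_ne_zero (s : CM5) : s.1.1 ≠ 0 := by
  intro h
  have h1 : s.1.1 ⬝ᵥ s.1.2 = 1 := s.2
  simp [h] at h1

theorem CM5.snd_ne_zero (s : CM5) : s.1.2 ≠ 0 := by
  intro h
  have h1 : s.1.1 ⬝ᵥ s.1.2 = 1 := s.2
  simp [h] at h1

/-- The projection `(x, χ) ↦ ([x], [χ])` of the quadric onto the para-complex projective plane. -/
def proj (s : CM5) : DP2 :=
  ⟨(Projectivization.mk ℝ s.1.1 (CM5.fst_ne_zero s),
    Projectivization.mk ℝ s.1.2 (CM5.snd_ne_zero s)),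
    s.1.1, s.1.2, CM5.fst_ne_zero s, CM5.snd_ne_zero s, rfl, rfl, by
      have h1 : s.1.1 ⬝ᵥ s.1.2 = 1 := s.2
      rw [h1]; exact one_pos⟩

/-! ### Lifts and the para-Hermitian form

`proj` is a submersion of the quadric onto `DP2`, so that a `DP2`-valued map is smooth near a point
exactly when it has a smooth lift to the quadric near that point. -/

section Lifts

variable {E : Type*} [NormedAddCommGroup E] [NormedSpace ℝ E]

/-- `s` is a smooth lift of `F` to the quadric near `p`. -/
def IsLocalLiftAt (F : E → DP2) (s : E → CM5) (p : E) : Prop :=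
  ContDiffAt ℝ ∞ (fun q => (s q : Vec × Vec)) p ∧ ∀ᶠ q in 𝓝 p, proj (s q) = F q

/-- A `DP2`-valued map that is smooth near `p`. -/
def SmoothNear (F : E → DP2) (p : E) : Prop := ∃ s : E → CM5, IsLocalLiftAt F s p

/-- The component in `ℝ³` of the differential of a map `s = (x, χ)` into the quadric. -/
def dx (s : E → CM5) (p v : E) : Vec := fderiv ℝ (fun q => (s q).1.1) p v

/-- The component in `ℝ₃` of the differential of a map `s = (x, χ)` into the quadric. -/
def dχ (s : E → CM5) (p v : E) : Vec := fderiv ℝ (fun q => (s q).1.2) p v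

/-- `ξ(v) = dx(v) - ⟨dx(v), χ⟩ x`: the first component of the horizontal part of `ds(v)`. -/
def xi (s : E → CM5) (p v : E) : Vec := dx s p v - (dx s p v ⬝ᵥ (s p).1.2) • (s p).1.1

/-- `η(v) = dχ(v) - ⟨x, dχ(v)⟩ χ`: the second component of the horizontal part of `ds(v)`. -/
def eta (s : E → CM5) (p v : E) : Vec := dχ s p v - ((s p).1.1 ⬝ᵥ dχ s p v) • (s p).1.2

/-- The pull-back `h(v, w) = ⟨ξ(v), η(w)⟩` of the para-Hermitian form `g + ω` of `DP2`
under `proj ∘ s`. -/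
def hForm (s : E → CM5) (p v w : E) : ℝ := xi s p v ⬝ᵥ eta s p w

/-- The pull-back of the metric `g` of `DP2`: the symmetric part of `h`. -/
def gForm (s : E → CM5) (p v w : E) : ℝ := (hForm s p v w + hForm s p w v) / 2

/-- The pull-back of the symplectic form `ω` of `DP2`: the skew-symmetric part of `h`. -/
def omegaForm (s : E → CM5) (p v w : E) : ℝ := (hForm s p v w - hForm s p w v) / 2

end Lifts

/-! ### Isometries of the para-complex projective plane -/

/-- A smooth self-map of `DP2`: it maps smooth parametrized pieces of `DP2`
(in particular local charts) to smooth ones. -/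
def SmoothSelfMap (Φ : DP2 → DP2) : Prop :=
  ∀ (k : ℕ) (F : EuclideanSpace ℝ (Fin k) → DP2) (p : EuclideanSpace ℝ (Fin k)),
    SmoothNear F p → SmoothNear (Φ ∘ F) p

/-- `Φ` pulls the metric of `DP2` back to itself. -/
def PreservesMetric (Φ : DP2 → DP2) : Prop :=
  ∀ (k : ℕ) (F : EuclideanSpace ℝ (Fin k) → DP2) (p : EuclideanSpace ℝ (Fin k))
    (s s' : EuclideanSpace ℝ (Fin k) → CM5),
    IsLocalLiftAt F s p → IsLocalLiftAt (Φ ∘ F) s' p →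
      ∀ v w, gForm s' p v w = gForm s p v w

/-- An isometry of `DP2`: a diffeomorphism that preserves the metric. -/
def IsIsometryDP2 (Φ : DP2 → DP2) : Prop :=
  (∃ Ψ : DP2 → DP2, Function.LeftInverse Ψ Φ ∧ Function.RightInverse Ψ Φ ∧
    SmoothSelfMap Φ ∧ SmoothSelfMap Ψ) ∧ PreservesMetric Φ

theorem mulVec_injective_of_inv {A B : Matrix (Fin 3) (Fin 3) ℝ} (h : B * A = 1) :
    Function.Injective (Matrix.mulVecLin A) := by
  intro v w hvw
  have h1 : A *ᵥ v = A *ᵥ w := hvw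
  have h2 := congrArg (fun t => B *ᵥ t) h1
  simpa [Matrix.mulVec_mulVec, h] using h2

theorem inv_mul_coe (A : Matrix.SpecialLinearGroup (Fin 3) ℝ) :
    ((A⁻¹ : Matrix.SpecialLinearGroup (Fin 3) ℝ) : Matrix (Fin 3) (Fin 3) ℝ) *
      (A : Matrix (Fin 3) (Fin 3) ℝ) = 1 := by
  rw [← Matrix.SpecialLinearGroup.coe_mul, inv_mul_cancel, Matrix.SpecialLinearGroup.coe_one]

theorem transpose_mul_inv_transpose (A : Matrix.SpecialLinearGroup (Fin 3) ℝ) :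
    (A : Matrix (Fin 3) (Fin 3) ℝ)ᵀ *
      ((A⁻¹ : Matrix.SpecialLinearGroup (Fin 3) ℝ) : Matrix (Fin 3) (Fin 3) ℝ)ᵀ = 1 := by
  rw [← Matrix.transpose_mul, inv_mul_coe, Matrix.transpose_one]

/-- The action `([x], [χ]) ↦ ([A x], [A⁻ᵀ χ])` of `SL(3, ℝ)` on `DP2`. -/
def act (A : Matrix.SpecialLinearGroup (Fin 3) ℝ) (p : DP2) : DP2 :=
  ⟨(Projectivization.map (Matrix.mulVecLin (A : Matrix (Fin 3) (Fin 3) ℝ))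
      (mulVec_injective_of_inv (inv_mul_coe A)) p.1.1,
    Projectivization.map (Matrix.mulVecLin
      ((A⁻¹ : Matrix.SpecialLinearGroup (Fin 3) ℝ) : Matrix (Fin 3) (Fin 3) ℝ)ᵀ)
      (mulVec_injective_of_inv (transpose_mul_inv_transpose A)) p.1.2), by
    obtain ⟨x, χ, hx, hχ, h1, h2, h3⟩ := p.2
    refine ⟨(A : Matrix (Fin 3) (Fin 3) ℝ) *ᵥ x,
      ((A⁻¹ : Matrix.SpecialLinearGroup (Fin 3) ℝ) : Matrix (Fin 3) (Fin 3) ℝ)ᵀ *ᵥ χ,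
      fun h => hx ?_, fun h => hχ ?_, ?_, ?_, ?_⟩
    · exact mulVec_injective_of_inv (inv_mul_coe A) (h.trans (map_zero _).symm)
    · exact mulVec_injective_of_inv (transpose_mul_inv_transpose A)
        (h.trans (map_zero _).symm)
    · rw [← h1]; rfl
    · rw [← h2]; rfl
    · rw [Matrix.mulVec_transpose, dotProduct_comm, ← Matrix.dotProduct_mulVec,
        Matrix.mulVec_mulVec, inv_mul_coe, Matrix.one_mulVec, dotProduct_comm]
      exact h3⟩

/-! ### Invariants in a complex coordinate `z` -/

/-- `∂_z = (∂₁ - i ∂₂) / 2`. -/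
def dz (f : ℂ → ℂ) (z : ℂ) : ℂ := (fderiv ℝ f z 1 - Complex.I * fderiv ℝ f z Complex.I) / 2

/-- `∂_{z̄} = (∂₁ + i ∂₂) / 2`. -/
def dzbar (f : ℂ → ℂ) (z : ℂ) : ℂ := (fderiv ℝ f z 1 + Complex.I * fderiv ℝ f z Complex.I) / 2

/-- `ξ_z = (ξ₁ - i ξ₂) / 2`. -/
def xiC (s : ℂ → CM5) (z : ℂ) : Fin 3 → ℂ :=
  fun i => ((xi s z 1 i : ℂ) - Complex.I * (xi s z Complex.I i : ℂ)) / 2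

/-- `η_z = (η₁ - i η₂) / 2`. -/
def etaC (s : ℂ → CM5) (z : ℂ) : Fin 3 → ℂ :=
  fun i => ((eta s z 1 i : ℂ) - Complex.I * (eta s z Complex.I i : ℂ)) / 2

/-- `ρ = ⟨∂_z x, χ⟩`. -/
def rhoOf (s : ℂ → CM5) (z : ℂ) : ℂ :=
  (fun i => dz (fun w => ((s w).1.1 i : ℂ)) z) ⬝ᵥ (fun i => ((s z).1.2 i : ℂ))

/-- The para-Kähler angle `θ = arctan (b / a) + π / 2`, where `a = g(∂₁, ∂₁)`
and `b = ω(∂₁, ∂₂)`. -/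
def angleOf (s : ℂ → CM5) (z : ℂ) : ℝ :=
  Real.arctan (omegaForm s z 1 Complex.I / gForm s z 1 1) + Real.pi / 2

/-- `φ = H e^{-u} ⟨∂_{z̄} ξ, η⟩`. -/
def phiOf (H : ℝ) (u : ℂ → ℝ) (s : ℂ → CM5) (z : ℂ) : ℂ :=
  (H * Real.exp (-u z) : ℝ) * ((fun i => dzbar (fun w => xiC s w i) z) ⬝ᵥ etaC s z)

/-- `Q = ⟨∂_z ξ, η⟩`. -/
def cubicOf (s : ℂ → CM5) (z : ℂ) : ℂ := (fun i => dz (fun w => xiC s w i) z) ⬝ᵥ etaC s z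

/-! ### The compatibility equations in a complex coordinate -/

/-- `c = 1 + i tan (θ - π / 2)`. -/
def cOf (θ : ℂ → ℝ) (z : ℂ) : ℂ := 1 + Complex.I * (Real.tan (θ z - Real.pi / 2) : ℝ)

/-- `Im ∂_{z̄} ρ = H e^u Im c`. -/
def CompRho (H : ℝ) (u θ : ℂ → ℝ) (ρ : ℂ → ℂ) (z : ℂ) : Prop :=
  (dzbar ρ z).im = H * Real.exp (u z) * (cOf θ z).im

/-- `|c|⁻²|φ|² - |c|⁻² e^{-2u} |Q|² + H (c̄ - 2c) e^u + ∂_z (c⁻¹ φ̄) - ∂_{z̄} (c⁻¹ φ)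
  - ∂_z ∂_{z̄} (log c + u) = 0`. -/
def Comp1 (H : ℝ) (u θ : ℂ → ℝ) (φ Q : ℂ → ℂ) (z : ℂ) : Prop :=
  ((‖cOf θ z‖ ^ 2)⁻¹ * ‖φ z‖ ^ 2
      - (‖cOf θ z‖ ^ 2)⁻¹ * Real.exp (-2 * u z) * ‖Q z‖ ^ 2 : ℝ)
    + H * (star (cOf θ z) - 2 * cOf θ z) * (Real.exp (u z) : ℝ)
    + dz (fun w => (cOf θ w)⁻¹ * star (φ w)) z
    - dzbar (fun w => (cOf θ w)⁻¹ * φ w) z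
    - dz (dzbar (fun w => Complex.log (cOf θ w) + (u w : ℂ))) z = 0

/-- `(c⁻¹ - c̄⁻¹) (e^u φ̄² - H Q̄ φ) - e^u φ̄ ∂_{z̄} log |c|²
  + e^u (∂_{z̄} φ̄ - φ̄ ∂_{z̄} u) - H ∂_z Q̄ = 0`. -/
def Comp2 (H : ℝ) (u θ : ℂ → ℝ) (φ Q : ℂ → ℂ) (z : ℂ) : Prop :=
  ((cOf θ z)⁻¹ - (star (cOf θ z))⁻¹)
      * ((Real.exp (u z) : ℝ) * star (φ z) ^ 2 - H * star (Q z) * φ z)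
    - (Real.exp (u z) : ℝ) * star (φ z) * dzbar (fun w => (Real.log (‖cOf θ w‖ ^ 2) : ℂ)) z
    + (Real.exp (u z) : ℝ)
      * (dzbar (fun w => star (φ w)) z - star (φ z) * dzbar (fun w => (u w : ℂ)) z)
    - H * dz (fun w => star (Q w)) z = 0

/-! ### Data and immersions on a Riemann surface

Geometric objects on a Riemann surface `M` are given by their coefficients in the charts `e` of the
atlas; the coefficient in the chart `e` is a function on `e.target`, and values of it outside
`e.target` play no role. -/

section Surface

variable {M : Type*} [TopologicalSpace M] [ChartedSpace ℂ M]

/-- `q` is a smooth differential `q dz^k` on `M`: a smooth coefficient in every chart, transforming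
by `q = (q' ∘ τ) (τ')^k` under a change `τ` of the complex coordinate. -/
def IsDifferential (k : ℕ) (q : OpenPartialHomeomorph M ℂ → ℂ → ℂ) : Prop :=
  (∀ e ∈ atlas ℂ M, ContDiffOn ℝ ∞ (q e) e.target) ∧
  ∀ e ∈ atlas ℂ M, ∀ e' ∈ atlas ℂ M, ∀ z ∈ e.target, e.symm z ∈ e'.source →
    q e z = q e' (e' (e.symm z)) * deriv (e' ∘ e.symm) z ^ k

/-- A sign `H`, chart coefficients `u` of a metric `2 H e^u |dz|²`, a real function `θ`, and chart
coefficients of `φ dz` and `Q dz³`. -/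
structure SurfaceData (M : Type*) [TopologicalSpace M] where
  H : ℝ
  u : OpenPartialHomeomorph M ℂ → ℂ → ℝ
  θ : M → ℝ
  φ : OpenPartialHomeomorph M ℂ → ℂ → ℂ
  Q : OpenPartialHomeomorph M ℂ → ℂ → ℂ

/-- The data consist of a smooth definite conformal metric `2 H e^u |dz|²` on `M`, a smooth function
`θ : M → (0, π)`, a smooth form `φ dz` and a smooth cubic form `Q dz³`. -/
structure SurfaceData.IsGeometric (D : SurfaceData M) : Prop where
  sign : D.H = 1 ∨ D.H = -1
  smooth_u : ∀ e ∈ atlas ℂ M, ContDiffOn ℝ ∞ (D.u e) e.target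
  metric : ∀ e ∈ atlas ℂ M, ∀ e' ∈ atlas ℂ M, ∀ z ∈ e.target, e.symm z ∈ e'.source →
    Real.exp (D.u e z) =
      Real.exp (D.u e' (e' (e.symm z))) * ‖deriv (e' ∘ e.symm) z‖ ^ 2
  smooth_θ : ∀ e ∈ atlas ℂ M, ContDiffOn ℝ ∞ (D.θ ∘ e.symm) e.target
  range_θ : ∀ p, D.θ p ∈ Set.Ioo 0 Real.pi
  form_φ : IsDifferential 1 D.φ
  form_Q : IsDifferential 3 D.Q

/-- The two compatibility equations for `(H, u, θ, φ, Q)`, in every chart. -/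
def SurfaceData.Compatible (D : SurfaceData M) : Prop :=
  ∀ e ∈ atlas ℂ M, ∀ z ∈ e.target,
    Comp1 D.H (D.u e) (D.θ ∘ e.symm) (D.φ e) (D.Q e) z ∧
    Comp2 D.H (D.u e) (D.θ ∘ e.symm) (D.φ e) (D.Q e) z

/-- The compatibility equation between `ρ dz` and `(H, u, θ)`, in every chart. -/
def SurfaceData.CompatibleRho (D : SurfaceData M)
    (ρ : OpenPartialHomeomorph M ℂ → ℂ → ℂ) : Prop :=
  ∀ e ∈ atlas ℂ M, ∀ z ∈ e.target, CompRho D.H (D.u e) (D.θ ∘ e.symm) (ρ e) z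

/-- A smooth immersion `M → DP2`. (The differential of `f` at a point vanishes on `v` exactly when
the horizontal part of the differential of a lift does.) -/
def IsImmersionDP2 (f : M → DP2) : Prop :=
  ∀ e ∈ atlas ℂ M, ∀ z ∈ e.target, SmoothNear (f ∘ e.symm) z ∧
    ∀ s : ℂ → CM5, IsLocalLiftAt (f ∘ e.symm) s z →
      ∀ v : ℂ, xi s z v = 0 → eta s z v = 0 → v = 0

/-- `s` is a (global, smooth) lift of `f` to the quadric. -/
def IsLift (f : M → DP2) (s : M → CM5) : Prop :=
  (∀ p, proj (s p) = f p) ∧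
  ∀ e ∈ atlas ℂ M, ContDiffOn ℝ ∞ (fun z => (s (e.symm z) : Vec × Vec)) e.target

/-- The map `f` induces the definite metric `2 H e^u |dz|²` and has para-Kähler angle `θ`,
mean curvature form `φ dz` and cubic form `Q dz³`. The invariants are computed from a local lift of
`f`; they do not depend on the choice of the lift. -/
structure HasInvariants (f : M → DP2) (D : SurfaceData M) : Prop where
  sign : D.H = 1 ∨ D.H = -1
  metric : ∀ e ∈ atlas ℂ M, ∀ z ∈ e.target, ∀ s : ℂ → CM5, IsLocalLiftAt (f ∘ e.symm) s z →
    ∀ v w : ℂ, gForm s z v w = 2 * D.H * Real.exp (D.u e z) * (v * star w).re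
  angle : ∀ e ∈ atlas ℂ M, ∀ z ∈ e.target, ∀ s : ℂ → CM5, IsLocalLiftAt (f ∘ e.symm) s z →
    D.θ (e.symm z) = angleOf s z
  meanCurvature : ∀ e ∈ atlas ℂ M, ∀ z ∈ e.target, ∀ s : ℂ → CM5,
    IsLocalLiftAt (f ∘ e.symm) s z → D.φ e z = phiOf D.H (D.u e) s z
  cubic : ∀ e ∈ atlas ℂ M, ∀ z ∈ e.target, ∀ s : ℂ → CM5,
    IsLocalLiftAt (f ∘ e.symm) s z → D.Q e z = cubicOf s z

end Surface

end DefiniteSurface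

end

open scoped Manifold ContDiff
open DefiniteSurface

/-! A lift carries the frame F = (x, ξ_z, conj ξ_z) of ℂ³. In complex form the invariants say
exactly ⟨ξ_z, η_z⟩ = 0, ⟨ξ_z, conj η_z⟩ = He^u c, ⟨∂_z̄ ξ_z, η_z⟩ = He^u φ and ⟨∂_z ξ_z, η_z⟩ = Q
(`AdaptedAt`, `invariantsAt_iff`). Up to factors, χ, conj η_z, η_z form the dual frame, so these
pairings and ρ determine every derivative of F: ∂_z F = F U and ∂_z̄ F = F V with U = `connZ` and V
its conjugate `connZbar` (`AdaptedAt.dzM_frame`). Conversely, the first column of a solution F with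
the right reality property, and the first row of its inverse, form a lift with the given invariants
(`exists_local_lift`).

The integrability condition is the vanishing of a curvature matrix. Conjugation symmetry leaves five
entries; two vanish identically, and the others give (a), then (b) once (a) holds, and (c) up to a
nonvanishing factor (`LocalData.RegularAt.flatAt_iff`). For an existing lift, equality of mixed
derivatives therefore gives part (1). For given data, Frobenius' theorem (`exists_flat_section`)
gives local lifts, and two local lifts with the same ρ differ by a constant real invertible matrix
(`local_lift_unique`). These matrices form a locally constant cocycle, which on a simply connected
surface is a coboundary, so that local lifts can be glued (`exists_global_lift`).

A global form satisfying (a) is needed to start. The imaginary part of (b) says that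
`LocalData.rhoCan` is one. Geometrically, it is the form of every lift normalized by |det F| = e^u
(`NormalizedAt.rhoOf_eq`). Normalization also gives uniqueness: normalized lifts of two immersions
with the same invariants share ρ, so locally they differ by a real matrix of determinant ±1, which
acts on the projective planes like an element of SL(3, ℝ). That element is unique, hence locally
constant, hence constant (`exists_eq_act`). For any other ρ satisfying (a), the same construction
gives a congruent immersion, and moving its lift by the congruence produces a lift of the original
one. -/

open scoped Manifold ContDiff
open DefiniteSurface

/-! ### Locally constant cocycles on simply connected spaces. -/

/-- A locally constant cocycle on a simply connected space is a coboundary. -/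
theorem exists_trivialization_of_locallyConstant_cocycle {M ι Γ : Type*} [TopologicalSpace M]
    [SimplyConnectedSpace M] [LocallyPathConnectedSpace M] [Group Γ]
    (U : ι → Set M) (hU : ∀ i, IsOpen (U i)) (cov : ∀ x, ∃ i, x ∈ U i) (g : ι → ι → M → Γ)
    (hself : ∀ i, ∀ x ∈ U i, g i i x = 1)
    (hcomp : ∀ i j k x, x ∈ U i → x ∈ U j → x ∈ U k → g i j x * g j k x = g i k x)
    (hloc : ∀ i j x, x ∈ U i → x ∈ U j → ∀ᶠ y in 𝓝 x, g i j y = g i j x) :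
    ∃ b : ι → M → Γ, (∀ i j x, x ∈ U i → x ∈ U j → b i x * g i j x = b j x) ∧
      ∀ i x, x ∈ U i → ∀ᶠ y in 𝓝 x, b i y = b i x := by
  classical
  let _ : TopologicalSpace Γ := ⊥
  have _ : DiscreteTopology Γ := ⟨rfl⟩
  choose ix hix using cov
  -- With discrete fibre Γ the bundle is a covering. The transition functions multiply on the right,
  -- so that the coordinates b i of a section satisfy b i * g i j = b j.
  let Z : FiberBundleCore ι M Γ :=
    { baseSet := U
      isOpen_baseSet := hU
      indexAt := ix
      mem_baseSet_at := hix
      coordChange := fun i j x v => v * g i j x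
      coordChange_self := fun i x hx v => by simp [hself i x hx]
      continuousOn_coordChange := by
        intro i j p hp
        have h1 : ∀ᶠ y in 𝓝 p.1, g i j y = g i j p.1 := hloc i j p.1 hp.1.1 hp.1.2
        have h2 : ∀ᶠ q in 𝓝 p, q.1 ∈ {y | g i j y = g i j p.1} :=
          continuous_fst.continuousAt.eventually h1
        have h3 : ∀ᶠ q in 𝓝 p, q.2 ∈ ({p.2} : Set Γ) :=
          continuous_snd.continuousAt.eventually ((isOpen_discrete _).mem_nhds rfl)
        apply ContinuousAt.continuousWithinAt
        refine (continuousAt_const (y := p.2 * g i j p.1)).congr ?_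
        filter_upwards [h2, h3] with q hq hq'
        rw [Set.mem_singleton_iff] at hq'
        change g i j q.1 = g i j p.1 at hq
        rw [hq, hq']
      coordChange_comp := by
        intro i j k x hx v
        rw [mul_assoc, hcomp i j k x hx.1.1 hx.1.2 hx.2] }
  have hcov : IsCoveringMap (Bundle.TotalSpace.proj (F := Γ) (E := Z.Fiber)) :=
    FiberBundle.isCoveringMap
  obtain ⟨x₀⟩ : Nonempty M := inferInstance
  -- Simple connectedness lifts the identity of M to a global section; its coordinates in the
  -- trivializations are the required functions, locally constant because Γ is discrete.
  obtain ⟨σ, ⟨-, hσ⟩, -⟩ := hcov.existsUnique_continuousMap_lifts (ContinuousMap.id M) x₀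
    (⟨x₀, (1 : Γ)⟩ : Bundle.TotalSpace Γ Z.Fiber) rfl
  have hσ' : ∀ x, (σ x).proj = x := fun x => congrFun hσ x
  refine ⟨fun i x => (Z.localTriv i (σ x)).2, ?_, ?_⟩
  · intro i j x hi hj
    have h3 : (σ x).proj = x := hσ' x
    let v : Γ := (σ x).2
    change v * g (ix (σ x).proj) i (σ x).proj * g i j x = v * g (ix (σ x).proj) j (σ x).proj
    rw [mul_assoc, h3, hcomp _ _ _ _ (hix x) hi hj]
  · intro i x hx
    have h1 : ContinuousAt (Z.localTriv i) (σ x) := by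
      apply (Z.localTriv i).continuousAt
      rw [Z.mem_localTriv_source, hσ' x]
      exact hx
    have h2 : ContinuousAt (fun y => (Z.localTriv i (σ y)).2) x :=
      continuousAt_snd.comp (ContinuousAt.comp (g := Z.localTriv i) h1 σ.continuous.continuousAt)
    exact h2.eventually ((isOpen_discrete {(Z.localTriv i (σ x)).2}).mem_nhds rfl)

/-! ### Integrable linear systems dF = F Ω in a Banach algebra. -/

section Frobenius

variable {E R : Type*} [NormedAddCommGroup E] [NormedSpace ℝ E] [NormedRing R] [NormedAlgebra ℝ R]

/-- The linear equation `Y' = Y A` on `[0, 1]` is solvable when `A` is small. -/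
theorem exists_linear_ode_solution [CompleteSpace R] (A : ℝ → R) (hA : ContinuousOn A (Set.Icc 0 1))
    (hb : ∀ t ∈ Set.Icc (0 : ℝ) 1, ‖A t‖ ≤ 1 / 2) :
    ∃ Y : ℝ → R, Y 0 = 1 ∧ ∀ t ∈ Set.Icc (0 : ℝ) 1,
      HasDerivWithinAt Y (Y t * A t) (Set.Icc 0 1) t := by
  have hN : 0 ≤ ‖(1 : R)‖ + 1 := by positivity
  -- On the ball of radius ‖1‖ + 1 about 1 one has ‖Y‖ ≤ 2‖1‖ + 1, hence ‖Y A‖ ≤ ‖1‖ + 1. The speed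
  -- bound equals the radius, so the solution exists for the whole unit time.
  have hpl : IsPicardLindelof (fun t (Y : R) => Y * A t) (tmin := 0) (tmax := 1)
      ⟨0, by simp⟩ (1 : R) (⟨‖(1 : R)‖ + 1, hN⟩ : NNReal) 0 ⟨‖(1 : R)‖ + 1, hN⟩ (1 / 2) := by
    refine ⟨fun t ht => ?_, fun x _ => ContinuousOn.mul (continuousOn_const (c := x)) hA, fun t ht x hx => ?_, ?_⟩
    · refine LipschitzWith.lipschitzOnWith (LipschitzWith.of_dist_le_mul fun x y => ?_)
      rw [dist_eq_norm, dist_eq_norm, ← sub_mul]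
      refine (norm_mul_le _ _).trans ?_
      have := hb t ht
      rw [mul_comm]
      refine mul_le_mul_of_nonneg_right ?_ (norm_nonneg _)
      simpa using this
    · have h1 : ‖x‖ ≤ ‖x - 1‖ + ‖(1 : R)‖ := by simpa using norm_add_le (x - 1) (1 : R)
      rw [mem_closedBall_iff_norm] at hx
      have h2 : ‖x - 1‖ ≤ ‖(1 : R)‖ + 1 := hx
      change ‖x * A t‖ ≤ ‖(1 : R)‖ + 1
      have h3 := norm_mul_le x (A t)
      have h4 := hb t ht
      nlinarith [norm_nonneg x, norm_nonneg (A t), norm_nonneg (1 : R)]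
    · simp
  exact hpl.exists_eq_forall_mem_Icc_hasDerivWithinAt₀

/-- The Grönwall estimates below ask for right derivatives. -/
theorem HasDerivWithinAt.Ici_of_Icc {Y : ℝ → R} {Y' : R} {t : ℝ}
    (h : HasDerivWithinAt Y Y' (Set.Icc 0 1) t) (ht : t ∈ Set.Ico (0 : ℝ) 1) :
    HasDerivWithinAt Y Y' (Set.Ici t) t := by
  refine h.mono_of_mem_nhdsWithin ?_
  exact Filter.mem_of_superset (Icc_mem_nhdsGE ht.2)
    (Set.Icc_subset_Icc_left ht.1)

/-- The radial solution of a flat linear system solves it. -/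
theorem exists_flat_section_of_bounds [CompleteSpace R] (Ω : E → E →L[ℝ] R) (D : E → E →L[ℝ] E →L[ℝ] R) (z₀ : E)
    (r B K₁ K₂ : ℝ) (hr : 0 < r) (hB : 0 ≤ B) (hK₁ : 0 ≤ K₁) (hK₂ : 0 ≤ K₂)
    (hD : ∀ w ∈ Metric.ball z₀ r, HasFDerivAt Ω (D w) w)
    (hΩ : ∀ w ∈ Metric.ball z₀ r, ‖Ω w‖ ≤ B)
    (h₁ : ∀ w ∈ Metric.ball z₀ r, ∀ w' ∈ Metric.ball z₀ r, ‖Ω w' - Ω w‖ ≤ K₁ * ‖w' - w‖)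
    (h₂ : ∀ w ∈ Metric.ball z₀ r, ∀ w' ∈ Metric.ball z₀ r,
      ‖Ω w' - Ω w - D w (w' - w)‖ ≤ K₂ * ‖w' - w‖ ^ 2)
    (flat : ∀ w ∈ Metric.ball z₀ r, ∀ v v', Ω w v * Ω w v' + D w v v' =
      Ω w v' * Ω w v + D w v' v)
    (hBr : B * r ≤ 1 / 2) :
    ∃ F : E → R, F z₀ = 1 ∧ ∀ z ∈ Metric.ball z₀ r,
      HasFDerivAt F ((ContinuousLinearMap.mul ℝ R (F z)).comp (Ω z)) z := by
  have hmem : ∀ y : E, ‖y‖ < r → ∀ t ∈ Set.Icc (0 : ℝ) 1, z₀ + t • y ∈ Metric.ball z₀ r := by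
    intro y hy t ht
    rw [mem_ball_iff_norm, add_sub_cancel_left, norm_smul, Real.norm_of_nonneg ht.1]
    nlinarith [ht.2, norm_nonneg y]
  have hcurve : ∀ (y : E) (t : ℝ), HasDerivAt (fun t : ℝ => z₀ + t • y) y t := by
    intro y t
    simpa using ((hasDerivAt_id t).smul_const y).const_add z₀
  have hder : ∀ y : E, ‖y‖ < r → ∀ t ∈ Set.Icc (0 : ℝ) 1,
      HasDerivAt (fun t : ℝ => Ω (z₀ + t • y)) (D (z₀ + t • y) y) t := fun y hy t ht =>
    (hD _ (hmem y hy t ht)).comp_hasDerivAt t (hcurve y t)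
  -- The system is solved along each ray from z₀; F(z₀ + y) is the value at time 1 of the solution
  -- along the ray to z₀ + y.
  have hex : ∀ y : E, ‖y‖ < r → ∃ Y : ℝ → R, Y 0 = 1 ∧ ∀ t ∈ Set.Icc (0 : ℝ) 1,
      HasDerivWithinAt Y (Y t * Ω (z₀ + t • y) y) (Set.Icc 0 1) t := by
    intro y hy
    refine exists_linear_ode_solution (fun t => Ω (z₀ + t • y) y) ?_ ?_
    · intro t ht
      exact ((hder y hy t ht).continuousAt.clm_apply continuousAt_const).continuousWithinAt
    · intro t ht
      refine ((Ω _).le_opNorm y).trans ?_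
      have := hΩ _ (hmem y hy t ht)
      nlinarith [norm_nonneg y, norm_nonneg (Ω (z₀ + t • y))]
  choose! Y hY0 hY using hex
  have hYc : ∀ y : E, ‖y‖ < r → ContinuousOn (Y y) (Set.Icc 0 1) := fun y hy t ht =>
    (hY y hy t ht).continuousWithinAt
  refine ⟨fun z => Y (z - z₀) 1, ?_, ?_⟩
  · have h0 : ‖(0 : E)‖ < r := by simpa using hr
    have h3 := eq_zero_of_abs_deriv_le_mul_abs_self_of_eq_zero_right (f := fun t => Y 0 t - 1)
      (f' := fun t => Y 0 t * Ω (z₀ + t • (0 : E)) 0) (K := 0) (a := 0) (b := 1)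
      ((hYc 0 h0).sub continuousOn_const)
      (fun t ht => ((hY 0 h0 t ⟨ht.1, ht.2.le⟩).Ici_of_Icc ht).sub_const 1)
      (by simp [hY0 0 h0]) (fun t _ => by simp) 1 (by simp)
    simpa [sub_eq_zero] using h3
  · intro z hz
    obtain ⟨y, rfl⟩ : ∃ y, z = z₀ + y := ⟨z - z₀, by abel⟩
    have hy : ‖y‖ < r := by simpa [mem_ball_iff_norm] using hz
    obtain ⟨C, hC⟩ := isCompact_Icc.exists_bound_of_continuousOn (hYc y hy)
    have hC0 : 0 ≤ C := (norm_nonneg _).trans (hC 0 (by simp))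
    -- The solution along the ray to y + h is compared with the first-order guess Y_y(t)(1 + t Ω(z₀
    -- + t y)h). The guess solves the equation of the new ray up to an error of order ‖h‖², and
    -- Grönwall's inequality bounds the difference at time 1. In the constant, C bounds Y_y, K₂ r
    -- comes from the Taylor remainder of Ω applied to y, K₁ from the increment of Ω applied to h,
    -- and B(K₁ r + B) from the products of values of Ω.
    have key : ∀ h : E, ‖y + h‖ < r →
        ‖Y (y + h) 1 - Y y 1 * (1 + Ω (z₀ + y) h)‖ ≤
          gronwallBound 0 (1 / 2) (C * (K₂ * r + K₁ + B * (K₁ * r + B))  * ‖h‖ ^ 2) 1 := by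
      intro h hyh
      have hlip : ∀ t ∈ Set.Ico (0 : ℝ) 1,
          LipschitzOnWith (1 / 2) (fun Z : R => Z * Ω (z₀ + t • (y + h)) (y + h)) Set.univ := by
        intro t ht
        refine LipschitzWith.lipschitzOnWith (LipschitzWith.of_dist_le_mul fun Z Z' => ?_)
        rw [dist_eq_norm, dist_eq_norm, ← sub_mul]
        refine (norm_mul_le _ _).trans ?_
        rw [mul_comm]
        refine mul_le_mul_of_nonneg_right ?_ (norm_nonneg _)
        have h5 := (Ω (z₀ + t • (y + h))).le_opNorm (y + h)
        have h6 := hΩ _ (hmem _ hyh t ⟨ht.1, ht.2.le⟩)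
        have : ‖Ω (z₀ + t • (y + h)) (y + h)‖ ≤ 1 / 2 := by
          nlinarith [norm_nonneg (y + h), norm_nonneg (Ω (z₀ + t • (y + h)))]
        simpa using this
      have hE : ∀ t ∈ Set.Icc (0 : ℝ) 1,
          HasDerivWithinAt (fun t => Y y t * (1 + t • Ω (z₀ + t • y) h))
            (Y y t * Ω (z₀ + t • y) y * (1 + t • Ω (z₀ + t • y) h) +
              Y y t * (t • D (z₀ + t • y) y h + (1 : ℝ) • Ω (z₀ + t • y) h))
            (Set.Icc 0 1) t := by
        intro t ht
        have h7 : HasDerivAt (fun t : ℝ => Ω (z₀ + t • y) h) (D (z₀ + t • y) y h) t := by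
          simpa using (hder y hy t ht).clm_apply (hasDerivAt_const t h)
        exact (hY y hy t ht).mul (((hasDerivAt_id t).smul h7).const_add 1).hasDerivWithinAt
      have hg := dist_le_of_approx_trajectories_ODE_of_mem (K := 1 / 2) (a := 0) (b := 1)
        (v := fun t (Z : R) => Z * Ω (z₀ + t • (y + h)) (y + h)) (s := fun _ => Set.univ)
        (f := Y (y + h)) (f' := fun t => Y (y + h) t * Ω (z₀ + t • (y + h)) (y + h))
        (εf := 0) (δ := 0) (εg := C * (K₂ * r + K₁ + B * (K₁ * r + B)) * ‖h‖ ^ 2)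
        (g := fun t => Y y t * (1 + t • Ω (z₀ + t • y) h)) hlip (hYc _ hyh)
        (fun t ht => (hY _ hyh t ⟨ht.1, ht.2.le⟩).Ici_of_Icc ht) (fun t _ => by simp)
        (fun _ _ => trivial) (fun t ht => (hE t ht).continuousWithinAt)
        (fun t ht => (hE t ⟨ht.1, ht.2.le⟩).Ici_of_Icc ht) ?_ (fun _ _ => trivial)
        (by simp [hY0 _ hy, hY0 _ hyh]) 1 (by simp)
      · rw [dist_eq_norm] at hg
        simpa using hg
      · intro t ht
        have ht' : t ∈ Set.Icc (0 : ℝ) 1 := ⟨ht.1, ht.2.le⟩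
        have hw := hmem y hy t ht'
        have hw' := hmem _ hyh t ht'
        have hd : z₀ + t • (y + h) - (z₀ + t • y) = t • h := by rw [smul_add]; abel
        have hth : ‖t • h‖ ≤ ‖h‖ := by
          rw [norm_smul, Real.norm_of_nonneg ht.1]
          nlinarith [norm_nonneg h, ht.2]
        have e1 := h₁ _ hw _ hw'
        have e2 := h₂ _ hw _ hw'
        have e3 := flat _ hw y h
        have e4 := hΩ _ hw
        have e5 := hΩ _ hw'
        have e6 := hC t ht'
        rw [hd] at e1 e2
        generalize z₀ + t • y = w at *
        generalize z₀ + t • (y + h) = w' at *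
        rw [dist_eq_norm]
        -- Flatness enters here: trading D w y h for D w h y cancels all terms of first order in h.
        have e7 : Y y t * Ω w y * (1 + t • Ω w h) + Y y t * (t • D w y h + (1 : ℝ) • Ω w h) -
            Y y t * (1 + t • Ω w h) * Ω w' (y + h) =
            -(Y y t * ((Ω w' - Ω w - D w (t • h)) y + (Ω w' - Ω w) h +
              t • (Ω w h * ((Ω w' - Ω w) y + Ω w' h)))) := by
          have e8 : D w y h = Ω w h * Ω w y + D w h y - Ω w y * Ω w h := by
            rw [← e3]; abel
          rw [e8]
          simp only [map_add, map_smul, sub_apply,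
            smul_apply, one_smul, mul_add, mul_sub, add_mul, mul_one,
            smul_add, smul_sub, mul_smul_comm, smul_mul_assoc, mul_assoc]
          abel
        rw [e7, norm_neg]
        have hy0 := norm_nonneg y
        have hh0 := norm_nonneg h
        have f1 : ‖(Ω w' - Ω w - D w (t • h)) y‖ ≤ K₂ * ‖h‖ ^ 2 * r := by
          refine (ContinuousLinearMap.le_opNorm _ _).trans ?_
          refine mul_le_mul (e2.trans ?_) hy.le (norm_nonneg _) (by positivity)
          gcongr
        have f2 : ‖(Ω w' - Ω w) h‖ ≤ K₁ * ‖h‖ * ‖h‖ := by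
          refine (ContinuousLinearMap.le_opNorm _ _).trans ?_
          refine mul_le_mul_of_nonneg_right (e1.trans ?_) hh0
          gcongr
        have f3 : ‖(Ω w' - Ω w) y‖ ≤ K₁ * ‖h‖ * r := by
          refine (ContinuousLinearMap.le_opNorm _ _).trans ?_
          refine mul_le_mul (e1.trans ?_) hy.le (norm_nonneg _) (by positivity)
          gcongr
        have f4 : ‖Ω w' h‖ ≤ B * ‖h‖ :=
          (ContinuousLinearMap.le_opNorm _ _).trans (mul_le_mul_of_nonneg_right e5 hh0)
        have f5 : ‖Ω w h‖ ≤ B * ‖h‖ :=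
          (ContinuousLinearMap.le_opNorm _ _).trans (mul_le_mul_of_nonneg_right e4 hh0)
        have f6 : ‖t • (Ω w h * ((Ω w' - Ω w) y + Ω w' h))‖ ≤
            B * ‖h‖ * (K₁ * ‖h‖ * r + B * ‖h‖) := by
          rw [norm_smul, Real.norm_of_nonneg ht.1]
          refine (mul_le_of_le_one_left (norm_nonneg _) ht.2.le).trans ?_
          refine (norm_mul_le _ _).trans ?_
          refine mul_le_mul f5 ((norm_add_le _ _).trans (add_le_add f3 f4)) (norm_nonneg _)
            (by positivity)
        refine (norm_mul_le _ _).trans ?_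
        calc _ ≤ C * (K₂ * ‖h‖ ^ 2 * r + K₁ * ‖h‖ * ‖h‖ +
                B * ‖h‖ * (K₁ * ‖h‖ * r + B * ‖h‖)) :=
              mul_le_mul e6 ((norm_add_le _ _).trans (add_le_add
                ((norm_add_le _ _).trans (add_le_add f1 f2)) f6)) (norm_nonneg _) hC0
          _ = _ := by ring
    rw [hasFDerivAt_iff_isLittleO_nhds_zero]
    -- At t = 1 the guess is F(z)(1 + Ω(z)h), so a quadratic error is exactly differentiability with
    -- derivative F Ω.
    refine Asymptotics.IsBigO.trans_isLittleO ?_ (Asymptotics.isLittleO_norm_pow_id one_lt_two)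
    refine Asymptotics.IsBigO.of_bound (C * (K₂ * r + K₁ + B * (K₁ * r + B)) *
      ((1 / 2 : ℝ)⁻¹ * (Real.exp (1 / 2) - 1))) ?_
    have hev : ∀ᶠ h : E in 𝓝 0, ‖y + h‖ < r := by
      have : ContinuousAt (fun h : E => ‖y + h‖) 0 := by fun_prop
      exact this.eventually_lt continuousAt_const (by simpa using hy)
    filter_upwards [hev] with h hh
    have h9 := key h hh
    rw [gronwallBound_of_K_ne_0 (by norm_num)] at h9
    have h10 : z₀ + y + h - z₀ = y + h := by abel
    have h11 : z₀ + y - z₀ = y := by abel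
    simp only [h10, h11]
    convert h9 using 1
    · congr 1
      simp [mul_add, sub_sub]
    · simp
      ring

/-- **Frobenius' theorem** for linear systems `dF = F Ω` with values in a Banach algebra. -/
theorem exists_flat_section [CompleteSpace R] (Ω : E → E →L[ℝ] R) (z₀ : E) (hΩ : ContDiffAt ℝ 2 Ω z₀)
    (flat : ∀ᶠ w in 𝓝 z₀, ∀ v v', Ω w v * Ω w v' + fderiv ℝ Ω w v v' =
      Ω w v' * Ω w v + fderiv ℝ Ω w v' v) :
    ∃ F : E → R, F z₀ = 1 ∧ ∀ᶠ z in 𝓝 z₀,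
      HasFDerivAt F ((ContinuousLinearMap.mul ℝ R (F z)).comp (Ω z)) z := by
  obtain ⟨K₁, s₁, hs₁, hK₁⟩ := (hΩ.of_le (by norm_num : (1 : WithTop ℕ∞) ≤ 2)).exists_lipschitzOnWith
  obtain ⟨K₂, s₂, hs₂, hK₂⟩ := (hΩ.fderiv_right (m := 1) (by norm_num)).exists_lipschitzOnWith
  have hdiff : ∀ᶠ w in 𝓝 z₀, DifferentiableAt ℝ Ω w := by
    filter_upwards [hΩ.eventually (by simp)] with w hw
    exact hw.differentiableAt (by norm_num)
  have hbd : ∀ᶠ w in 𝓝 z₀, ‖Ω w‖ < ‖Ω z₀‖ + 1 :=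
    hΩ.continuousAt.norm.eventually_lt continuousAt_const (by simp)
  obtain ⟨r₀, hr₀, hball⟩ := Metric.eventually_nhds_iff_ball.1
    (hdiff.and (hbd.and (flat.and (Filter.Eventually.and (Filter.mem_of_superset hs₁
      fun _ h => h : ∀ᶠ w in 𝓝 z₀, w ∈ s₁) (Filter.mem_of_superset hs₂
      fun _ h => h : ∀ᶠ w in 𝓝 z₀, w ∈ s₂)))))
  set B := ‖Ω z₀‖ + 1 with hB
  have hB0 : 0 < B := by positivity
  -- The bound 1 / (2B) makes B r ≤ 1/2, the smallness needed to solve along the rays up to time 1.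
  set r := min r₀ (1 / (2 * B)) with hr
  have hr0 : 0 < r := lt_min hr₀ (by positivity)
  have hsub : Metric.ball z₀ r ⊆ Metric.ball z₀ r₀ := Metric.ball_subset_ball (min_le_left _ _)
  obtain ⟨F, hF0, hF⟩ := exists_flat_section_of_bounds Ω (fderiv ℝ Ω) z₀ r B K₁ K₂ hr0 hB0.le
    K₁.2 K₂.2 (fun w hw => (hball w (hsub hw)).1.hasFDerivAt)
    (fun w hw => (hball w (hsub hw)).2.1.le)
    (fun w hw w' hw' => by
      simpa [dist_eq_norm] using hK₁.dist_le_mul w' (hball _ (hsub hw')).2.2.2.1 w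
        (hball _ (hsub hw)).2.2.2.1)
    (fun w hw w' hw' => by
      have hseg : segment ℝ w w' ⊆ Metric.ball z₀ r := (convex_ball z₀ r).segment_subset hw hw'
      have := (convex_segment w w').norm_image_sub_le_of_norm_hasFDerivWithin_le' (𝕜 := ℝ)
        (f := Ω) (f' := fderiv ℝ Ω) (φ := fderiv ℝ Ω w) (C := K₂ * ‖w' - w‖)
        (fun x hx => (hball x (hsub (hseg hx))).1.hasFDerivAt.hasFDerivWithinAt)
        (fun x hx => by
          have h1 := hK₂.dist_le_mul x (hball _ (hsub (hseg hx))).2.2.2.2 w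
            (hball _ (hsub hw)).2.2.2.2
          rw [dist_eq_norm, dist_eq_norm] at h1
          refine h1.trans (mul_le_mul_of_nonneg_left ?_ K₂.2)
          obtain ⟨a, ha, hx⟩ := (segment_eq_image' ℝ w w') ▸ hx
          rw [← hx]
          simp only [add_sub_cancel_left, norm_smul, Real.norm_of_nonneg ha.1]
          exact mul_le_of_le_one_left (norm_nonneg _) ha.2)
        (left_mem_segment ℝ w w') (right_mem_segment ℝ w w')
      refine this.trans (le_of_eq (by ring)))
    (fun w hw => (hball w (hsub hw)).2.2.1)
    (by
      have : r ≤ 1 / (2 * B) := min_le_right _ _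
      calc B * r ≤ B * (1 / (2 * B)) := by gcongr
        _ = 1 / 2 := by field_simp)
  exact ⟨F, hF0, Filter.mem_of_superset (Metric.ball_mem_nhds z₀ hr0) hF⟩

/-- Solutions of `dF = F Ω` are smooth when `Ω` is. -/
theorem contDiffAt_of_flat_section {Ω : E → E →L[ℝ] R} {F : E → R} {z₀ : E}
    (hΩ : ContDiffAt ℝ ∞ Ω z₀) (hF : ∀ᶠ z in 𝓝 z₀,
      HasFDerivAt F ((ContinuousLinearMap.mul ℝ R (F z)).comp (Ω z)) z) :
    ContDiffAt ℝ ∞ F z₀ := by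
  rw [contDiffAt_infty]
  intro n
  induction n with
  | zero =>
    refine contDiffAt_zero.2 ?_
    obtain ⟨s, hs, ho, hz⟩ := mem_nhds_iff.1 hF
    exact ⟨s, ho.mem_nhds hz, fun z h => (hs h).continuousAt.continuousWithinAt⟩
  | succ n ih =>
    rw [show ((n + 1 : ℕ) : WithTop ℕ∞) = (n : WithTop ℕ∞) + 1 by simp,
      contDiffAt_succ_iff_hasFDerivAt]
    -- The derivative F Ω is as smooth as F itself, so each order of smoothness yields the next.
    refine ⟨fun z => (ContinuousLinearMap.mul ℝ R (F z)).comp (Ω z), ⟨_, hF, fun z hz => hz⟩, ?_⟩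
    exact ((ContinuousLinearMap.mul ℝ R).contDiff.contDiffAt.comp z₀ ih).clm_comp
      (hΩ.of_le (by exact_mod_cast le_top))

end Frobenius

/-! ### Calculus of ∂_z and ∂_z̄. -/

section Wirtinger

open Complex

theorem dz_congr {f g : ℂ → ℂ} {z : ℂ} (h : f =ᶠ[𝓝 z] g) : dz f z = dz g z := by
  simp only [dz, h.fderiv_eq]

theorem dzbar_congr {f g : ℂ → ℂ} {z : ℂ} (h : f =ᶠ[𝓝 z] g) : dzbar f z = dzbar g z := by
  simp only [dzbar, h.fderiv_eq]

theorem fderiv_eq_dz_dzbar (f : ℂ → ℂ) (z v : ℂ) :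
    fderiv ℝ f z v = dz f z * v + dzbar f z * star v := by
  have hv : v = v.re • (1 : ℂ) + v.im • I := by
    apply Complex.ext <;> simp
  have hs : star v = v.re - v.im * I := by
    apply Complex.ext <;> simp
  conv_lhs => rw [hv, map_add, map_smul, map_smul]
  conv_rhs => rw [hs, show dz f z * v = dz f z * (v.re + v.im * I) by rw [Complex.re_add_im]]
  simp only [dz, dzbar, real_smul]
  linear_combination ((v.im : ℂ) * fderiv ℝ f z I) * I_mul_I

variable {f g : ℂ → ℂ} {z : ℂ}

@[simp] theorem dz_const (a : ℂ) : dz (fun _ => a) z = 0 := by simp [dz]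
@[simp] theorem dzbar_const (a : ℂ) : dzbar (fun _ => a) z = 0 := by simp [dzbar]

theorem dz_add (hf : DifferentiableAt ℝ f z) (hg : DifferentiableAt ℝ g z) :
    dz (fun w => f w + g w) z = dz f z + dz g z := by
  simp only [dz, fderiv_fun_add hf hg, add_apply]; ring

theorem dzbar_add (hf : DifferentiableAt ℝ f z) (hg : DifferentiableAt ℝ g z) :
    dzbar (fun w => f w + g w) z = dzbar f z + dzbar g z := by
  simp only [dzbar, fderiv_fun_add hf hg, add_apply]; ring

theorem dz_sub (hf : DifferentiableAt ℝ f z) (hg : DifferentiableAt ℝ g z) :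
    dz (fun w => f w - g w) z = dz f z - dz g z := by
  simp only [dz, fderiv_fun_sub hf hg, sub_apply]; ring

theorem dzbar_sub (hf : DifferentiableAt ℝ f z) (hg : DifferentiableAt ℝ g z) :
    dzbar (fun w => f w - g w) z = dzbar f z - dzbar g z := by
  simp only [dzbar, fderiv_fun_sub hf hg, sub_apply]; ring

theorem dz_neg : dz (fun w => -f w) z = -dz f z := by
  simp only [dz, fderiv_fun_neg, neg_apply]; ring

theorem dzbar_neg : dzbar (fun w => -f w) z = -dzbar f z := by
  simp only [dzbar, fderiv_fun_neg, neg_apply]; ring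

theorem dz_mul (hf : DifferentiableAt ℝ f z) (hg : DifferentiableAt ℝ g z) :
    dz (fun w => f w * g w) z = dz f z * g z + f z * dz g z := by
  simp only [dz, fderiv_fun_mul hf hg, add_apply, smul_apply, smul_eq_mul]; ring

theorem dzbar_mul (hf : DifferentiableAt ℝ f z) (hg : DifferentiableAt ℝ g z) :
    dzbar (fun w => f w * g w) z = dzbar f z * g z + f z * dzbar g z := by
  simp only [dzbar, fderiv_fun_mul hf hg, add_apply, smul_apply, smul_eq_mul]; ring

theorem dz_const_mul (a : ℂ) (hf : DifferentiableAt ℝ f z) :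
    dz (fun w => a * f w) z = a * dz f z := by
  rw [dz_mul (differentiableAt_const a) hf]; simp

theorem dzbar_const_mul (a : ℂ) (hf : DifferentiableAt ℝ f z) :
    dzbar (fun w => a * f w) z = a * dzbar f z := by
  rw [dzbar_mul (differentiableAt_const a) hf]; simp

theorem fderiv_star_apply (f : ℂ → ℂ) (z v : ℂ) :
    fderiv ℝ (fun w => star (f w)) z v = star (fderiv ℝ f z v) := by
  have h : (fun w => star (f w)) = conjCLE ∘ f := by
    ext w; simp
  rw [h, ContinuousLinearEquiv.comp_fderiv]
  simp

theorem dz_star : dz (fun w => star (f w)) z = star (dzbar f z) := by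
  simp only [dz, dzbar, fderiv_star_apply]
  simp; ring

theorem dzbar_star : dzbar (fun w => star (f w)) z = star (dz f z) := by
  simp only [dz, dzbar, fderiv_star_apply]
  simp

/-- Chain rule for a holomorphic outer function. -/
theorem fderiv_holo_comp {g : ℂ → ℂ} {g' : ℂ} (hg : HasDerivAt g g' (f z))
    (hf : DifferentiableAt ℝ f z) (v : ℂ) :
    fderiv ℝ (fun w => g (f w)) z v = g' * fderiv ℝ f z v := by
  have h1 : HasFDerivAt g (g' • (1 : ℂ →L[ℝ] ℂ)) (f z) := hg.complexToReal_fderiv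
  rw [show (fun w => g (f w)) = g ∘ f from rfl, (h1.comp z hf.hasFDerivAt).fderiv]
  simp

theorem dz_holo_comp {g : ℂ → ℂ} {g' : ℂ} (hg : HasDerivAt g g' (f z))
    (hf : DifferentiableAt ℝ f z) : dz (fun w => g (f w)) z = g' * dz f z := by
  simp only [dz, fderiv_holo_comp hg hf]; ring

theorem dzbar_holo_comp {g : ℂ → ℂ} {g' : ℂ} (hg : HasDerivAt g g' (f z))
    (hf : DifferentiableAt ℝ f z) : dzbar (fun w => g (f w)) z = g' * dzbar f z := by
  simp only [dzbar, fderiv_holo_comp hg hf]; ring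

theorem dzbar_inv (hf : DifferentiableAt ℝ f z) (h0 : f z ≠ 0) :
    dzbar (fun w => (f w)⁻¹) z = -(f z ^ 2)⁻¹ * dzbar f z :=
  dzbar_holo_comp (hasDerivAt_inv h0) hf

theorem dz_log (hf : DifferentiableAt ℝ f z) (h0 : f z ∈ slitPlane) :
    dz (fun w => log (f w)) z = (f z)⁻¹ * dz f z :=
  dz_holo_comp (hasDerivAt_log h0) hf

theorem dzbar_log (hf : DifferentiableAt ℝ f z) (h0 : f z ∈ slitPlane) :
    dzbar (fun w => log (f w)) z = (f z)⁻¹ * dzbar f z :=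
  dzbar_holo_comp (hasDerivAt_log h0) hf

/-- Chain rule for a holomorphic change of coordinates. -/
theorem fderiv_comp_holo {F : Type*} [NormedAddCommGroup F] [NormedSpace ℝ F] {f : ℂ → F}
    {τ : ℂ → ℂ} {τ' : ℂ} (hτ : HasDerivAt τ τ' z)
    (hf : DifferentiableAt ℝ f (τ z)) (v : ℂ) :
    fderiv ℝ (fun w => f (τ w)) z v = fderiv ℝ f (τ z) (τ' * v) := by
  have h1 : HasFDerivAt τ (τ' • (1 : ℂ →L[ℝ] ℂ)) z := hτ.complexToReal_fderiv
  rw [show (fun w => f (τ w)) = f ∘ τ from rfl, (hf.hasFDerivAt.comp z h1).fderiv]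
  simp

theorem dz_comp_holo {τ : ℂ → ℂ} {τ' : ℂ} (hτ : HasDerivAt τ τ' z)
    (hf : DifferentiableAt ℝ f (τ z)) : dz (fun w => f (τ w)) z = dz f (τ z) * τ' := by
  have e1 := fderiv_comp_holo hτ hf 1
  have e2 := fderiv_comp_holo hτ hf I
  rw [fderiv_eq_dz_dzbar f] at e1 e2
  conv_lhs => rw [dz.eq_def, e1, e2]
  simp
  linear_combination (-(dz f (τ z)) * τ' / 2 + dzbar f (τ z) * (starRingEnd ℂ) τ' / 2) * I_mul_I

theorem dzbar_comp_holo {τ : ℂ → ℂ} {τ' : ℂ} (hτ : HasDerivAt τ τ' z)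
    (hf : DifferentiableAt ℝ f (τ z)) :
    dzbar (fun w => f (τ w)) z = dzbar f (τ z) * star τ' := by
  have e1 := fderiv_comp_holo hτ hf 1
  have e2 := fderiv_comp_holo hτ hf I
  rw [fderiv_eq_dz_dzbar f] at e1 e2
  conv_lhs => rw [dzbar.eq_def, e1, e2]
  simp
  linear_combination (dz f (τ z) * τ' / 2 - dzbar f (τ z) * (starRingEnd ℂ) τ' / 2) * I_mul_I

theorem ContDiffAt.dz (hf : ContDiffAt ℝ ∞ f z) : ContDiffAt ℝ ∞ (DefiniteSurface.dz f) z := by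
  have h : ContDiffAt ℝ ∞ (fderiv ℝ f) z := hf.fderiv_right (by simp)
  exact ((h.clm_apply contDiffAt_const).sub
    (contDiffAt_const.mul (h.clm_apply contDiffAt_const))).div_const 2

theorem ContDiffAt.dzbar (hf : ContDiffAt ℝ ∞ f z) :
    ContDiffAt ℝ ∞ (DefiniteSurface.dzbar f) z := by
  have h : ContDiffAt ℝ ∞ (fderiv ℝ f) z := hf.fderiv_right (by simp)
  exact ((h.clm_apply contDiffAt_const).add
    (contDiffAt_const.mul (h.clm_apply contDiffAt_const))).div_const 2

theorem dz_dzbar_comm (hf : ContDiffAt ℝ ∞ f z) :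
    dz (fun w => dzbar f w) z = dzbar (fun w => dz f w) z := by
  have h : DifferentiableAt ℝ (fderiv ℝ f) z :=
    (hf.fderiv_right (m := ∞) (by simp)).differentiableAt (by simp)
  have hsymm : IsSymmSndFDerivAt ℝ f z := hf.isSymmSndFDerivAt (by simpa using (WithTop.coe_le_coe.2 le_top : ((2 : ℕ∞) : WithTop ℕ∞) ≤ ∞))
  have h1 : ∀ v v', fderiv ℝ (fun w => fderiv ℝ f w v) z v' = fderiv ℝ (fderiv ℝ f) z v' v := by
    intro v v'
    rw [fderiv_clm_apply h (differentiableAt_const v)]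
    simp
  have hd : ∀ v, DifferentiableAt ℝ (fun w => fderiv ℝ f w v) z := fun v =>
    h.clm_apply (differentiableAt_const v)
  have h2 : ∀ v', fderiv ℝ (fun w => dzbar f w) z v' =
      (fderiv ℝ (fderiv ℝ f) z v' 1 + I * fderiv ℝ (fderiv ℝ f) z v' I) / 2 := by
    intro v'
    have : (fun w => dzbar f w) = fun w => (2 : ℂ)⁻¹ * (fderiv ℝ f w 1 + I * fderiv ℝ f w I) := by
      ext w; simp only [dzbar]; ring
    rw [this, fderiv_const_mul ((hd 1).fun_add ((hd I).const_mul I)),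
      fderiv_fun_add (hd 1) ((hd I).const_mul I), fderiv_const_mul (hd I)]
    simp only [smul_apply, add_apply, h1, smul_eq_mul]; ring
  have h3 : ∀ v', fderiv ℝ (fun w => dz f w) z v' =
      (fderiv ℝ (fderiv ℝ f) z v' 1 - I * fderiv ℝ (fderiv ℝ f) z v' I) / 2 := by
    intro v'
    have : (fun w => dz f w) = fun w => (2 : ℂ)⁻¹ * (fderiv ℝ f w 1 - I * fderiv ℝ f w I) := by
      ext w; simp only [dz]; ring
    rw [this, fderiv_const_mul ((hd 1).fun_sub ((hd I).const_mul I)),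
      fderiv_fun_sub (hd 1) ((hd I).const_mul I), fderiv_const_mul (hd I)]
    simp only [smul_apply, sub_apply, h1, smul_eq_mul]; ring
  rw [DefiniteSurface.dz.eq_def, DefiniteSurface.dzbar.eq_def, h2, h2, h3, h3, hsymm.eq 1 I]
  ring

theorem ContDiffAt.star_comp (hf : ContDiffAt ℝ ∞ f z) : ContDiffAt ℝ ∞ (fun w => star (f w)) z :=
  (conjCLE : ℂ ≃L[ℝ] ℂ).contDiff.contDiffAt.comp z hf

theorem DifferentiableAt.star_comp (hf : DifferentiableAt ℝ f z) :
    DifferentiableAt ℝ (fun w => star (f w)) z :=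
  (conjCLE : ℂ ≃L[ℝ] ℂ).differentiableAt.comp z hf

theorem ContDiffAt.ofReal_comp' {E : Type*} [NormedAddCommGroup E] [NormedSpace ℝ E] {u : E → ℝ}
    {z : E} (hu : ContDiffAt ℝ ∞ u z) : ContDiffAt ℝ ∞ (fun w => (u w : ℂ)) z :=
  ofRealCLM.contDiff.contDiffAt.comp z hu

theorem dzbar_ofReal (u : ℂ → ℝ) : dzbar (fun w => (u w : ℂ)) z = star (dz (fun w => (u w : ℂ)) z) := by
  rw [← dzbar_star]
  simp

theorem dz_exp_ofReal {u : ℂ → ℝ} (hu : DifferentiableAt ℝ (fun w => (u w : ℂ)) z) :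
    dz (fun w => ((Real.exp (u w) : ℝ) : ℂ)) z =
      (Real.exp (u z) : ℝ) * dz (fun w => (u w : ℂ)) z := by
  simp only [ofReal_exp]
  exact dz_holo_comp (hasDerivAt_exp _) hu

/-- If `dz f` and `dzbar f` vanish near a point, `f` is constant near it. -/
theorem eventually_eq_of_dz_eq_zero (hf : ∀ᶠ w in 𝓝 z, DifferentiableAt ℝ f w)
    (h1 : ∀ᶠ w in 𝓝 z, dz f w = 0) (h2 : ∀ᶠ w in 𝓝 z, dzbar f w = 0) :
    ∀ᶠ w in 𝓝 z, f w = f z := by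
  obtain ⟨r, hr, hb⟩ := Metric.eventually_nhds_iff_ball.1 (hf.and (h1.and h2))
  refine Filter.mem_of_superset (Metric.ball_mem_nhds z hr) fun w hw => ?_
  refine (convex_ball z r).is_const_of_fderivWithin_eq_zero (𝕜 := ℝ)
    (fun w hw => (hb w hw).1.differentiableWithinAt) (fun w hw => ?_) hw (Metric.mem_ball_self hr)
  rw [fderivWithin_of_isOpen Metric.isOpen_ball hw]
  ext v
  rw [fderiv_eq_dz_dzbar, (hb w hw).2.1, (hb w hw).2.2]
  simp

/-! ### Vector-valued functions -/

/-- `∂_z` of a vector-valued function. -/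
noncomputable def dzV (f : ℂ → Fin 3 → ℂ) (z : ℂ) : Fin 3 → ℂ := fun i => dz (fun w => f w i) z

/-- `∂_z̄` of a vector-valued function. -/
noncomputable def dzbarV (f : ℂ → Fin 3 → ℂ) (z : ℂ) : Fin 3 → ℂ :=
  fun i => dzbar (fun w => f w i) z

theorem dz_dotProduct {f g : ℂ → Fin 3 → ℂ} (hf : ∀ i, DifferentiableAt ℝ (fun w => f w i) z)
    (hg : ∀ i, DifferentiableAt ℝ (fun w => g w i) z) :
    dz (fun w => f w ⬝ᵥ g w) z = dzV f z ⬝ᵥ g z + f z ⬝ᵥ dzV g z := by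
  simp only [dotProduct, Fin.sum_univ_three, dzV]
  rw [dz_add (((hf 0).fun_mul (hg 0)).fun_add ((hf 1).fun_mul (hg 1))) ((hf 2).fun_mul (hg 2)),
    dz_add ((hf 0).fun_mul (hg 0)) ((hf 1).fun_mul (hg 1)), dz_mul (hf 0) (hg 0), dz_mul (hf 1) (hg 1),
    dz_mul (hf 2) (hg 2)]
  ring

theorem dzbar_dotProduct {f g : ℂ → Fin 3 → ℂ} (hf : ∀ i, DifferentiableAt ℝ (fun w => f w i) z)
    (hg : ∀ i, DifferentiableAt ℝ (fun w => g w i) z) :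
    dzbar (fun w => f w ⬝ᵥ g w) z = dzbarV f z ⬝ᵥ g z + f z ⬝ᵥ dzbarV g z := by
  simp only [dotProduct, Fin.sum_univ_three, dzbarV]
  rw [dzbar_add (((hf 0).fun_mul (hg 0)).fun_add ((hf 1).fun_mul (hg 1))) ((hf 2).fun_mul (hg 2)),
    dzbar_add ((hf 0).fun_mul (hg 0)) ((hf 1).fun_mul (hg 1)), dzbar_mul (hf 0) (hg 0),
    dzbar_mul (hf 1) (hg 1), dzbar_mul (hf 2) (hg 2)]
  ring

/-! ### The function `c` -/

theorem cOf_re (θ : ℂ → ℝ) (z : ℂ) : (cOf θ z).re = 1 := by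
  rw [cOf, add_re, I_mul_re, ofReal_im]
  simp

theorem cOf_ne_zero (θ : ℂ → ℝ) (z : ℂ) : cOf θ z ≠ 0 := fun h => by
  have := cOf_re θ z
  simp [h] at this

theorem star_cOf_ne_zero (θ : ℂ → ℝ) (z : ℂ) : star (cOf θ z) ≠ 0 :=
  star_ne_zero.2 (cOf_ne_zero θ z)

/-- As Re c = 1, the principal logarithm of c is smooth and no branch has to be chosen. -/
theorem cOf_mem_slitPlane (θ : ℂ → ℝ) (z : ℂ) : cOf θ z ∈ slitPlane :=
  Or.inl (by rw [cOf_re]; exact one_pos)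

/-- For 0 < θ < π the tangent is evaluated away from its poles, since cos(θ - π/2) = sin θ > 0. -/
theorem contDiffAt_cOf {θ : ℂ → ℝ} (hθ : ContDiffAt ℝ ∞ θ z) (h0 : θ z ∈ Set.Ioo 0 Real.pi) :
    ContDiffAt ℝ ∞ (cOf θ) z := by
  have h1 : Real.cos (θ z - Real.pi / 2) ≠ 0 := by
    rw [Real.cos_sub_pi_div_two]
    exact (Real.sin_pos_of_pos_of_lt_pi h0.1 h0.2).ne'
  have h2 : ContDiffAt ℝ ∞ (fun w => Real.tan (θ w - Real.pi / 2)) z :=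
    ContDiffAt.comp (g := Real.tan) (f := fun w => θ w - Real.pi / 2) z (Real.contDiffAt_tan.2 h1)
      (hθ.sub contDiffAt_const)
  exact contDiffAt_const.add (contDiffAt_const.mul h2.ofReal_comp')

end Wirtinger

/-! ### Change of lift and the linear action. -/

section LiftChange

variable {E : Type*} [NormedAddCommGroup E] [NormedSpace ℝ E]

/-- Proportionality gives two independent factors for x and χ; the normalization ⟨x, χ⟩ = 1 forces
them to be inverse to each other. -/
theorem proj_eq_proj_iff (s s' : CM5) : proj s' = proj s ↔
    ∃ t : ℝ, t ≠ 0 ∧ s'.1.1 = t • s.1.1 ∧ s'.1.2 = t⁻¹ • s.1.2 := by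
  constructor
  · intro h
    have h1 := congrArg (fun p => p.1.1) h
    have h2 := congrArg (fun p => p.1.2) h
    obtain ⟨a, ha⟩ := (Projectivization.mk_eq_mk_iff' _ _ _ _ _).1 h1
    obtain ⟨b, hb⟩ := (Projectivization.mk_eq_mk_iff' _ _ _ _ _).1 h2
    have e1 : s.1.1 ⬝ᵥ s.1.2 = 1 := s.2
    have e2 : s'.1.1 ⬝ᵥ s'.1.2 = 1 := s'.2
    rw [← ha, ← hb, smul_dotProduct, dotProduct_smul, e1] at e2
    have e3 : a * b = 1 := by simpa using e2
    have ha0 : a ≠ 0 := left_ne_zero_of_mul_eq_one e3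
    refine ⟨a, ha0, ha.symm, ?_⟩
    rw [← hb, eq_inv_of_mul_eq_one_right e3]
  · rintro ⟨t, ht, h1, h2⟩
    refine Subtype.ext (Prod.ext ?_ ?_)
    · exact (Projectivization.mk_eq_mk_iff' _ _ _ _ _).2 ⟨t, h1.symm⟩
    · exact (Projectivization.mk_eq_mk_iff' _ _ _ _ _).2 ⟨t⁻¹, h2.symm⟩

/-- The map `s` into the quadric is smooth near `p`. -/
def SmoothAt (s : E → CM5) (p : E) : Prop := ContDiffAt ℝ ∞ (fun q => (s q : Vec × Vec)) p

theorem SmoothAt.fst {s : E → CM5} {p : E} (h : SmoothAt s p) :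
    ContDiffAt ℝ ∞ (fun q => (s q).1.1) p := ContDiffAt.fst h

theorem SmoothAt.snd {s : E → CM5} {p : E} (h : SmoothAt s p) :
    ContDiffAt ℝ ∞ (fun q => (s q).1.2) p := ContDiffAt.snd h

theorem SmoothAt.fst_apply {s : E → CM5} {p : E} (h : SmoothAt s p) (i : Fin 3) :
    ContDiffAt ℝ ∞ (fun q => (s q).1.1 i) p := contDiffAt_pi.1 h.fst i

theorem SmoothAt.snd_apply {s : E → CM5} {p : E} (h : SmoothAt s p) (i : Fin 3) :
    ContDiffAt ℝ ∞ (fun q => (s q).1.2 i) p := contDiffAt_pi.1 h.snd i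

/-- The map `s` into the quadric is differentiable at `p`. -/
def DiffAt (s : E → CM5) (p : E) : Prop := DifferentiableAt ℝ (fun q => (s q : Vec × Vec)) p

theorem SmoothAt.diffAt {s : E → CM5} {p : E} (h : SmoothAt s p) : DiffAt s p :=
  ContDiffAt.differentiableAt h (by simp)

theorem DiffAt.fst {s : E → CM5} {p : E} (h : DiffAt s p) :
    DifferentiableAt ℝ (fun q => (s q).1.1) p := DifferentiableAt.fst h

theorem DiffAt.snd {s : E → CM5} {p : E} (h : DiffAt s p) :
    DifferentiableAt ℝ (fun q => (s q).1.2) p := DifferentiableAt.snd h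

theorem DiffAt.fst_apply {s : E → CM5} {p : E} (h : DiffAt s p) (i : Fin 3) :
    DifferentiableAt ℝ (fun q => (s q).1.1 i) p := differentiableAt_pi.1 h.fst i

theorem DiffAt.snd_apply {s : E → CM5} {p : E} (h : DiffAt s p) (i : Fin 3) :
    DifferentiableAt ℝ (fun q => (s q).1.2 i) p := differentiableAt_pi.1 h.snd i

theorem ContDiffAt.eventually_differentiableAt {F : Type*} [NormedAddCommGroup F]
    [NormedSpace ℝ F] {f : E → F} {p : E} (h : ContDiffAt ℝ ∞ f p) :
    ∀ᶠ q in 𝓝 p, DifferentiableAt ℝ f q :=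
  ((h.of_le (by simp) : ContDiffAt ℝ 1 f p).eventually (by simp)).mono
    fun _ hq => hq.differentiableAt (by simp)

theorem SmoothAt.eventually_diffAt {s : E → CM5} {p : E} (h : SmoothAt s p) :
    ∀ᶠ q in 𝓝 p, DiffAt s q := ContDiffAt.eventually_differentiableAt h

theorem SmoothAt.congr {s s' : E → CM5} {p : E} (h : SmoothAt s p) (h' : s' =ᶠ[𝓝 p] s) :
    SmoothAt s' p :=
  ContDiffAt.congr_of_eventuallyEq h (h'.mono fun _ hq => congrArg Subtype.val hq)

/-- `s'` is the lift `s` rescaled by `t`, near `p`. -/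
structure RescaledAt (s s' : E → CM5) (t : E → ℝ) (p : E) : Prop where
  diff : DifferentiableAt ℝ t p
  eventually : ∀ᶠ q in 𝓝 p,
    t q ≠ 0 ∧ (s' q).1.1 = t q • (s q).1.1 ∧ (s' q).1.2 = (t q)⁻¹ • (s q).1.2

/-- The factor between two lifts is recovered as t = ⟨x', χ⟩, which is smooth because both lifts
are. -/
theorem DefiniteSurface.IsLocalLiftAt.rescaled {F : E → DP2} {s s' : E → CM5} {p : E}
    (h : IsLocalLiftAt F s p) (h' : IsLocalLiftAt F s' p) : ∃ t, ContDiffAt ℝ ∞ t p ∧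
      ∀ᶠ q in 𝓝 p, RescaledAt s s' t q := by
  have hs : SmoothAt s p := h.1
  have hs' : SmoothAt s' p := h'.1
  have ht : ContDiffAt ℝ ∞ (fun q => (s' q).1.1 ⬝ᵥ (s q).1.2) p :=
    ContDiffAt.sum fun i _ => (hs'.fst_apply i).mul (hs.snd_apply i)
  refine ⟨fun q => (s' q).1.1 ⬝ᵥ (s q).1.2, ht, ?_⟩
  filter_upwards [ht.eventually_differentiableAt, h.2.eventually_nhds, h'.2.eventually_nhds]
    with q hd hq hq'
  refine ⟨hd, ?_⟩
  · filter_upwards [hq, hq'] with q hq hq'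
    obtain ⟨t, ht, h1, h2⟩ := (proj_eq_proj_iff (s q) (s' q)).1 (hq'.trans hq.symm)
    have e1 : (s q).1.1 ⬝ᵥ (s q).1.2 = 1 := (s q).2
    have e2 : (s' q).1.1 ⬝ᵥ (s q).1.2 = t := by rw [h1, smul_dotProduct, e1]; simp
    rw [e2]
    exact ⟨ht, h1, h2⟩

theorem dx_apply {s : E → CM5} {p : E} (hs : DiffAt s p) (v : E) (i : Fin 3) :
    dx s p v i = fderiv ℝ (fun q => (s q).1.1 i) p v := by
  rw [fderiv_apply hs.fst i]
  rfl

theorem dχ_apply {s : E → CM5} {p : E} (hs : DiffAt s p) (v : E) (i : Fin 3) :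
    dχ s p v i = fderiv ℝ (fun q => (s q).1.2 i) p v := by
  rw [fderiv_apply hs.snd i]
  rfl

theorem dx_dotProduct_add {s : E → CM5} {p : E} (hs : DiffAt s p) (v : E) :
    dx s p v ⬝ᵥ (s p).1.2 + (s p).1.1 ⬝ᵥ dχ s p v = 0 := by
  have h1 : ∀ i, DifferentiableAt ℝ (fun q => (s q).1.1 i) p := hs.fst_apply
  have h2 : ∀ i, DifferentiableAt ℝ (fun q => (s q).1.2 i) p := hs.snd_apply
  have h : fderiv ℝ (fun q => (s q).1.1 ⬝ᵥ (s q).1.2) p v = 0 := by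
    have : (fun q => (s q).1.1 ⬝ᵥ (s q).1.2) = fun _ => (1 : ℝ) := funext fun q => (s q).2
    rw [this]; simp
  simp only [dotProduct] at h ⊢
  rw [fderiv_fun_sum fun i _ => (h1 i).fun_mul (h2 i)] at h
  rw [← Finset.sum_add_distrib, ← h]
  simp only [sum_apply]
  refine Finset.sum_congr rfl fun i _ => ?_
  rw [fderiv_fun_mul (h1 i) (h2 i), dx_apply hs, dχ_apply hs]
  simp only [add_apply, smul_apply, smul_eq_mul]
  ring

/-- The derivative of the factor contributes only a multiple of x, which the horizontal projection
removes. Hence ξ scales by t, η by t⁻¹, and h is unchanged. -/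
theorem RescaledAt.xi {s s' : E → CM5} {t : E → ℝ} {p : E} (h : RescaledAt s s' t p)
    (hs : DiffAt s p) (v : E) : xi s' p v = t p • xi s p v := by
  have h0 := h.eventually.self_of_nhds
  have e1 : (fun q => (s' q).1.1) =ᶠ[𝓝 p] fun q => t q • (s q).1.1 :=
    h.eventually.mono fun q hq => hq.2.1
  have e2 : dx s' p v = t p • dx s p v + fderiv ℝ t p v • (s p).1.1 := by
    rw [dx, e1.fderiv_eq, fderiv_fun_smul h.diff
      hs.fst]
    simp [dx]
  have e3 : (s p).1.1 ⬝ᵥ (s p).1.2 = 1 := (s p).2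
  rw [DefiniteSurface.xi, e2, h0.2.1, h0.2.2, DefiniteSurface.xi]
  simp only [add_dotProduct, smul_dotProduct, dotProduct_smul, e3, smul_eq_mul]
  ext i
  simp only [Pi.sub_apply, Pi.add_apply, Pi.smul_apply, smul_eq_mul]
  field_simp [h0.1]
  ring

theorem RescaledAt.eta {s s' : E → CM5} {t : E → ℝ} {p : E} (h : RescaledAt s s' t p)
    (hs : DiffAt s p) (v : E) : eta s' p v = (t p)⁻¹ • eta s p v := by
  have h0 := h.eventually.self_of_nhds
  have e1 : (fun q => (s' q).1.2) =ᶠ[𝓝 p] fun q => (t q)⁻¹ • (s q).1.2 :=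
    h.eventually.mono fun q hq => hq.2.2
  have e2 : dχ s' p v = (t p)⁻¹ • dχ s p v + fderiv ℝ (fun q => (t q)⁻¹) p v • (s p).1.2 := by
    rw [dχ, e1.fderiv_eq, fderiv_fun_smul (h.diff.fun_inv h0.1)
      hs.snd]
    simp [dχ]
  have e3 : (s p).1.1 ⬝ᵥ (s p).1.2 = 1 := (s p).2
  rw [DefiniteSurface.eta, e2, h0.2.1, h0.2.2, DefiniteSurface.eta]
  simp only [dotProduct_add, smul_dotProduct, dotProduct_smul, e3, smul_eq_mul]
  ext i
  simp only [Pi.sub_apply, Pi.add_apply, Pi.smul_apply, smul_eq_mul]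
  field_simp [h0.1]
  ring

theorem RescaledAt.hForm {s s' : E → CM5} {t : E → ℝ} {p : E} (h : RescaledAt s s' t p)
    (hs : DiffAt s p) (v w : E) : hForm s' p v w = hForm s p v w := by
  have h0 := h.eventually.self_of_nhds.1
  rw [DefiniteSurface.hForm, h.xi hs, h.eta hs, smul_dotProduct, dotProduct_smul, smul_smul,
    mul_inv_cancel₀ h0, one_smul, DefiniteSurface.hForm]

/-! ### The linear action -/

/-- The group of invertible real matrices. -/
abbrev GL3 : Type := (Matrix (Fin 3) (Fin 3) ℝ)ˣ

/-- The action `(x, χ) ↦ (A x, A⁻ᵀ χ)` on the quadric. -/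
noncomputable def actL (A : GL3) (s : CM5) : CM5 :=
  ⟨(A.1 *ᵥ s.1.1, s.1.2 ᵥ* A.2), by
    have h : s.1.1 ⬝ᵥ s.1.2 = 1 := s.2
    change (A.1 *ᵥ s.1.1) ⬝ᵥ (s.1.2 ᵥ* A.2) = 1
    rw [dotProduct_comm, ← Matrix.dotProduct_mulVec, Matrix.mulVec_mulVec, A.inv_val,
      Matrix.one_mulVec, dotProduct_comm, h]⟩

theorem actL_mul (A B : GL3) (s : CM5) : actL (A * B) s = actL A (actL B s) := by
  apply Subtype.ext
  refine Prod.ext ?_ ?_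
  · change (A.1 * B.1) *ᵥ s.1.1 = A.1 *ᵥ (B.1 *ᵥ s.1.1)
    rw [Matrix.mulVec_mulVec]
  · change s.1.2 ᵥ* (B.2 * A.2) = (s.1.2 ᵥ* B.2) ᵥ* A.2
    rw [Matrix.vecMul_vecMul]

theorem actL_one (s : CM5) : actL 1 s = s := by
  apply Subtype.ext
  refine Prod.ext ?_ ?_
  · exact Matrix.one_mulVec s.1.1
  · exact Matrix.vecMul_one s.1.2

theorem SmoothAt.actL {s : E → CM5} {p : E} (h : SmoothAt s p) (A : GL3) :
    SmoothAt (fun q => actL A (s q)) p := by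
  refine ContDiffAt.prodMk ?_ ?_
  · exact contDiffAt_pi.2 fun i => ContDiffAt.sum (s := Finset.univ) (f := fun j q => A.1 i j * (s q).1.1 j)
      fun j _ => contDiffAt_const.mul (h.fst_apply j)
  · exact contDiffAt_pi.2 fun i => ContDiffAt.sum (s := Finset.univ) (f := fun j q => (s q).1.2 j * A.2 j i)
      fun j _ => (h.snd_apply j).mul contDiffAt_const

theorem DiffAt.actL {s : E → CM5} {p : E} (h : DiffAt s p) (A : GL3) :
    DiffAt (fun q => actL A (s q)) p := by
  refine DifferentiableAt.prodMk ?_ ?_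
  · exact differentiableAt_pi.2 fun i => DifferentiableAt.fun_sum (u := Finset.univ)
      (A := fun j q => A.1 i j * (s q).1.1 j) fun j _ => (h.fst_apply j).const_mul _
  · exact differentiableAt_pi.2 fun i => DifferentiableAt.fun_sum (u := Finset.univ)
      (A := fun j q => (s q).1.2 j * A.2 j i) fun j _ => (h.snd_apply j).mul_const _

theorem dx_actL {s : E → CM5} {p : E} (h : DiffAt s p) (A : GL3) (v : E) :
    dx (fun q => actL A (s q)) p v = A.1 *ᵥ dx s p v := by
  ext i
  rw [dx_apply (h.actL A)]
  change fderiv ℝ (fun q => ∑ j, A.1 i j * (s q).1.1 j) p v = ∑ j, A.1 i j * dx s p v j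
  have h1 : ∀ i, DifferentiableAt ℝ (fun q => (s q).1.1 i) p := h.fst_apply
  rw [fderiv_fun_sum fun j _ => (h1 j).const_mul _]
  simp only [sum_apply]
  refine Finset.sum_congr rfl fun j _ => ?_
  rw [fderiv_const_mul (h1 j), dx_apply h]
  simp

theorem dχ_actL {s : E → CM5} {p : E} (h : DiffAt s p) (A : GL3) (v : E) :
    dχ (fun q => actL A (s q)) p v = dχ s p v ᵥ* A.2 := by
  ext i
  rw [dχ_apply (h.actL A)]
  change fderiv ℝ (fun q => ∑ j, (s q).1.2 j * A.2 j i) p v = ∑ j, dχ s p v j * A.2 j i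
  have h1 : ∀ i, DifferentiableAt ℝ (fun q => (s q).1.2 i) p := h.snd_apply
  rw [fderiv_fun_sum fun j _ => (h1 j).mul_const _]
  simp only [sum_apply]
  refine Finset.sum_congr rfl fun j _ => ?_
  rw [fderiv_mul_const (h1 j), dχ_apply h]
  simp [mul_comm]

theorem mulVec_dotProduct_vecMul {R : Type*} [CommRing R] {A B : Matrix (Fin 3) (Fin 3) R}
    (h : B * A = 1) (v w : Fin 3 → R) : (A *ᵥ v) ⬝ᵥ (w ᵥ* B) = v ⬝ᵥ w := by
  rw [dotProduct_comm, ← Matrix.dotProduct_mulVec, Matrix.mulVec_mulVec, h, Matrix.one_mulVec,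
    dotProduct_comm]

theorem xi_actL {s : E → CM5} {p : E} (h : DiffAt s p) (A : GL3) (v : E) :
    xi (fun q => actL A (s q)) p v = A.1 *ᵥ xi s p v := by
  rw [xi, dx_actL h, xi, Matrix.mulVec_sub, Matrix.mulVec_smul]
  change A.1 *ᵥ dx s p v - ((A.1 *ᵥ dx s p v) ⬝ᵥ ((s p).1.2 ᵥ* A.2)) • (A.1 *ᵥ (s p).1.1) = _
  rw [mulVec_dotProduct_vecMul A.inv_val]

theorem eta_actL {s : E → CM5} {p : E} (h : DiffAt s p) (A : GL3) (v : E) :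
    eta (fun q => actL A (s q)) p v = eta s p v ᵥ* A.2 := by
  rw [eta, dχ_actL h, eta, Matrix.sub_vecMul, Matrix.smul_vecMul]
  change dχ s p v ᵥ* A.2 - ((A.1 *ᵥ (s p).1.1) ⬝ᵥ (dχ s p v ᵥ* A.2)) • ((s p).1.2 ᵥ* A.2) = _
  rw [mulVec_dotProduct_vecMul A.inv_val]

theorem hForm_actL {s : E → CM5} {p : E} (h : DiffAt s p) (A : GL3) (v w : E) :
    hForm (fun q => actL A (s q)) p v w = hForm s p v w := by
  rw [hForm, xi_actL h, eta_actL h, mulVec_dotProduct_vecMul A.inv_val, hForm]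

/-- An element of `SL(3, ℝ)` as an invertible matrix. -/
noncomputable def slToGL (A : Matrix.SpecialLinearGroup (Fin 3) ℝ) : GL3 :=
  ⟨A, (A⁻¹ : Matrix.SpecialLinearGroup (Fin 3) ℝ), by
    rw [← Matrix.SpecialLinearGroup.coe_mul, mul_inv_cancel, Matrix.SpecialLinearGroup.coe_one],
    inv_mul_coe A⟩

theorem proj_actL (A : Matrix.SpecialLinearGroup (Fin 3) ℝ) (s : CM5) :
    proj (actL (slToGL A) s) = act A (proj s) := by
  refine Subtype.ext (Prod.ext ?_ ?_)
  · rfl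
  · change Projectivization.mk ℝ (s.1.2 ᵥ*
      ((A⁻¹ : Matrix.SpecialLinearGroup (Fin 3) ℝ) : Matrix (Fin 3) (Fin 3) ℝ)) _ =
      Projectivization.mk ℝ _ _
    congr 1
    exact (Matrix.mulVec_transpose _ _).symm

theorem exists_proj_eq (p : DP2) : ∃ s : CM5, proj s = p := by
  obtain ⟨⟨p₁, p₂⟩, x, χ, hx, hχ, h1, h2, h3⟩ := p
  refine ⟨⟨((x ⬝ᵥ χ)⁻¹ • x, χ), ?_⟩, ?_⟩
  · change ((x ⬝ᵥ χ)⁻¹ • x) ⬝ᵥ χ = 1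
    rw [smul_dotProduct, smul_eq_mul, inv_mul_cancel₀ h3.ne']
  · refine Subtype.ext (Prod.ext ?_ ?_)
    · refine Eq.trans ?_ h1
      exact (Projectivization.mk_eq_mk_iff' _ _ _ _ _).2 ⟨_, rfl⟩
    · exact h2

theorem act_mul (A B : Matrix.SpecialLinearGroup (Fin 3) ℝ) (p : DP2) :
    act (A * B) p = act A (act B p) := by
  obtain ⟨s, rfl⟩ := exists_proj_eq p
  rw [← proj_actL, ← proj_actL, ← proj_actL, ← actL_mul]
  congr 2
  ext1
  rfl

theorem act_one (p : DP2) : act 1 p = p := by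
  obtain ⟨s, rfl⟩ := exists_proj_eq p
  rw [← proj_actL]
  have : slToGL 1 = 1 := by ext1; rfl
  rw [this, actL_one]

theorem DefiniteSurface.IsLocalLiftAt.act {F : E → DP2} {s : E → CM5} {p : E}
    (h : IsLocalLiftAt F s p) (A : Matrix.SpecialLinearGroup (Fin 3) ℝ) :
    IsLocalLiftAt (DefiniteSurface.act A ∘ F) (fun q => actL (slToGL A) (s q)) p := by
  refine ⟨SmoothAt.actL h.1 _, h.2.mono fun q hq => ?_⟩
  rw [proj_actL, hq]
  rfl

/-- `SL(3, ℝ)` acts by isometries. -/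
theorem isIsometryDP2_act (A : Matrix.SpecialLinearGroup (Fin 3) ℝ) : IsIsometryDP2 (act A) := by
  refine ⟨⟨act A⁻¹, fun p => ?_, fun p => ?_, ?_, ?_⟩, ?_⟩
  · rw [← act_mul, inv_mul_cancel, act_one]
  · rw [← act_mul, mul_inv_cancel, act_one]
  · rintro k F p ⟨s, hs⟩
    exact ⟨_, hs.act A⟩
  · rintro k F p ⟨s, hs⟩
    exact ⟨_, hs.act A⁻¹⟩
  · intro k F p s s' hs hs' v w
    obtain ⟨t, -, ht⟩ := (hs.act A).rescaled hs'
    have h1 : DiffAt s p := SmoothAt.diffAt hs.1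
    have h2 : ∀ v w, hForm s' p v w = hForm s p v w := fun v w => by
      rw [ht.self_of_nhds.hForm (h1.actL _), hForm_actL h1]
    rw [gForm, gForm, h2, h2]

end LiftChange

/-! ### The invariants as complex pairings. -/

noncomputable section Complexified

open Complex

/-- The complexified first component of a map into the quadric. -/
def ptC (s : ℂ → CM5) (z : ℂ) : Fin 3 → ℂ := fun i => ((s z).1.1 i : ℂ)

/-- The complexified second component of a map into the quadric. -/
def duC (s : ℂ → CM5) (z : ℂ) : Fin 3 → ℂ := fun i => ((s z).1.2 i : ℂ)

theorem ofReal_dotProduct (v w : Vec) :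
    (fun i => (v i : ℂ)) ⬝ᵥ (fun i => (w i : ℂ)) = ((v ⬝ᵥ w : ℝ) : ℂ) := by
  simp [dotProduct]

theorem star_dotProduct_star' (v w : Fin 3 → ℂ) : star v ⬝ᵥ star w = star (v ⬝ᵥ w) := by
  simp [dotProduct]

variable {s : ℂ → CM5} {z : ℂ}

theorem star_ptC : star (ptC s z) = ptC s z := by ext i; simp [ptC]

theorem star_duC : star (duC s z) = duC s z := by ext i; simp [duC]

theorem ptC_dotProduct_duC : ptC s z ⬝ᵥ duC s z = 1 := by
  have h : (s z).1.1 ⬝ᵥ (s z).1.2 = 1 := (s z).2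
  exact (ofReal_dotProduct _ _).trans (by rw [h, ofReal_one])

theorem DiffAt.ptC (h : DiffAt s z) (i : Fin 3) : DifferentiableAt ℝ (fun w => ptC s w i) z :=
  ofRealCLM.differentiableAt.comp z (h.fst_apply i)

theorem DiffAt.duC (h : DiffAt s z) (i : Fin 3) : DifferentiableAt ℝ (fun w => duC s w i) z :=
  ofRealCLM.differentiableAt.comp z (h.snd_apply i)

theorem SmoothAt.ptC (h : SmoothAt s z) (i : Fin 3) : ContDiffAt ℝ ∞ (fun w => ptC s w i) z :=
  (h.fst_apply i).ofReal_comp'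

theorem SmoothAt.duC (h : SmoothAt s z) (i : Fin 3) : ContDiffAt ℝ ∞ (fun w => duC s w i) z :=
  (h.snd_apply i).ofReal_comp'

theorem fderiv_ofReal {u : ℂ → ℝ} (hu : DifferentiableAt ℝ u z) (v : ℂ) :
    fderiv ℝ (fun w => (u w : ℂ)) z v = (fderiv ℝ u z v : ℂ) := by
  rw [show (fun w => (u w : ℂ)) = ofRealCLM ∘ u from rfl,
    (ofRealCLM.hasFDerivAt.comp z hu.hasFDerivAt).fderiv]
  rfl

theorem dzV_ptC (h : DiffAt s z) (i : Fin 3) :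
    dzV (ptC s) z i = (dx s z 1 i - I * dx s z I i) / 2 := by
  rw [dx_apply h, dx_apply h]
  simp only [dzV, ptC, dz, fderiv_ofReal (h.fst_apply i)]

theorem dzV_duC (h : DiffAt s z) (i : Fin 3) :
    dzV (duC s) z i = (dχ s z 1 i - I * dχ s z I i) / 2 := by
  rw [dχ_apply h, dχ_apply h]
  simp only [dzV, duC, dz, fderiv_ofReal (h.snd_apply i)]

theorem rhoOf_eq : rhoOf s z = dzV (ptC s) z ⬝ᵥ duC s z := rfl

theorem rhoOf_eq_dx (h : DiffAt s z) : rhoOf s z =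
    ((dx s z 1 ⬝ᵥ (s z).1.2 : ℝ) - I * (dx s z I ⬝ᵥ (s z).1.2 : ℝ)) / 2 := by
  rw [rhoOf_eq]
  simp only [dotProduct, Fin.sum_univ_three, dzV_ptC h, duC]
  push_cast
  ring

theorem ptC_dotProduct_dzV_duC (h : DiffAt s z) : ptC s z ⬝ᵥ dzV (duC s) z = -rhoOf s z := by
  have e := dz_dotProduct h.ptC h.duC
  rw [show (fun w => ptC s w ⬝ᵥ duC s w) = fun _ => 1 from funext fun w => ptC_dotProduct_duC,
    dz_const] at e
  rw [rhoOf_eq]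
  linear_combination -e

theorem xiC_eq (h : DiffAt s z) : xiC s z = dzV (ptC s) z - rhoOf s z • ptC s z := by
  ext i
  rw [Pi.sub_apply, dzV_ptC h, rhoOf_eq_dx h]
  simp only [xiC, xi, Pi.sub_apply, Pi.smul_apply, smul_eq_mul, ptC]
  push_cast
  ring

theorem etaC_eq (h : DiffAt s z) : etaC s z = dzV (duC s) z + rhoOf s z • duC s z := by
  ext i
  have e1 := dx_dotProduct_add h 1
  have e2 := dx_dotProduct_add h I
  have e1' := eq_neg_of_add_eq_zero_right e1
  have e2' := eq_neg_of_add_eq_zero_right e2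
  rw [Pi.add_apply, dzV_duC h, rhoOf_eq_dx h]
  simp only [etaC, DefiniteSurface.eta, Pi.sub_apply, Pi.smul_apply, smul_eq_mul, duC, e1', e2']
  push_cast
  ring

theorem dzV_ptC_eq (h : DiffAt s z) : dzV (ptC s) z = xiC s z + rhoOf s z • ptC s z := by
  rw [xiC_eq h]; abel

theorem dzV_duC_eq (h : DiffAt s z) : dzV (duC s) z = etaC s z - rhoOf s z • duC s z := by
  rw [etaC_eq h]; abel

theorem dzbarV_star (f : ℂ → Fin 3 → ℂ) : dzbarV (fun w => star (f w)) z = star (dzV f z) := by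
  ext i; exact dzbar_star

theorem dzV_star (f : ℂ → Fin 3 → ℂ) : dzV (fun w => star (f w)) z = star (dzbarV f z) := by
  ext i; exact dz_star

theorem dzbarV_ptC : dzbarV (ptC s) z = star (dzV (ptC s) z) := by
  rw [← dzbarV_star]; congr 1; ext1 w; rw [star_ptC]

theorem dzbarV_duC : dzbarV (duC s) z = star (dzV (duC s) z) := by
  rw [← dzbarV_star]; congr 1; ext1 w; rw [star_duC]

theorem xiC_dotProduct_duC (h : DiffAt s z) : xiC s z ⬝ᵥ duC s z = 0 := by
  rw [xiC_eq h, sub_dotProduct, smul_dotProduct, ptC_dotProduct_duC, ← rhoOf_eq]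
  simp

theorem ptC_dotProduct_etaC (h : DiffAt s z) : ptC s z ⬝ᵥ etaC s z = 0 := by
  rw [etaC_eq h, dotProduct_add, dotProduct_smul, ptC_dotProduct_duC, ptC_dotProduct_dzV_duC h]
  simp

theorem SmoothAt.rhoOf (h : SmoothAt s z) : ContDiffAt ℝ ∞ (rhoOf s) z :=
  ContDiffAt.sum (s := Finset.univ)
    (f := fun i w => DefiniteSurface.dz (fun w => _root_.ptC s w i) w * _root_.duC s w i)
    fun i _ => (h.ptC i).dz.mul (h.duC i)

theorem SmoothAt.xiC (h : SmoothAt s z) (i : Fin 3) : ContDiffAt ℝ ∞ (fun w => xiC s w i) z := by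
  have h1 : ContDiffAt ℝ ∞
      (fun w => DefiniteSurface.dz (fun w => _root_.ptC s w i) w - DefiniteSurface.rhoOf s w * _root_.ptC s w i) z :=
    (h.ptC i).dz.sub (h.rhoOf.mul (h.ptC i))
  refine h1.congr_of_eventuallyEq (h.eventually_diffAt.mono fun w hw => ?_)
  exact congrFun (xiC_eq hw) i

theorem SmoothAt.etaC (h : SmoothAt s z) (i : Fin 3) : ContDiffAt ℝ ∞ (fun w => etaC s w i) z := by
  have h1 : ContDiffAt ℝ ∞
      (fun w => DefiniteSurface.dz (fun w => _root_.duC s w i) w + DefiniteSurface.rhoOf s w * _root_.duC s w i) z :=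
    (h.duC i).dz.add (h.rhoOf.mul (h.duC i))
  refine h1.congr_of_eventuallyEq (h.eventually_diffAt.mono fun w hw => ?_)
  exact congrFun (etaC_eq hw) i

/-! ### Real and complex forms of the invariants -/

theorem xi_eq_re_im (v : ℂ) : xi s z v = v.re • xi s z 1 + v.im • xi s z I := by
  have hv : v = v.re • (1 : ℂ) + v.im • I := by apply Complex.ext <;> simp
  have e : dx s z v = v.re • dx s z 1 + v.im • dx s z I := by
    conv_lhs => rw [hv]
    simp only [dx, map_add, map_smul]
  rw [xi, e, xi, xi]
  simp only [add_dotProduct, smul_dotProduct, smul_eq_mul]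
  ext i
  simp only [Pi.sub_apply, Pi.add_apply, Pi.smul_apply, smul_eq_mul]
  ring

theorem eta_eq_re_im (v : ℂ) : DefiniteSurface.eta s z v =
    v.re • DefiniteSurface.eta s z 1 + v.im • DefiniteSurface.eta s z I := by
  have hv : v = v.re • (1 : ℂ) + v.im • I := by apply Complex.ext <;> simp
  have e : dχ s z v = v.re • dχ s z 1 + v.im • dχ s z I := by
    conv_lhs => rw [hv]
    simp only [dχ, map_add, map_smul]
  rw [DefiniteSurface.eta, e, DefiniteSurface.eta, DefiniteSurface.eta]
  simp only [dotProduct_add, dotProduct_smul, smul_eq_mul]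
  ext i
  simp only [Pi.sub_apply, Pi.add_apply, Pi.smul_apply, smul_eq_mul]
  ring

theorem hForm_eq_re_im (v w : ℂ) : hForm s z v w =
    v.re * w.re * hForm s z 1 1 + v.re * w.im * hForm s z 1 I + v.im * w.re * hForm s z I 1 +
      v.im * w.im * hForm s z I I := by
  simp only [hForm]
  rw [xi_eq_re_im v, eta_eq_re_im w]
  simp only [add_dotProduct, dotProduct_add, smul_dotProduct, dotProduct_smul, smul_eq_mul]
  ring

/-- This pairing vanishes exactly when h₁₁ = h₂₂ and h₁₂ + h₂₁ = 0, that is, when the induced metric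
is conformal. -/
theorem xiC_dotProduct_etaC : xiC s z ⬝ᵥ etaC s z =
    ((hForm s z 1 1 - hForm s z I I : ℝ) - I * (hForm s z 1 I + hForm s z I 1 : ℝ)) / 4 := by
  simp only [xiC, etaC, hForm, dotProduct, Fin.sum_univ_three]
  push_cast
  linear_combination (xi s z I 0 * DefiniteSurface.eta s z I 0 + xi s z I 1 * DefiniteSurface.eta s z I 1 +
    xi s z I 2 * DefiniteSurface.eta s z I 2 : ℂ) / 4 * I_mul_I

/-- For a conformal metric the value is (a + ib)/2 with a = g(∂₁, ∂₁) and b = ω(∂₁, ∂₂), so it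
carries both the conformal factor and the angle. -/
theorem xiC_dotProduct_star_etaC : xiC s z ⬝ᵥ star (etaC s z) =
    ((hForm s z 1 1 + hForm s z I I : ℝ) + I * (hForm s z 1 I - hForm s z I 1 : ℝ)) / 4 := by
  simp only [xiC, etaC, hForm, dotProduct, Fin.sum_univ_three, Pi.star_apply]
  simp
  linear_combination -(xi s z I 0 * DefiniteSurface.eta s z I 0 + xi s z I 1 * DefiniteSurface.eta s z I 1 +
    xi s z I 2 * DefiniteSurface.eta s z I 2 : ℂ) / 4 * I_mul_I

/-- The coefficients of `H, u, θ, φ, Q` in a complex coordinate. -/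
structure LocalData where
  H : ℝ
  u : ℂ → ℝ
  θ : ℂ → ℝ
  φ : ℂ → ℂ
  Q : ℂ → ℂ

/-- The invariants of `proj ∘ s` at `z` are those of `L`, in complex form. -/
structure AdaptedAt (L : LocalData) (s : ℂ → CM5) (z : ℂ) : Prop where
  null : xiC s z ⬝ᵥ etaC s z = 0
  pair : xiC s z ⬝ᵥ star (etaC s z) = L.H * (Real.exp (L.u z) : ℝ) * cOf L.θ z
  mean : dzbarV (xiC s) z ⬝ᵥ etaC s z = L.H * (Real.exp (L.u z) : ℝ) * L.φ z
  cubic : dzV (xiC s) z ⬝ᵥ etaC s z = L.Q z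

/-- The invariants of `proj ∘ s` at `z` are those of `L`. -/
structure InvariantsAt (L : LocalData) (s : ℂ → CM5) (z : ℂ) : Prop where
  metric : ∀ v w : ℂ, gForm s z v w = 2 * L.H * Real.exp (L.u z) * (v * star w).re
  angle : L.θ z = angleOf s z
  mean : L.φ z = phiOf L.H L.u s z
  cubic : L.Q z = cubicOf s z

theorem InvariantsAt.range_θ {L : LocalData} (h : InvariantsAt L s z) :
    L.θ z ∈ Set.Ioo 0 Real.pi := by
  rw [h.angle, angleOf]
  have h1 := Real.neg_pi_div_two_lt_arctan (omegaForm s z 1 I / gForm s z 1 1)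
  have h2 := Real.arctan_lt_pi_div_two (omegaForm s z 1 I / gForm s z 1 1)
  constructor <;> linarith

theorem ofReal_sign_mul_self {H : ℝ} (h : H = 1 ∨ H = -1) : (H : ℂ) * H = 1 := by
  rcases h with rfl | rfl <;> simp

theorem exp_ofReal_ne_zero (t : ℝ) : ((Real.exp t : ℝ) : ℂ) ≠ 0 :=
  ofReal_ne_zero.2 (Real.exp_pos t).ne'

theorem mean_iff {H t : ℝ} (h : H = 1 ∨ H = -1) (a b : ℂ) :
    a = (H * Real.exp (-t) : ℝ) * b ↔ b = H * (Real.exp t : ℝ) * a := by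
  have h1 := ofReal_sign_mul_self h
  have h2 := exp_ofReal_ne_zero t
  rw [Real.exp_neg]
  push_cast
  push_cast at h2
  constructor
  · rintro rfl
    field_simp
    linear_combination (-b) * h1
  · rintro rfl
    field_simp
    linear_combination (-a) * h1

/-- Real and imaginary parts of the two pairings of ξ_z with η_z and its conjugate recover all
entries of h. The range of θ is needed in the converse because arctan inverts tan only on (-π/2,
π/2). -/
theorem invariantsAt_iff {L : LocalData} (hH : L.H = 1 ∨ L.H = -1) :
    InvariantsAt L s z ↔ AdaptedAt L s z ∧ L.θ z ∈ Set.Ioo 0 Real.pi := by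
  have hmean : L.φ z = phiOf L.H L.u s z ↔
      dzbarV (xiC s) z ⬝ᵥ etaC s z = L.H * (Real.exp (L.u z) : ℝ) * L.φ z := mean_iff hH _ _
  have ha : 2 * L.H * Real.exp (L.u z) ≠ 0 := by
    have := (Real.exp_pos (L.u z)).ne'
    rcases hH with h | h <;> rw [h] <;> simp
  have htan : ∀ a b : ℝ, a = 2 * L.H * Real.exp (L.u z) →
      ((a : ℂ) + I * b) / 2 = L.H * (Real.exp (L.u z) : ℝ) * (1 + I * ((b / a : ℝ) : ℂ)) := by
    intro a b h
    have h' : (a : ℂ) = 2 * L.H * (Real.exp (L.u z) : ℝ) := by rw [h]; push_cast; ring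
    have h0 : (a : ℂ) ≠ 0 := by rw [h]; exact ofReal_ne_zero.2 ha
    rw [show (L.H : ℂ) * (Real.exp (L.u z) : ℝ) = a / 2 by rw [h']; ring]
    push_cast
    field_simp
  constructor
  · intro h
    refine ⟨⟨?_, ?_, hmean.1 h.mean, h.cubic.symm⟩, h.range_θ⟩
    · have e1 := h.metric 1 1
      have e2 := h.metric I I
      have e3 := h.metric 1 I
      simp only [gForm, star_one, Complex.star_def, conj_I] at e1 e2 e3
      simp at e1 e2 e3
      rw [xiC_dotProduct_etaC, e3, e1, e2]
      simp
    · have e1 := h.metric 1 1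
      have e2 := h.metric I I
      simp only [gForm, star_one, Complex.star_def, conj_I] at e1 e2
      simp at e1 e2
      have e4 : Real.tan (L.θ z - Real.pi / 2) =
          ((hForm s z 1 I - hForm s z I 1) / 2) / (2 * L.H * Real.exp (L.u z)) := by
        rw [h.angle, angleOf, add_sub_cancel_right, Real.tan_arctan, gForm, omegaForm, ← e1]
        simp
      rw [cOf, e4, ← htan _ _ rfl, xiC_dotProduct_star_etaC, e1, e2]
      push_cast
      ring
  · rintro ⟨h, hθ⟩
    have n1 := h.null
    have n2 := h.pair
    rw [xiC_dotProduct_etaC] at n1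
    rw [xiC_dotProduct_star_etaC, cOf] at n2
    have r1 := congrArg re n1
    have r2 := congrArg im n1
    have r3 := congrArg re n2
    have r4 := congrArg im n2
    simp only [div_ofNat_re, div_ofNat_im, sub_re, sub_im, add_re, add_im, I_mul_re, I_mul_im,
      ofReal_re, ofReal_im, zero_re, zero_im, mul_assoc, re_ofReal_mul, im_ofReal_mul, one_re,
      one_im] at r1 r2 r3 r4
    have e1 : hForm s z 1 1 = 2 * L.H * Real.exp (L.u z) := by linarith
    have e2 : hForm s z I I = 2 * L.H * Real.exp (L.u z) := by linarith
    have e3 : hForm s z 1 I + hForm s z I 1 = 0 := by linarith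
    refine ⟨fun v w => ?_, ?_, hmean.2 h.mean, h.cubic.symm⟩
    · rw [gForm, hForm_eq_re_im v w, hForm_eq_re_im w v, e1, e2]
      have : (v * star w).re = v.re * w.re + v.im * w.im := by simp
      rw [this]
      linear_combination (v.re * w.im + v.im * w.re) / 2 * e3
    · have e4 : (hForm s z 1 I - hForm s z I 1) / 2 / (2 * L.H * Real.exp (L.u z)) =
          Real.tan (L.θ z - Real.pi / 2) := by
        rw [div_eq_iff ha]; linarith
      rw [angleOf, gForm, omegaForm, e1, add_self_div_two, e4, Real.arctan_tan]
      · ring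
      · linarith [hθ.1]
      · linarith [hθ.2]

/-! ### Behaviour under changes of the lift and of the coordinate -/

/-- When ξ is multiplied by a function m, the product rule adds a multiple of ξ itself, and ⟨ξ, η⟩ =
0 kills it. This covers both changes of lift and changes of coordinate. -/
theorem pairings_of_related {ξ η ξ' η' : ℂ → Fin 3 → ℂ} {m n τ : ℂ → ℂ} {τ' : ℂ}
    (hτ : HasDerivAt τ τ' z) (hm : DifferentiableAt ℝ m z)
    (hξ : ∀ i, DifferentiableAt ℝ (fun w => ξ w i) (τ z))
    (h : ∀ᶠ w in 𝓝 z, ξ' w = m w • ξ (τ w)) (hη : η' z = n z • η (τ z))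
    (h0 : ξ (τ z) ⬝ᵥ η (τ z) = 0) :
    dzbarV ξ' z ⬝ᵥ η' z = m z * n z * star τ' * (dzbarV ξ (τ z) ⬝ᵥ η (τ z)) ∧
    dzV ξ' z ⬝ᵥ η' z = m z * n z * τ' * (dzV ξ (τ z) ⬝ᵥ η (τ z)) := by
  have hc : ∀ i, DifferentiableAt ℝ (fun w => ξ (τ w) i) z := fun i =>
    (hξ i).comp z hτ.complexToReal_fderiv.differentiableAt
  have e1 : dzV ξ' z = dz m z • ξ (τ z) + (m z * τ') • dzV ξ (τ z) := by
    ext i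
    have : (fun w => ξ' w i) =ᶠ[𝓝 z] fun w => m w * ξ (τ w) i :=
      h.mono fun w hw => by simp [hw]
    rw [dzV, dz_congr this, dz_mul hm (hc i), dz_comp_holo (f := fun w => ξ w i) hτ (hξ i)]
    simp only [Pi.add_apply, Pi.smul_apply, smul_eq_mul, dzV]
    ring
  have e2 : dzbarV ξ' z = dzbar m z • ξ (τ z) + (m z * star τ') • dzbarV ξ (τ z) := by
    ext i
    have : (fun w => ξ' w i) =ᶠ[𝓝 z] fun w => m w * ξ (τ w) i :=
      h.mono fun w hw => by simp [hw]
    rw [dzbarV, dzbar_congr this, dzbar_mul hm (hc i),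
      dzbar_comp_holo (f := fun w => ξ w i) hτ (hξ i)]
    simp only [Pi.add_apply, Pi.smul_apply, smul_eq_mul, dzbarV]
    ring
  rw [e1, e2, hη]
  simp only [add_dotProduct, smul_dotProduct, dotProduct_smul, smul_eq_mul, h0]
  constructor <;> ring

theorem RescaledAt.xiC {s' : ℂ → CM5} {t : ℂ → ℝ} (h : RescaledAt s s' t z) (hs : DiffAt s z) :
    DefiniteSurface.xiC s' z = (t z : ℂ) • DefiniteSurface.xiC s z := by
  ext i
  simp only [DefiniteSurface.xiC, h.xi hs, Pi.smul_apply, smul_eq_mul]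
  push_cast
  ring

theorem RescaledAt.etaC {s' : ℂ → CM5} {t : ℂ → ℝ} (h : RescaledAt s s' t z) (hs : DiffAt s z) :
    DefiniteSurface.etaC s' z = (t z : ℂ)⁻¹ • DefiniteSurface.etaC s z := by
  ext i
  simp only [DefiniteSurface.etaC, h.eta hs, Pi.smul_apply, smul_eq_mul]
  push_cast
  ring

/-- The invariants do not depend on the lift. -/
theorem AdaptedAt.rescale {L : LocalData} {s' : ℂ → CM5} {t : ℂ → ℝ} (h : AdaptedAt L s z)
    (hs : SmoothAt s z) (ht : ∀ᶠ w in 𝓝 z, RescaledAt s s' t w) : AdaptedAt L s' z := by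
  have h0 : (t z : ℂ) ≠ 0 := ofReal_ne_zero.2 ht.self_of_nhds.eventually.self_of_nhds.1
  have e1 := ht.self_of_nhds.xiC hs.diffAt
  have e2 := ht.self_of_nhds.etaC hs.diffAt
  -- A change of lift is the case τ = id with inverse factors m = t and n = t⁻¹, so the pairings are
  -- unchanged.
  obtain ⟨e3, e4⟩ := pairings_of_related (m := fun w => (t w : ℂ)) (n := fun w => (t w : ℂ)⁻¹)
    (ξ := xiC s) (η := etaC s) (ξ' := xiC s') (η' := etaC s') (hasDerivAt_id z)
    (ofRealCLM.differentiableAt.comp z ht.self_of_nhds.diff)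
    (fun i => (hs.xiC i).differentiableAt (by simp))
    ((ht.and hs.eventually_diffAt).mono fun w hw => hw.1.xiC hw.2) e2 h.null
  simp only [mul_inv_cancel₀ h0, star_one, one_mul, id] at e3 e4
  refine ⟨?_, ?_, e3.trans h.mean, e4.trans h.cubic⟩
  · rw [e1, e2, smul_dotProduct, dotProduct_smul, h.null]; simp
  · rw [e1, e2, star_smul, smul_dotProduct, dotProduct_smul, smul_smul, ← h.pair]
    simp [mul_inv_cancel₀ h0]

theorem DiffAt.comp {τ : ℂ → ℂ} {τ' : ℂ} (hτ : HasDerivAt τ τ' z) (hs : DiffAt s (τ z)) :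
    DiffAt (s ∘ τ) z :=
  DifferentiableAt.comp (g := fun q => (s q : Vec × Vec)) z hs
    hτ.complexToReal_fderiv.differentiableAt

theorem dzV_comp {f : ℂ → Fin 3 → ℂ} {τ : ℂ → ℂ} {τ' : ℂ} (hτ : HasDerivAt τ τ' z)
    (hf : ∀ i, DifferentiableAt ℝ (fun w => f w i) (τ z)) :
    dzV (fun w => f (τ w)) z = τ' • dzV f (τ z) := by
  ext i
  rw [dzV, dz_comp_holo (f := fun w => f w i) hτ (hf i)]
  simp [dzV, mul_comm]

theorem rhoOf_comp {τ : ℂ → ℂ} {τ' : ℂ} (hτ : HasDerivAt τ τ' z) (hs : DiffAt s (τ z)) :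
    rhoOf (s ∘ τ) z = τ' * rhoOf s (τ z) := by
  rw [rhoOf_eq, rhoOf_eq, show ptC (s ∘ τ) = fun w => ptC s (τ w) from rfl,
    dzV_comp hτ hs.ptC, smul_dotProduct]
  rfl

theorem xiC_comp {τ : ℂ → ℂ} {τ' : ℂ} (hτ : HasDerivAt τ τ' z) (hs : DiffAt s (τ z)) :
    xiC (s ∘ τ) z = τ' • xiC s (τ z) := by
  rw [xiC_eq (hs.comp hτ), xiC_eq hs, rhoOf_comp hτ hs,
    show ptC (s ∘ τ) = fun w => ptC s (τ w) from rfl, dzV_comp hτ hs.ptC, smul_sub, smul_smul]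

theorem etaC_comp {τ : ℂ → ℂ} {τ' : ℂ} (hτ : HasDerivAt τ τ' z) (hs : DiffAt s (τ z)) :
    etaC (s ∘ τ) z = τ' • etaC s (τ z) := by
  rw [etaC_eq (hs.comp hτ), etaC_eq hs, rhoOf_comp hτ hs,
    show duC (s ∘ τ) = fun w => duC s (τ w) from rfl, dzV_comp hτ hs.duC, smul_add, smul_smul]

/-- The pairings that define the invariants, in a new complex coordinate. -/
theorem pairings_comp {τ : ℂ → ℂ} (hτ : AnalyticAt ℂ τ z) (hs : SmoothAt s (τ z))
    (h0 : xiC s (τ z) ⬝ᵥ etaC s (τ z) = 0) :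
    xiC (s ∘ τ) z ⬝ᵥ etaC (s ∘ τ) z = 0 ∧
    xiC (s ∘ τ) z ⬝ᵥ star (etaC (s ∘ τ) z) =
      (‖deriv τ z‖ ^ 2 : ℝ) * (xiC s (τ z) ⬝ᵥ star (etaC s (τ z))) ∧
    dzbarV (xiC (s ∘ τ)) z ⬝ᵥ etaC (s ∘ τ) z =
      (‖deriv τ z‖ ^ 2 : ℝ) * deriv τ z * (dzbarV (xiC s) (τ z) ⬝ᵥ etaC s (τ z)) ∧
    dzV (xiC (s ∘ τ)) z ⬝ᵥ etaC (s ∘ τ) z =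
      deriv τ z ^ 3 * (dzV (xiC s) (τ z) ⬝ᵥ etaC s (τ z)) := by
  have hd : HasDerivAt τ (deriv τ z) z := hτ.differentiableAt.hasDerivAt
  have hn : ((‖deriv τ z‖ ^ 2 : ℝ) : ℂ) = deriv τ z * star (deriv τ z) := by
    rw [Complex.star_def, Complex.mul_conj, Complex.normSq_eq_norm_sq]
  have e1 := xiC_comp hd hs.diffAt
  have e2 := etaC_comp hd hs.diffAt
  have hev : ∀ᶠ w in 𝓝 z, xiC (s ∘ τ) w = deriv τ w • xiC s (τ w) := by
    filter_upwards [hτ.eventually_analyticAt, hτ.continuousAt.eventually hs.eventually_diffAt]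
      with w hw hw'
    exact xiC_comp hw.differentiableAt.hasDerivAt hw'
  -- A holomorphic change of coordinate multiplies both ξ_z and η_z by τ'.
  obtain ⟨e3, e4⟩ := pairings_of_related (m := deriv τ) (n := deriv τ)
    (ξ := xiC s) (η := etaC s) (ξ' := xiC (s ∘ τ)) (η' := etaC (s ∘ τ)) hd
    (hτ.deriv.differentiableAt.restrictScalars ℝ)
    (fun i => (hs.xiC i).differentiableAt (by simp)) hev e2 h0
  refine ⟨?_, ?_, ?_, ?_⟩
  · rw [e1, e2, smul_dotProduct, dotProduct_smul, h0]; simp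
  · rw [e1, e2, star_smul, smul_dotProduct, dotProduct_smul, smul_smul, hn, smul_eq_mul]
  · rw [e3, hn]; ring
  · rw [e4]; ring

theorem xiC_actL (h : DiffAt s z) (A : GL3) :
    xiC (fun q => actL A (s q)) z = (A.1.map ofReal) *ᵥ xiC s z := by
  ext i
  simp only [xiC, xi_actL h, Matrix.mulVec, dotProduct, Fin.sum_univ_three, Matrix.map_apply]
  push_cast
  ring

theorem etaC_actL (h : DiffAt s z) (A : GL3) :
    etaC (fun q => actL A (s q)) z = etaC s z ᵥ* (A.2.map ofReal) := by
  ext i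
  simp only [etaC, eta_actL h, Matrix.vecMul, dotProduct, Fin.sum_univ_three, Matrix.map_apply]
  push_cast
  ring

theorem ptC_actL (A : GL3) :
    ptC (fun q => actL A (s q)) z = (A.1.map ofReal) *ᵥ ptC s z := by
  ext i
  simp only [ptC, actL, Matrix.mulVec, dotProduct, Fin.sum_univ_three, Matrix.map_apply]
  push_cast
  ring

theorem duC_actL (A : GL3) :
    duC (fun q => actL A (s q)) z = duC s z ᵥ* (A.2.map ofReal) := by
  ext i
  simp only [duC, actL, Matrix.vecMul, dotProduct, Fin.sum_univ_three, Matrix.map_apply]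
  push_cast
  ring

theorem map_inv_mul_map (A : GL3) : A.2.map ofReal * A.1.map ofReal = (1 : Matrix _ _ ℂ) := by
  have := congrArg (fun B => B.map (ofRealHom : ℝ →+* ℂ)) A.inv_val
  simp only [Matrix.map_mul] at this
  rw [Matrix.map_one _ (map_zero _) (map_one _)] at this
  exact this

theorem dzV_mulVec (A : Matrix (Fin 3) (Fin 3) ℂ) {f : ℂ → Fin 3 → ℂ}
    (hf : ∀ i, DifferentiableAt ℝ (fun w => f w i) z) :
    dzV (fun w => A *ᵥ f w) z = A *ᵥ dzV f z ∧ dzbarV (fun w => A *ᵥ f w) z = A *ᵥ dzbarV f z := by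
  constructor <;> ext i
  · have := dz_dotProduct (f := fun _ => A i) (fun j => differentiableAt_const (A i j)) hf
    have h0 : dzV (fun _ => A i) z = 0 := by ext j; simp [dzV]
    rw [h0, zero_dotProduct, zero_add] at this
    exact this
  · have := dzbar_dotProduct (f := fun _ => A i) (fun j => differentiableAt_const (A i j)) hf
    have h0 : dzbarV (fun _ => A i) z = 0 := by ext j; simp [dzbarV]
    rw [h0, zero_dotProduct, zero_add] at this
    exact this

/-- The linear action preserves the invariants. -/
theorem AdaptedAt.actL {L : LocalData} (h : AdaptedAt L s z) (hs : SmoothAt s z) (A : GL3) :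
    AdaptedAt L (fun q => actL A (s q)) z := by
  have e1 := xiC_actL hs.diffAt A
  have e2 := etaC_actL hs.diffAt A
  have hev : xiC (fun q => _root_.actL A (s q)) =ᶠ[𝓝 z]
      fun w => (A.1.map ofReal) *ᵥ xiC s w := hs.eventually_diffAt.mono fun w hw => xiC_actL hw A
  have hd := dzV_mulVec (A.1.map ofReal) (fun i => (hs.xiC i).differentiableAt (by simp))
  have e3 : dzV (xiC (fun q => _root_.actL A (s q))) z = (A.1.map ofReal) *ᵥ dzV (xiC s) z := by
    rw [← hd.1]; ext i
    exact dz_congr (hev.mono fun w hw => congrFun hw i)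
  have e4 : dzbarV (xiC (fun q => _root_.actL A (s q))) z =
      (A.1.map ofReal) *ᵥ dzbarV (xiC s) z := by
    rw [← hd.2]; ext i
    exact dzbar_congr (hev.mono fun w hw => congrFun hw i)
  have e5 : star (etaC s z ᵥ* A.2.map ofReal) = star (etaC s z) ᵥ* A.2.map ofReal := by
    ext i
    simp [Matrix.vecMul, dotProduct]
  refine ⟨?_, ?_, ?_, ?_⟩
  · rw [e1, e2, mulVec_dotProduct_vecMul (map_inv_mul_map A), h.null]
  · rw [e1, e2, e5, mulVec_dotProduct_vecMul (map_inv_mul_map A), h.pair]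
  · rw [e4, e2, mulVec_dotProduct_vecMul (map_inv_mul_map A), h.mean]
  · rw [e3, e2, mulVec_dotProduct_vecMul (map_inv_mul_map A), h.cubic]

theorem rhoOf_actL (hs : DiffAt s z) (A : GL3) : rhoOf (fun q => actL A (s q)) z = rhoOf s z := by
  rw [rhoOf_eq, rhoOf_eq, show ptC (fun q => actL A (s q)) = fun w => (A.1.map ofReal) *ᵥ ptC s w
    from funext fun w => ptC_actL A, (dzV_mulVec _ hs.ptC).1, duC_actL,
    mulVec_dotProduct_vecMul (map_inv_mul_map A)]

end Complexified

/-! ### The moving frame of a lift and its connection. -/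

noncomputable section StructureEquations

open Complex

abbrev Mat3 : Type := Matrix (Fin 3) (Fin 3) ℂ

/-- `∂_z` of a matrix-valued function. -/
def dzM (F : ℂ → Mat3) (z : ℂ) : Mat3 := Matrix.of fun i j => dz (fun w => F w i j) z

/-- `∂_z̄` of a matrix-valued function. -/
def dzbarM (F : ℂ → Mat3) (z : ℂ) : Mat3 := Matrix.of fun i j => dzbar (fun w => F w i j) z

variable {z : ℂ}

theorem dzM_congr {F G : ℂ → Mat3} (h : F =ᶠ[𝓝 z] G) : dzM F z = dzM G z := by
  ext i j; exact dz_congr (h.mono fun w hw => congrFun (congrFun hw i) j)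

theorem dzbarM_congr {F G : ℂ → Mat3} (h : F =ᶠ[𝓝 z] G) : dzbarM F z = dzbarM G z := by
  ext i j; exact dzbar_congr (h.mono fun w hw => congrFun (congrFun hw i) j)

/-- All entries are differentiable. -/
def DiffM (F : ℂ → Mat3) (z : ℂ) : Prop := ∀ i j, DifferentiableAt ℝ (fun w => F w i j) z

/-- All entries are smooth. -/
def SmoothM (F : ℂ → Mat3) (z : ℂ) : Prop := ∀ i j, ContDiffAt ℝ ∞ (fun w => F w i j) z

theorem SmoothM.diffM {F : ℂ → Mat3} (h : SmoothM F z) : DiffM F z := fun i j =>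
  (h i j).differentiableAt (by simp)

theorem dzM_mul {F G : ℂ → Mat3} (hF : DiffM F z) (hG : DiffM G z) :
    dzM (fun w => F w * G w) z = dzM F z * G z + F z * dzM G z := by
  ext i j
  exact dz_dotProduct (f := fun w => F w i) (g := fun w k => G w k j) (hF i) (fun k => hG k j)

theorem dzbarM_mul {F G : ℂ → Mat3} (hF : DiffM F z) (hG : DiffM G z) :
    dzbarM (fun w => F w * G w) z = dzbarM F z * G z + F z * dzbarM G z := by
  ext i j
  exact dzbar_dotProduct (f := fun w => F w i) (g := fun w k => G w k j) (hF i) (fun k => hG k j)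

theorem DiffM.mul {F G : ℂ → Mat3} (hF : DiffM F z) (hG : DiffM G z) :
    DiffM (fun w => F w * G w) z := fun i j =>
  DifferentiableAt.fun_sum (u := Finset.univ) (A := fun k w => F w i k * G w k j)
    fun k _ => (hF i k).fun_mul (hG k j)

theorem dzM_dzbarM_comm {F : ℂ → Mat3} (hF : SmoothM F z) :
    dzM (dzbarM F) z = dzbarM (dzM F) z := by
  ext i j; exact dz_dzbar_comm (hF i j)

/-- Complex conjugation of a matrix, followed by exchanging the last two rows and columns. -/
def conjSwap (A : Mat3) : Mat3 := (A.map star).submatrix ![0, 2, 1] ![0, 2, 1]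

/-- Complex conjugation of a matrix, followed by exchanging the last two columns. -/
def conjSwapCol (A : Mat3) : Mat3 := (A.map star).submatrix id ![0, 2, 1]

theorem conjSwap_apply (A : Mat3) (i j : Fin 3) :
    conjSwap A i j = star (A (![0, 2, 1] i) (![0, 2, 1] j)) := rfl

theorem conjSwapCol_apply (A : Mat3) (i j : Fin 3) :
    conjSwapCol A i j = star (A i (![0, 2, 1] j)) := rfl

theorem conjSwapCol_mul (A B : Mat3) : conjSwapCol (A * B) = conjSwapCol A * conjSwap B := by
  ext i j
  simp [conjSwapCol_apply, conjSwap_apply, Matrix.mul_apply, Fin.sum_univ_three]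
  ring

theorem conjSwap_mul (A B : Mat3) : conjSwap (A * B) = conjSwap A * conjSwap B := by
  ext i j
  simp [conjSwap_apply, Matrix.mul_apply, Fin.sum_univ_three]
  ring

theorem conjSwap_add (A B : Mat3) : conjSwap (A + B) = conjSwap A + conjSwap B := by
  ext i j
  simp [conjSwap_apply]

theorem conjSwap_conjSwap (A : Mat3) : conjSwap (conjSwap A) = A := by
  ext i j
  fin_cases i <;> fin_cases j <;> simp [conjSwap_apply]

theorem dzM_conjSwap (F : ℂ → Mat3) : dzM (fun w => conjSwap (F w)) z = conjSwap (dzbarM F z) := by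
  ext i j; exact dz_star

theorem dzbarM_conjSwapCol (F : ℂ → Mat3) :
    dzbarM (fun w => conjSwapCol (F w)) z = conjSwapCol (dzM F z) := by
  ext i j; exact dzbar_star

theorem dzM_conjSwapCol (F : ℂ → Mat3) :
    dzM (fun w => conjSwapCol (F w)) z = conjSwapCol (dzbarM F z) := by
  ext i j; exact dz_star

/-! ### The connection matrices -/

/-- The coefficient functions are smooth near `z`, with `H = ±1` and `0 < θ < π`. -/
structure LocalData.RegularAt (L : LocalData) (z : ℂ) : Prop where
  sign : L.H = 1 ∨ L.H = -1
  u : ContDiffAt ℝ ∞ L.u z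
  θ : ContDiffAt ℝ ∞ L.θ z
  range_θ : L.θ z ∈ Set.Ioo 0 Real.pi
  φ : ContDiffAt ℝ ∞ L.φ z
  Q : ContDiffAt ℝ ∞ L.Q z

/-- `H e^u`. -/
def LocalData.a (L : LocalData) (z : ℂ) : ℂ := L.H * (Real.exp (L.u z) : ℝ)

/-- `log c + u`. -/
def LocalData.ell (L : LocalData) (z : ℂ) : ℂ := log (cOf L.θ z) + (L.u z : ℂ)

/-- The matrix of `∂_z` in the frame `x, ξ_z, ξ_z̄`. -/
def LocalData.connZ (L : LocalData) (ρ : ℂ → ℂ) (z : ℂ) : Mat3 :=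
  !![ρ z, 0, -(L.a z * star (cOf L.θ z));
     1, dz L.ell z + (cOf L.θ z)⁻¹ * L.φ z + ρ z, (cOf L.θ z)⁻¹ * star (L.φ z);
     0, (L.a z * star (cOf L.θ z))⁻¹ * L.Q z, (star (cOf L.θ z))⁻¹ * L.φ z + ρ z]

/-- The matrix of `∂_z̄` in the frame `x, ξ_z, ξ_z̄`. -/
def LocalData.connZbar (L : LocalData) (ρ : ℂ → ℂ) (z : ℂ) : Mat3 := conjSwap (L.connZ ρ z)

/-- The integrability condition of `dF = F (U dz + V dz̄)`. -/
def LocalData.FlatAt (L : LocalData) (ρ : ℂ → ℂ) (z : ℂ) : Prop :=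
  L.connZbar ρ z * L.connZ ρ z + dzbarM (L.connZ ρ) z =
    L.connZ ρ z * L.connZbar ρ z + dzM (L.connZbar ρ) z

namespace LocalData

variable {L : LocalData}

theorem a_ne_zero (hH : L.H = 1 ∨ L.H = -1) (z : ℂ) : L.a z ≠ 0 := by
  refine mul_ne_zero ?_ (exp_ofReal_ne_zero _)
  rcases hH with h | h <;> simp [h]

theorem star_a (z : ℂ) : star (L.a z) = L.a z := by
  simp only [a, star_mul', Complex.star_def, conj_ofReal]

theorem RegularAt.a_ne_zero (h : L.RegularAt z) : L.a z ≠ 0 := LocalData.a_ne_zero h.sign z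

theorem RegularAt.contDiffAt_c (h : L.RegularAt z) : ContDiffAt ℝ ∞ (cOf L.θ) z :=
  contDiffAt_cOf h.θ h.range_θ

theorem RegularAt.contDiffAt_a (h : L.RegularAt z) : ContDiffAt ℝ ∞ L.a z :=
  contDiffAt_const.mul (Real.contDiff_exp.contDiffAt.comp z h.u).ofReal_comp'

theorem RegularAt.contDiffAt_log_c (h : L.RegularAt z) :
    ContDiffAt ℝ ∞ (fun w => log (cOf L.θ w)) z :=
  ((contDiffAt_log (cOf_mem_slitPlane L.θ z)).restrict_scalars ℝ).comp z h.contDiffAt_c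

theorem RegularAt.contDiffAt_ell (h : L.RegularAt z) : ContDiffAt ℝ ∞ L.ell z :=
  h.contDiffAt_log_c.add h.u.ofReal_comp'

theorem RegularAt.dz_a (h : L.RegularAt z) :
    dz L.a z = L.a z * dz (fun w => (L.u w : ℂ)) z := by
  have e := dz_const_mul (L.H : ℂ) (f := fun w => ((Real.exp (L.u w) : ℝ) : ℂ)) (z := z)
    ((Real.contDiff_exp.contDiffAt.comp z h.u).ofReal_comp'.differentiableAt (by simp))
  rw [dz_exp_ofReal (h.u.ofReal_comp'.differentiableAt (by simp))] at e
  rw [show dz L.a z = dz (fun w => (L.H : ℂ) * ((Real.exp (L.u w) : ℝ) : ℂ)) z from rfl, e, a]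
  ring

theorem RegularAt.dzbar_a (h : L.RegularAt z) :
    dzbar L.a z = L.a z * dzbar (fun w => (L.u w : ℂ)) z := by
  rw [dzbar_ofReal, ← star_a, ← star_mul', ← h.dz_a, ← dzbar_star]
  congr 1
  ext1 w
  exact (star_a w).symm

theorem RegularAt.dz_ell (h : L.RegularAt z) : dz L.ell z =
    (cOf L.θ z)⁻¹ * dz (cOf L.θ) z + dz (fun w => (L.u w : ℂ)) z := by
  rw [← dz_log (h.contDiffAt_c.differentiableAt (by simp)) (cOf_mem_slitPlane _ _)]
  exact dz_add (h.contDiffAt_log_c.differentiableAt (by simp))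
    (h.u.ofReal_comp'.differentiableAt (by simp))

theorem RegularAt.smoothM_connZ (h : L.RegularAt z) {ρ : ℂ → ℂ} (hρ : ContDiffAt ℝ ∞ ρ z) :
    SmoothM (L.connZ ρ) z := by
  have hc := h.contDiffAt_c
  have hc' := hc.star_comp
  have hci := hc.inv (cOf_ne_zero _ _)
  have hci' := hc'.inv (star_cOf_ne_zero _ _)
  have ha := h.contDiffAt_a.mul hc'
  have hai := ha.inv (mul_ne_zero h.a_ne_zero (star_cOf_ne_zero _ _))
  have h0 : ∀ b : ℂ, ContDiffAt ℝ ∞ (fun _ : ℂ => b) z := fun b => contDiffAt_const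
  intro i j
  fin_cases i <;> fin_cases j
  · exact hρ
  · exact h0 0
  · exact ha.neg
  · exact h0 1
  · exact (h.contDiffAt_ell.dz.add (hci.mul h.φ)).add hρ
  · exact hci.mul h.φ.star_comp
  · exact h0 0
  · exact hai.mul h.Q
  · exact (hci'.mul h.φ).add hρ

theorem smoothM_conjSwap {F : ℂ → Mat3} (h : SmoothM F z) : SmoothM (fun w => conjSwap (F w)) z :=
  fun _ _ => (h _ _).star_comp

theorem RegularAt.smoothM_connZbar (h : L.RegularAt z) {ρ : ℂ → ℂ} (hρ : ContDiffAt ℝ ∞ ρ z) :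
    SmoothM (L.connZbar ρ) z := smoothM_conjSwap (h.smoothM_connZ hρ)

theorem trace_connZ (ρ : ℂ → ℂ) : (L.connZ ρ z).trace = 3 * ρ z + dz L.ell z +
    ((cOf L.θ z)⁻¹ + (star (cOf L.θ z))⁻¹) * L.φ z := by
  simp [Matrix.trace, Fin.sum_univ_three, connZ]
  ring

end LocalData

/-! ### The structure equations of a lift -/

/-- The frame `x, ξ_z, ξ_z̄`. -/
def frame (s : ℂ → CM5) (z : ℂ) : Mat3 :=
  Matrix.of fun i => ![ptC s z i, xiC s z i, star (xiC s z i)]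

/-- The frame dual to `x, ξ_z, ξ_z̄`. -/
def coframe (L : LocalData) (s : ℂ → CM5) (z : ℂ) : Mat3 :=
  Matrix.of ![duC s z, (L.a z * cOf L.θ z)⁻¹ • star (etaC s z),
    (L.a z * star (cOf L.θ z))⁻¹ • etaC s z]

variable {s : ℂ → CM5} {L : LocalData}

/-- Conjugation fixes the real vector x and exchanges ξ_z with its conjugate. This is the reality
condition that singles out frames coming from real lifts. -/
theorem conjSwapCol_frame : conjSwapCol (frame s z) = frame s z := by
  ext i j
  fin_cases j <;> simp [conjSwapCol, frame, ptC]

theorem SmoothAt.smoothM_frame (h : SmoothAt s z) : SmoothM (frame s) z := by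
  intro i j
  fin_cases j
  · exact h.ptC i
  · exact h.xiC i
  · exact (h.xiC i).star_comp

theorem star_dotProduct_eq (v w : Fin 3 → ℂ) : star v ⬝ᵥ w = star (v ⬝ᵥ star w) := by
  simp [dotProduct]

theorem AdaptedAt.pair' (h : AdaptedAt L s z) :
    xiC s z ⬝ᵥ star (etaC s z) = L.a z * cOf L.θ z := h.pair

theorem AdaptedAt.mean' (h : AdaptedAt L s z) :
    dzbarV (xiC s) z ⬝ᵥ etaC s z = L.a z * L.φ z := h.mean

/-- Duality is the table of pairings: ⟨x, χ⟩ = 1, horizontality, conformality, and ⟨ξ_z, conj η_z⟩ =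
ac. In particular the frame is invertible. -/
theorem AdaptedAt.coframe_mul_frame (h : AdaptedAt L s z) (hs : DiffAt s z)
    (hH : L.H = 1 ∨ L.H = -1) : coframe L s z * frame s z = 1 := by
  have ha := L.a_ne_zero hH z
  have hc := cOf_ne_zero L.θ z
  have hc' := star_cOf_ne_zero L.θ z
  have e1 : ptC s z ⬝ᵥ star (etaC s z) = 0 := by
    rw [← star_ptC, star_dotProduct_star', ptC_dotProduct_etaC hs, star_zero]
  have e2 : star (xiC s z) ⬝ᵥ duC s z = 0 := by
    rw [star_dotProduct_eq, star_duC, xiC_dotProduct_duC hs, star_zero]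
  have e3 : star (xiC s z) ⬝ᵥ star (etaC s z) = 0 := by
    rw [star_dotProduct_star', h.null, star_zero]
  have e4 : star (xiC s z) ⬝ᵥ etaC s z = L.a z * star (cOf L.θ z) := by
    rw [star_dotProduct_eq, h.pair', star_mul', L.star_a]
  have key : ∀ i j, (coframe L s z * frame s z) i j =
      ![ptC s z, xiC s z, star (xiC s z)] j ⬝ᵥ coframe L s z i := by
    intro i j
    rw [dotProduct_comm, Matrix.mul_apply, dotProduct]
    refine Finset.sum_congr rfl fun k _ => ?_
    fin_cases j <;> rfl
  have r0 : coframe L s z 0 = duC s z := rfl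
  have r1 : coframe L s z 1 = (L.a z * cOf L.θ z)⁻¹ • star (etaC s z) := rfl
  have r2 : coframe L s z 2 = (L.a z * star (cOf L.θ z))⁻¹ • etaC s z := rfl
  have f0 : ![ptC s z, xiC s z, star (xiC s z)] 0 = ptC s z := rfl
  have f1 : ![ptC s z, xiC s z, star (xiC s z)] 1 = xiC s z := rfl
  have f2 : ![ptC s z, xiC s z, star (xiC s z)] 2 = star (xiC s z) := rfl
  have m1 := inv_mul_cancel₀ (mul_ne_zero ha hc)
  have m2 := inv_mul_cancel₀ (mul_ne_zero ha hc')
  have k00 := (key 0 0).trans (by rw [r0, f0, ptC_dotProduct_duC])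
  have k01 := (key 0 1).trans (by rw [r0, f1, xiC_dotProduct_duC hs])
  have k02 := (key 0 2).trans (by rw [r0, f2, e2])
  have k10 := (key 1 0).trans (by rw [r1, f0, dotProduct_smul, e1, smul_zero])
  have k11 := (key 1 1).trans (by rw [r1, f1, dotProduct_smul, h.pair', smul_eq_mul, m1])
  have k12 := (key 1 2).trans (by rw [r1, f2, dotProduct_smul, e3, smul_zero])
  have k20 := (key 2 0).trans (by rw [r2, f0, dotProduct_smul, ptC_dotProduct_etaC hs, smul_zero])
  have k21 := (key 2 1).trans (by rw [r2, f1, dotProduct_smul, h.null, smul_zero])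
  have k22 := (key 2 2).trans (by rw [r2, f2, dotProduct_smul, e4, smul_eq_mul, m2])
  ext i j
  fin_cases i <;> fin_cases j
  exacts [k00, k01, k02, k10, k11, k12, k20, k21, k22]

/-- Expansion of a vector in the frame. -/
theorem AdaptedAt.expand (h : AdaptedAt L s z) (hs : DiffAt s z)
    (hH : L.H = 1 ∨ L.H = -1) (v : Fin 3 → ℂ) :
    v = frame s z *ᵥ ![v ⬝ᵥ duC s z, (L.a z * cOf L.θ z)⁻¹ * (v ⬝ᵥ star (etaC s z)),
      (L.a z * star (cOf L.θ z))⁻¹ * (v ⬝ᵥ etaC s z)] := by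
  have e := h.coframe_mul_frame hs hH
  have e' : frame s z * coframe L s z = 1 := mul_eq_one_comm.1 e
  have : coframe L s z *ᵥ v = ![v ⬝ᵥ duC s z, (L.a z * cOf L.θ z)⁻¹ * (v ⬝ᵥ star (etaC s z)),
      (L.a z * star (cOf L.θ z))⁻¹ * (v ⬝ᵥ etaC s z)] := by
    ext i
    rw [Matrix.mulVec, dotProduct_comm]
    fin_cases i
    · rfl
    · exact dotProduct_smul (L.a z * cOf L.θ z)⁻¹ v (star (etaC s z))
    · exact dotProduct_smul (L.a z * star (cOf L.θ z))⁻¹ v (etaC s z)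
  rw [← this, Matrix.mulVec_mulVec, e', Matrix.one_mulVec]

/-- Since ξ_z = ∂_z x - ρx and ∂_z̄∂_z x is real, subtracting the conjugate leaves no second
derivatives of x. The analogous identity for η follows. -/
theorem dzbarV_xiC_sub (hs : SmoothAt s z) :
    dzbarV (xiC s) z - star (dzbarV (xiC s) z) =
      (star (dzbar (rhoOf s) z) - dzbar (rhoOf s) z) • ptC s z -
        rhoOf s z • star (xiC s z) + star (rhoOf s z) • xiC s z := by
  have hd := hs.diffAt
  have key : ∀ i, dzbarV (xiC s) z i = dzbar (fun w => dz (fun w => ptC s w i) w) z -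
      (dzbar (rhoOf s) z * ptC s z i + rhoOf s z * dzbar (fun w => ptC s w i) z) := by
    intro i
    have e : (fun w => xiC s w i) =ᶠ[𝓝 z] fun w => dz (fun w => ptC s w i) w -
        rhoOf s w * ptC s w i :=
      hs.eventually_diffAt.mono fun w hw => congrFun (xiC_eq hw) i
    have h1 : DifferentiableAt ℝ (fun w => rhoOf s w) z := hs.rhoOf.differentiableAt (by simp)
    rw [dzbarV, dzbar_congr e, dzbar_sub ((hs.ptC i).dz.differentiableAt (by simp))
      (h1.fun_mul (hd.ptC i)), dzbar_mul h1 (hd.ptC i)]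
  ext i
  have e1 : star (dzbar (fun w => dz (fun w => ptC s w i) w) z) =
      dzbar (fun w => dz (fun w => ptC s w i) w) z := by
    rw [← dz_star, ← dz_dzbar_comm (hs.ptC i)]
    congr 1
    ext1 w
    rw [← dzbar_star]
    congr 1
    ext1 w
    exact congrFun star_ptC i
  have e2 : dzbar (fun w => ptC s w i) z = star (xiC s z i) + star (rhoOf s z) * ptC s z i := by
    have := congrFun (dzbarV_ptC (s := s) (z := z)) i
    rw [dzV_ptC_eq hd] at this
    refine this.trans ?_
    have h3 := congrFun (star_ptC (s := s) (z := z)) i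
    simp only [Pi.star_apply] at h3
    simp only [Pi.star_apply, Pi.add_apply, Pi.smul_apply, smul_eq_mul, star_add, star_mul', h3]
  have h3 := congrFun (star_ptC (s := s) (z := z)) i
  simp only [Pi.star_apply] at h3
  simp only [Pi.sub_apply, Pi.add_apply, Pi.smul_apply, smul_eq_mul, Pi.star_apply, key, star_sub,
    star_add, star_mul', e1, e2, h3, star_star]
  ring

theorem dzbarV_etaC_sub (hs : SmoothAt s z) :
    dzbarV (etaC s) z - star (dzbarV (etaC s) z) =
      (dzbar (rhoOf s) z - star (dzbar (rhoOf s) z)) • duC s z +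
        rhoOf s z • star (etaC s z) - star (rhoOf s z) • etaC s z := by
  have hd := hs.diffAt
  have key : ∀ i, dzbarV (etaC s) z i = dzbar (fun w => dz (fun w => duC s w i) w) z +
      (dzbar (rhoOf s) z * duC s z i + rhoOf s z * dzbar (fun w => duC s w i) z) := by
    intro i
    have e : (fun w => etaC s w i) =ᶠ[𝓝 z] fun w => dz (fun w => duC s w i) w +
        rhoOf s w * duC s w i :=
      hs.eventually_diffAt.mono fun w hw => congrFun (etaC_eq hw) i
    have h1 : DifferentiableAt ℝ (fun w => rhoOf s w) z := hs.rhoOf.differentiableAt (by simp)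
    rw [dzbarV, dzbar_congr e, dzbar_add ((hs.duC i).dz.differentiableAt (by simp))
      (h1.fun_mul (hd.duC i)), dzbar_mul h1 (hd.duC i)]
  ext i
  have e1 : star (dzbar (fun w => dz (fun w => duC s w i) w) z) =
      dzbar (fun w => dz (fun w => duC s w i) w) z := by
    rw [← dz_star, ← dz_dzbar_comm (hs.duC i)]
    congr 1
    ext1 w
    rw [← dzbar_star]
    congr 1
    ext1 w
    exact congrFun star_duC i
  have e2 : dzbar (fun w => duC s w i) z = star (etaC s z i) - star (rhoOf s z) * duC s z i := by
    have := congrFun (dzbarV_duC (s := s) (z := z)) i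
    rw [dzV_duC_eq hd] at this
    refine this.trans ?_
    have h3 := congrFun (star_duC (s := s) (z := z)) i
    simp only [Pi.star_apply] at h3
    simp only [Pi.star_apply, Pi.sub_apply, Pi.smul_apply, smul_eq_mul, star_sub, star_mul', h3]
  have h3 := congrFun (star_duC (s := s) (z := z)) i
  simp only [Pi.star_apply] at h3
  simp only [Pi.sub_apply, Pi.add_apply, Pi.smul_apply, smul_eq_mul, Pi.star_apply, key,
    star_add, star_sub, star_mul', e1, e2, h3, star_star]
  ring

/-- Differentiating ⟨ξ_z, χ⟩ = 0 moves the derivative to χ, and the horizontal part of dχ is η. -/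
theorem dzbarV_xiC_dotProduct_duC (hs : SmoothAt s z) :
    dzbarV (xiC s) z ⬝ᵥ duC s z = -(xiC s z ⬝ᵥ star (etaC s z)) := by
  have hd := hs.diffAt
  have hξ : ∀ i, DifferentiableAt ℝ (fun w => xiC s w i) z := fun i =>
    (hs.xiC i).differentiableAt (by simp)
  have e := dzbar_dotProduct hξ hd.duC
  have e0 : (fun w => xiC s w ⬝ᵥ duC s w) =ᶠ[𝓝 z] fun _ => 0 :=
    hs.eventually_diffAt.mono fun w hw => xiC_dotProduct_duC hw
  rw [dzbar_congr e0, dzbar_const, dzbarV_duC, dzV_duC_eq hd, star_sub, star_smul, star_duC,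
    dotProduct_sub, dotProduct_smul, xiC_dotProduct_duC hd, smul_zero, sub_zero] at e
  linear_combination -e

theorem dzV_xiC_dotProduct_duC (hs : SmoothAt s z) :
    dzV (xiC s) z ⬝ᵥ duC s z = -(xiC s z ⬝ᵥ etaC s z) := by
  have hd := hs.diffAt
  have hξ : ∀ i, DifferentiableAt ℝ (fun w => xiC s w i) z := fun i =>
    (hs.xiC i).differentiableAt (by simp)
  have e := dz_dotProduct hξ hd.duC
  have e0 : (fun w => xiC s w ⬝ᵥ duC s w) =ᶠ[𝓝 z] fun _ => 0 :=
    hs.eventually_diffAt.mono fun w hw => xiC_dotProduct_duC hw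
  rw [dz_congr e0, dz_const, dzV_duC_eq hd,
    dotProduct_sub, dotProduct_smul, xiC_dotProduct_duC hd, smul_zero, sub_zero] at e
  linear_combination -e

/-- Replacing ∂_z̄ ξ_z by its conjugate via `dzbarV_xiC_sub` reduces this pairing to the conjugate
of the one defining φ. -/
theorem AdaptedAt.dzbarV_xiC_dotProduct_star_etaC (h : AdaptedAt L s z) (hs : SmoothAt s z) :
    dzbarV (xiC s) z ⬝ᵥ star (etaC s z) =
      L.a z * star (L.φ z) + star (rhoOf s z) * (L.a z * cOf L.θ z) := by
  have hd := hs.diffAt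
  have e1 : ptC s z ⬝ᵥ star (etaC s z) = 0 := by
    rw [← star_ptC, star_dotProduct_star', ptC_dotProduct_etaC hd, star_zero]
  have e := congrArg (fun v => v ⬝ᵥ star (etaC s z)) (dzbarV_xiC_sub hs)
  simp only [sub_dotProduct, add_dotProduct, smul_dotProduct, e1, star_dotProduct_star', h.null,
    h.mean', h.pair', smul_eq_mul, star_mul', L.star_a, star_zero] at e
  linear_combination e

/-- Differentiating ⟨ξ_z, conj η_z⟩ = ac by ∂_z and ⟨ξ_z, η_z⟩ = 0 by ∂_z̄ leaves derivatives of η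
that are conjugate to each other; `dzbarV_etaC_sub` relates them. -/
theorem AdaptedAt.dzV_xiC_dotProduct_star_etaC (hA : ∀ᶠ w in 𝓝 z, AdaptedAt L s w)
    (hs : SmoothAt s z) (hL : L.RegularAt z) :
    dzV (xiC s) z ⬝ᵥ star (etaC s z) =
      L.a z * cOf L.θ z * (dz L.ell z + (cOf L.θ z)⁻¹ * L.φ z + rhoOf s z) := by
  have hd := hs.diffAt
  have h := hA.self_of_nhds
  have hξ : ∀ i, DifferentiableAt ℝ (fun w => xiC s w i) z := fun i =>
    (hs.xiC i).differentiableAt (by simp)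
  have hη : ∀ i, DifferentiableAt ℝ (fun w => etaC s w i) z := fun i =>
    (hs.etaC i).differentiableAt (by simp)
  have hη' : ∀ i, DifferentiableAt ℝ (fun w => (star (etaC s w)) i) z := fun i =>
    (hη i).star_comp
  have hc := hL.contDiffAt_c.differentiableAt (by simp)
  have ha := hL.contDiffAt_a.differentiableAt (by simp)
  have e1 := dzbar_dotProduct hξ hη
  have e2 := dz_dotProduct hξ hη'
  rw [dzbar_congr (hA.mono fun w hw => hw.null), dzbar_const, h.mean'] at e1
  rw [dz_congr (hA.mono fun w hw => hw.pair'), dz_mul ha hc, hL.dz_a, dzV_star] at e2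
  have e3 := congrArg (fun v => xiC s z ⬝ᵥ v) (dzbarV_etaC_sub hs)
  simp only [dotProduct_sub, dotProduct_add, dotProduct_smul, xiC_dotProduct_duC hd, h.null,
    h.pair', smul_eq_mul] at e3
  rw [hL.dz_ell]
  have hc0 := cOf_ne_zero L.θ z
  field_simp
  linear_combination -e2 + e1 + e3

/-- The structure equation `∂_z F = F U`. -/
theorem AdaptedAt.dzM_frame (hA : ∀ᶠ w in 𝓝 z, AdaptedAt L s w)
    (hs : SmoothAt s z) (hL : L.RegularAt z) :
    dzM (frame s) z = frame s z * L.connZ (rhoOf s) z := by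
  have hd := hs.diffAt
  have h := hA.self_of_nhds
  have ha := hL.a_ne_zero
  have hc := cOf_ne_zero L.θ z
  have hc' := star_cOf_ne_zero L.θ z
  have c0 : ∀ i, dzM (frame s) z i 0 = (frame s z * L.connZ (rhoOf s) z) i 0 := by
    intro i
    have : dzM (frame s) z i 0 = dzV (ptC s) z i := rfl
    rw [this, dzV_ptC_eq hd]
    simp [Matrix.mul_apply, Fin.sum_univ_three, frame, LocalData.connZ]
    ring
  have c1 : ∀ i, dzM (frame s) z i 1 = (frame s z * L.connZ (rhoOf s) z) i 1 := by
    intro i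
    have : dzM (frame s) z i 1 = dzV (xiC s) z i := rfl
    rw [this, h.expand hd hL.sign (dzV (xiC s) z), dzV_xiC_dotProduct_duC hs, h.null,
      AdaptedAt.dzV_xiC_dotProduct_star_etaC hA hs hL, h.cubic,
      inv_mul_cancel_left₀ (mul_ne_zero ha hc)]
    simp [Matrix.mul_apply, Matrix.mulVec, dotProduct, Fin.sum_univ_three, frame, LocalData.connZ]
  have c2 : ∀ i, dzM (frame s) z i 2 = (frame s z * L.connZ (rhoOf s) z) i 2 := by
    intro i
    have : dzM (frame s) z i 2 = (star (dzbarV (xiC s) z)) i := dz_star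
    have e1 : star (dzbarV (xiC s) z) ⬝ᵥ duC s z = -(L.a z * star (cOf L.θ z)) := by
      rw [star_dotProduct_eq, star_duC, dzbarV_xiC_dotProduct_duC hs, h.pair', star_neg, star_mul',
        L.star_a]
    have e2 : star (dzbarV (xiC s) z) ⬝ᵥ etaC s z =
        L.a z * L.φ z + rhoOf s z * (L.a z * star (cOf L.θ z)) := by
      rw [star_dotProduct_eq, h.dzbarV_xiC_dotProduct_star_etaC hs]
      simp only [star_add, star_mul', star_star, L.star_a]
    have e3 : star (dzbarV (xiC s) z) ⬝ᵥ star (etaC s z) = L.a z * star (L.φ z) := by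
      rw [star_dotProduct_star', h.mean', star_mul', L.star_a]
    rw [this, h.expand hd hL.sign (star (dzbarV (xiC s) z)), e1, e2, e3]
    have e4 : (L.a z * cOf L.θ z)⁻¹ * (L.a z * star (L.φ z)) = (cOf L.θ z)⁻¹ * star (L.φ z) := by
      field_simp
    have e5 : (L.a z * star (cOf L.θ z))⁻¹ *
        (L.a z * L.φ z + rhoOf s z * (L.a z * star (cOf L.θ z))) =
        (star (cOf L.θ z))⁻¹ * L.φ z + rhoOf s z := by
      field_simp
    rw [e4, e5]
    simp [Matrix.mul_apply, Matrix.mulVec, dotProduct, Fin.sum_univ_three, frame, LocalData.connZ]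
  ext i j
  fin_cases j
  · exact c0 i
  · exact c1 i
  · exact c2 i

/-- The structure equation `∂_z̄ F = F V`. -/
theorem AdaptedAt.dzbarM_frame (hA : ∀ᶠ w in 𝓝 z, AdaptedAt L s w)
    (hs : SmoothAt s z) (hL : L.RegularAt z) :
    dzbarM (frame s) z = frame s z * L.connZbar (rhoOf s) z := by
  have e := congrArg conjSwapCol (AdaptedAt.dzM_frame hA hs hL)
  rw [conjSwapCol_mul, conjSwapCol_frame, ← dzbarM_conjSwapCol] at e
  have : (fun w => conjSwapCol (frame s w)) = frame s := funext fun w => conjSwapCol_frame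
  rw [this] at e
  exact e

/-- The integrability condition holds for the invariants of a lift. -/
theorem AdaptedAt.flatAt (hA : ∀ᶠ w in 𝓝 z, AdaptedAt L s w)
    (hs : ∀ᶠ w in 𝓝 z, SmoothAt s w) (hL : ∀ᶠ w in 𝓝 z, L.RegularAt w) :
    L.FlatAt (rhoOf s) z := by
  have hs0 := hs.self_of_nhds
  have hL0 := hL.self_of_nhds
  have hF := hs0.smoothM_frame
  have e1 : dzM (frame s) =ᶠ[𝓝 z] fun w => frame s w * L.connZ (rhoOf s) w := by
    filter_upwards [hA.eventually_nhds, hs, hL] with w h1 h2 h3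
    exact AdaptedAt.dzM_frame h1 h2 h3
  have e2 : dzbarM (frame s) =ᶠ[𝓝 z] fun w => frame s w * L.connZbar (rhoOf s) w := by
    filter_upwards [hA.eventually_nhds, hs, hL] with w h1 h2 h3
    exact AdaptedAt.dzbarM_frame h1 h2 h3
  -- Equality of the mixed derivatives of the frame is F times the integrability condition; the
  -- coframe then cancels F.
  have e3 := dzM_dzbarM_comm hF
  rw [dzM_congr e2, dzbarM_congr e1,
    dzM_mul hF.diffM (hL0.smoothM_connZbar hs0.rhoOf).diffM,
    dzbarM_mul hF.diffM (hL0.smoothM_connZ hs0.rhoOf).diffM,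
    AdaptedAt.dzM_frame hA hs0 hL0, AdaptedAt.dzbarM_frame hA hs0 hL0, mul_assoc, mul_assoc,
    ← mul_add, ← mul_add] at e3
  have e4 := congrArg (fun B => coframe L s z * B) e3
  simp only [← mul_assoc, hA.self_of_nhds.coframe_mul_frame hs0.diffAt hL0.sign, one_mul] at e4
  exact e4.symm

end StructureEquations

/-! ### Curvature entries and the compatibility equations. -/

noncomputable section Flatness

open Complex

namespace LocalData

variable {L : LocalData} {z : ℂ} {ρ : ℂ → ℂ}

theorem connZbar_eq : L.connZbar ρ z =
    !![star (ρ z), -(L.a z * cOf L.θ z), 0;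
       0, (cOf L.θ z)⁻¹ * star (L.φ z) + star (ρ z), (L.a z * cOf L.θ z)⁻¹ * star (L.Q z);
       1, (star (cOf L.θ z))⁻¹ * L.φ z,
        star (dz L.ell z) + (star (cOf L.θ z))⁻¹ * star (L.φ z) + star (ρ z)] := by
  have ha : (starRingEnd ℂ) (L.a z) = L.a z := star_a z
  ext i j
  fin_cases i <;> fin_cases j <;> simp [connZbar, conjSwap_apply, connZ, ha]

/-- The curvature of the connection. -/
def curv (L : LocalData) (ρ : ℂ → ℂ) (z : ℂ) : Mat3 :=
  L.connZbar ρ z * L.connZ ρ z + dzbarM (L.connZ ρ) z -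
    (L.connZ ρ z * L.connZbar ρ z + dzM (L.connZbar ρ) z)

theorem flatAt_iff_curv : L.FlatAt ρ z ↔ L.curv ρ z = 0 := by
  rw [FlatAt, curv, sub_eq_zero]

theorem dzM_connZbar : dzM (L.connZbar ρ) z = conjSwap (dzbarM (L.connZ ρ) z) :=
  dzM_conjSwap _

theorem conjSwap_connZbar : conjSwap (L.connZbar ρ z) = L.connZ ρ z := conjSwap_conjSwap _

/-- The two connection matrices are conjugate under the swap, which exchanges the two halves of the
curvature. Entries hence come in conjugate pairs, and five of them decide its vanishing. -/
theorem curv_symm : conjSwap (L.curv ρ z) = -L.curv ρ z := by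
  have hsub : ∀ A B : Mat3, conjSwap (A - B) = conjSwap A - conjSwap B := fun A B => by
    ext i j; simp [conjSwap_apply]
  rw [curv, hsub, conjSwap_add, conjSwap_add, conjSwap_mul, conjSwap_mul, dzM_connZbar,
    conjSwap_conjSwap, conjSwap_connZbar, neg_sub]
  rfl

theorem curv_eq_zero_iff : L.curv ρ z = 0 ↔ L.curv ρ z 0 0 = 0 ∧ L.curv ρ z 0 1 = 0 ∧
    L.curv ρ z 1 0 = 0 ∧ L.curv ρ z 1 1 = 0 ∧ L.curv ρ z 2 1 = 0 := by
  constructor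
  · intro h; rw [h]; simp
  · rintro ⟨h00, h01, h10, h11, h21⟩
    have key : ∀ i j, L.curv ρ z i j = -star (L.curv ρ z (![0, 2, 1] i) (![0, 2, 1] j)) := by
      intro i j
      have := congrFun (congrFun (curv_symm (L := L) (ρ := ρ) (z := z)) i) j
      rw [conjSwap_apply, Matrix.neg_apply] at this
      rw [this, neg_neg]
    have h02 := key 0 2
    have h20 := key 2 0
    have h22 := key 2 2
    have h12 := key 1 2
    simp [h01] at h02
    simp [h10] at h20
    simp [h11] at h22
    simp [h21] at h12
    ext i j
    fin_cases i <;> fin_cases j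
    exacts [h00, h01, h02, h10, h11, h12, h20, h21, h22]

theorem dzbar_star_c : dzbar (fun w => star (cOf L.θ w)) z = star (dz (cOf L.θ) z) := dzbar_star

theorem RegularAt.dzbar_inv_mul (hL : L.RegularAt z) {f : ℂ → ℂ} (hf : DifferentiableAt ℝ f z) :
    dzbar (fun w => (cOf L.θ w)⁻¹ * f w) z =
      -(cOf L.θ z ^ 2)⁻¹ * dzbar (cOf L.θ) z * f z + (cOf L.θ z)⁻¹ * dzbar f z := by
  have hc := hL.contDiffAt_c.differentiableAt (by simp)
  rw [dzbar_mul (hc.fun_inv (cOf_ne_zero _ _)) hf, dzbar_inv hc (cOf_ne_zero _ _)]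

theorem RegularAt.dzbar_conn21 (hL : L.RegularAt z) : dzbar (fun w => (L.a w * star (cOf L.θ w))⁻¹ * L.Q w) z =
    (L.a z * star (cOf L.θ z))⁻¹ * (dzbar L.Q z - (star (dz (fun w => (L.u w : ℂ)) z) +
      (star (cOf L.θ z))⁻¹ * star (dz (cOf L.θ) z)) * L.Q z) := by
  have hc := hL.contDiffAt_c.star_comp.differentiableAt (by simp)
  have ha := hL.contDiffAt_a.differentiableAt (by simp)
  have hac := ha.fun_mul hc
  have h0 := mul_ne_zero hL.a_ne_zero (star_cOf_ne_zero L.θ z)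
  have ha0 := hL.a_ne_zero
  have hc0 := star_cOf_ne_zero L.θ z
  rw [dzbar_mul (hac.fun_inv h0) (hL.Q.differentiableAt (by simp)), dzbar_inv hac h0,
    dzbar_mul ha hc, hL.dzbar_a, dzbar_star_c, dzbar_ofReal]
  field_simp
  ring

theorem curv_00 : L.curv ρ z 0 0 =
    dzbar ρ z - star (dzbar ρ z) - L.a z * (cOf L.θ z - star (cOf L.θ z)) := by
  have e : (dzbarM (L.connZ ρ) z) 0 0 = dzbar ρ z := rfl
  have e' : (dzM (L.connZbar ρ) z) 0 0 = star (dzbar ρ z) := by rw [dzM_connZbar]; rfl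
  simp only [curv, Matrix.sub_apply, Matrix.add_apply, e, e', Matrix.mul_apply,
    Fin.sum_univ_three, connZbar_eq, connZ]
  simp
  ring

theorem curv_10 : L.curv ρ z 1 0 = 0 := by
  have e : (dzbarM (L.connZ ρ) z) 1 0 = 0 := dzbar_const 1
  have e' : (dzM (L.connZbar ρ) z) 1 0 = 0 := by
    rw [dzM_connZbar]
    change star (dzbar (fun _ => (0 : ℂ)) z) = 0
    simp
  simp only [curv, Matrix.sub_apply, Matrix.add_apply, e, e', Matrix.mul_apply,
    Fin.sum_univ_three, connZbar_eq, connZ]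
  simp
  ring

/-- The φ and ρ terms cancel, and what remains is ∂_z(ac) = ac ∂_z(log c + u). -/
theorem RegularAt.curv_01 (hL : L.RegularAt z) : L.curv ρ z 0 1 = 0 := by
  have e : (dzbarM (L.connZ ρ) z) 0 1 = 0 := dzbar_const 0
  have e' : (dzM (L.connZbar ρ) z) 0 1 =
      -(L.a z * dz (fun w => (L.u w : ℂ)) z * cOf L.θ z + L.a z * dz (cOf L.θ) z) := by
    have hc := hL.contDiffAt_c.star_comp.differentiableAt (by simp)
    have ha := hL.contDiffAt_a.differentiableAt (by simp)
    rw [dzM_connZbar]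
    change star (dzbar (fun w => -(L.a w * star (cOf L.θ w))) z) = _
    rw [dzbar_neg, dzbar_mul ha hc, hL.dzbar_a, dzbar_star_c, dzbar_ofReal]
    simp only [star_neg, star_add, star_mul', star_star, star_a]
  have hc0 := cOf_ne_zero L.θ z
  have hc0' := star_cOf_ne_zero L.θ z
  simp only [curv, Matrix.sub_apply, Matrix.add_apply, e, e', Matrix.mul_apply,
    Fin.sum_univ_three, connZbar_eq, connZ, hL.dz_ell]
  simp only [Matrix.of_apply, Matrix.cons_val', Matrix.cons_val, Matrix.cons_val_zero,
    Matrix.cons_val_one]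
  field_simp
  ring

theorem norm_sq_eq (w : ℂ) : ((‖w‖ ^ 2 : ℝ) : ℂ) = w * star w := by
  rw [Complex.star_def, Complex.mul_conj, Complex.normSq_eq_norm_sq]

/-- The entry is minus the left side of (b) plus the entry belonging to (a), so it gives (b) only
after (a). The sign H drops out of the |Q|² term because a⁻² = e^{-2u}. -/
theorem RegularAt.curv_11 (hL : L.RegularAt z) (hρ : ContDiffAt ℝ ∞ ρ z) : L.curv ρ z 1 1 =
    -(((‖cOf L.θ z‖ ^ 2)⁻¹ * ‖L.φ z‖ ^ 2
      - (‖cOf L.θ z‖ ^ 2)⁻¹ * Real.exp (-2 * L.u z) * ‖L.Q z‖ ^ 2 : ℝ)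
    + L.H * (star (cOf L.θ z) - 2 * cOf L.θ z) * (Real.exp (L.u z) : ℝ)
    + dz (fun w => (cOf L.θ w)⁻¹ * star (L.φ w)) z
    - dzbar (fun w => (cOf L.θ w)⁻¹ * L.φ w) z
    - dz (dzbar (fun w => Complex.log (cOf L.θ w) + (L.u w : ℂ))) z) + L.curv ρ z 0 0 := by
  have hc := hL.contDiffAt_c
  have hci := hc.inv (cOf_ne_zero _ _)
  have hci' := hc.star_comp.inv (star_cOf_ne_zero _ _)
  have hρd := hρ.differentiableAt (by simp)
  have h1 : DifferentiableAt ℝ (fun w => dz L.ell w) z :=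
    hL.contDiffAt_ell.dz.differentiableAt (by simp)
  have h2 : DifferentiableAt ℝ (fun w => (cOf L.θ w)⁻¹ * L.φ w) z :=
    (hci.mul hL.φ).differentiableAt (by simp)
  have h3 : DifferentiableAt ℝ (fun w => (star (cOf L.θ w))⁻¹ * L.φ w) z :=
    (hci'.mul hL.φ).differentiableAt (by simp)
  have e : (dzbarM (L.connZ ρ) z) 1 1 = dz (dzbar L.ell) z +
      dzbar (fun w => (cOf L.θ w)⁻¹ * L.φ w) z + dzbar ρ z := by
    change dzbar (fun w => dz L.ell w + (cOf L.θ w)⁻¹ * L.φ w + ρ w) z = _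
    rw [dzbar_add (h1.fun_add h2) hρd, dzbar_add h1 h2, ← dz_dzbar_comm hL.contDiffAt_ell]
  have e' : (dzM (L.connZbar ρ) z) 1 1 =
      dz (fun w => (cOf L.θ w)⁻¹ * star (L.φ w)) z + star (dzbar ρ z) := by
    rw [dzM_connZbar]
    change star (dzbar (fun w => (star (cOf L.θ w))⁻¹ * L.φ w + ρ w) z) = _
    rw [dzbar_add h3 hρd, star_add, ← dz_star]
    simp only [star_mul', star_inv₀, star_star]
  have hc0 := cOf_ne_zero L.θ z
  have hc0' := star_cOf_ne_zero L.θ z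
  have hE := exp_ofReal_ne_zero (L.u z)
  have hH := ofReal_sign_mul_self hL.sign
  have hell : dz (dzbar (fun w => Complex.log (cOf L.θ w) + (L.u w : ℂ))) z =
    dz (dzbar L.ell) z := rfl
  have hexp : ((Real.exp (-2 * L.u z) : ℝ) : ℂ) = ((Real.exp (L.u z) : ℝ) : ℂ)⁻¹ ^ 2 := by
    rw [← ofReal_inv, ← Real.exp_neg, ← ofReal_pow, ← Real.exp_nat_mul]
    congr 2
    push_cast
    ring
  have hcast : (((‖cOf L.θ z‖ ^ 2)⁻¹ * ‖L.φ z‖ ^ 2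
      - (‖cOf L.θ z‖ ^ 2)⁻¹ * Real.exp (-2 * L.u z) * ‖L.Q z‖ ^ 2 : ℝ) : ℂ) =
      (cOf L.θ z * star (cOf L.θ z))⁻¹ * (L.φ z * star (L.φ z)) -
      (cOf L.θ z * star (cOf L.θ z))⁻¹ * ((Real.exp (L.u z) : ℝ) : ℂ)⁻¹ ^ 2 *
        (L.Q z * star (L.Q z)) := by
    rw [← norm_sq_eq, ← norm_sq_eq, ← norm_sq_eq, ← hexp]
    push_cast
    ring
  have ha2 : (L.a z)⁻¹ ^ 2 = ((Real.exp (L.u z) : ℝ) : ℂ)⁻¹ ^ 2 := by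
    rw [a, mul_inv, mul_pow, show ((L.H : ℂ)⁻¹) ^ 2 = 1 by rw [inv_pow, pow_two, hH, inv_one],
      one_mul]
  have ha0 := hL.a_ne_zero
  rw [hcast, hell, curv_00, ← ha2]
  simp only [curv, Matrix.sub_apply, Matrix.add_apply, e, e', Matrix.mul_apply,
    Fin.sum_univ_three, connZbar_eq, connZ]
  simp only [Matrix.of_apply, Matrix.cons_val', Matrix.cons_val, Matrix.cons_val_zero,
    Matrix.cons_val_one]
  have hE' : (L.H : ℂ) * (star (cOf L.θ z) - 2 * cOf L.θ z) * (Real.exp (L.u z) : ℝ) =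
      L.a z * (star (cOf L.θ z) - 2 * cOf L.θ z) := by rw [a]; ring
  rw [hE']
  field_simp
  ring

/-- log |c|² is the sum of log c and its conjugate. -/
theorem dzbar_log_norm_sq (hc : DifferentiableAt ℝ (cOf L.θ) z) :
    dzbar (fun w => (Real.log (‖cOf L.θ w‖ ^ 2) : ℂ)) z =
      (cOf L.θ z)⁻¹ * dzbar (cOf L.θ) z + (star (cOf L.θ z))⁻¹ * star (dz (cOf L.θ) z) := by
  have e : (fun w => (Real.log (‖cOf L.θ w‖ ^ 2) : ℂ)) = fun w =>
      log (cOf L.θ w) + star (log (cOf L.θ w)) := by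
    ext1 w
    rw [Complex.star_def, Complex.add_conj, Complex.log_re, Real.log_pow]
    push_cast
    ring
  have hl : DifferentiableAt ℝ (fun w => log (cOf L.θ w)) z :=
    ((hasDerivAt_log (cOf_mem_slitPlane L.θ z)).complexToReal_fderiv.comp z
      hc.hasFDerivAt).differentiableAt
  rw [e, dzbar_add hl hl.star_comp, dzbar_star, dz_log hc (cOf_mem_slitPlane _ _),
    dzbar_log hc (cOf_mem_slitPlane _ _), star_mul', star_inv₀]

/-- The curvature entry contains ∂_z̄ Q, whereas (c) contains ∂_z of the conjugate of Q; this is why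
the entry is conjugated. The factor e^u c never vanishes. -/
theorem RegularAt.curv_21 (hL : L.RegularAt z) :
    ((cOf L.θ z)⁻¹ - (star (cOf L.θ z))⁻¹)
      * ((Real.exp (L.u z) : ℝ) * star (L.φ z) ^ 2 - L.H * star (L.Q z) * L.φ z)
    - (Real.exp (L.u z) : ℝ) * star (L.φ z) * dzbar (fun w => (Real.log (‖cOf L.θ w‖ ^ 2) : ℂ)) z
    + (Real.exp (L.u z) : ℝ)
      * (dzbar (fun w => star (L.φ w)) z - star (L.φ z) * dzbar (fun w => (L.u w : ℂ)) z)
    - L.H * dz (fun w => star (L.Q w)) z =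
    -((Real.exp (L.u z) : ℝ) * cOf L.θ z * star (L.curv ρ z 2 1)) := by
  have hc := hL.contDiffAt_c.differentiableAt (by simp)
  have e : (dzbarM (L.connZ ρ) z) 2 1 = _ := hL.dzbar_conn21
  have e' : (dzM (L.connZbar ρ) z) 2 1 =
      star (-(cOf L.θ z ^ 2)⁻¹ * dzbar (cOf L.θ) z * star (L.φ z) +
        (cOf L.θ z)⁻¹ * star (dz L.φ z)) := by
    rw [dzM_connZbar]
    change star (dzbar (fun w => (cOf L.θ w)⁻¹ * star (L.φ w)) z) = _
    rw [hL.dzbar_inv_mul (hL.φ.star_comp.differentiableAt (by simp)), dzbar_star]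
  have hc0 := cOf_ne_zero L.θ z
  have hc0' := star_cOf_ne_zero L.θ z
  have hE := exp_ofReal_ne_zero (L.u z)
  have hH := ofReal_sign_mul_self hL.sign
  have hH0 : (L.H : ℂ) ≠ 0 := left_ne_zero_of_mul_eq_one hH
  have hHi : (L.H : ℂ)⁻¹ = L.H := inv_eq_of_mul_eq_one_right hH
  have hai : (L.a z)⁻¹ = L.H * ((Real.exp (L.u z) : ℝ) : ℂ)⁻¹ := by rw [a, mul_inv, hHi]
  have hsE : star ((Real.exp (L.u z) : ℝ) : ℂ) = ((Real.exp (L.u z) : ℝ) : ℂ) := conj_ofReal _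
  have hsH : star ((L.H : ℝ) : ℂ) = (L.H : ℂ) := conj_ofReal _
  simp only [curv, Matrix.sub_apply, Matrix.add_apply, e, e', Matrix.mul_apply,
    Fin.sum_univ_three, connZbar_eq, connZ, hL.dz_ell]
  simp only [Matrix.of_apply, Matrix.cons_val', Matrix.cons_val, Matrix.cons_val_zero,
    Matrix.cons_val_one]
  rw [dzbar_log_norm_sq hc, dzbar_star, dz_star, dzbar_ofReal]
  simp only [mul_inv, hai, star_add, star_sub, star_mul', star_neg, star_inv₀, star_star, hsE, hsH,
    star_one, star_zero, star_pow]
  field_simp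
  ring

/-- The compatibility equations are the flatness of the connection. -/
theorem RegularAt.flatAt_iff (hL : L.RegularAt z) (hρ : ContDiffAt ℝ ∞ ρ z) :
    L.FlatAt ρ z ↔ CompRho L.H L.u L.θ ρ z ∧ Comp1 L.H L.u L.θ L.φ L.Q z ∧
      Comp2 L.H L.u L.θ L.φ L.Q z := by
  have h0 : L.curv ρ z 0 0 = 0 ↔ CompRho L.H L.u L.θ ρ z := by
    rw [curv_00, CompRho, Complex.star_def, sub_conj, sub_conj, a]
    constructor
    · intro h
      have := congrArg im h
      simp at this
      rw [Complex.exp_ofReal_re] at this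
      linarith
    · intro h
      rw [h]
      push_cast
      ring
  rw [flatAt_iff_curv, curv_eq_zero_iff, hL.curv_01, curv_10, ← h0]
  have h2 : L.curv ρ z 2 1 = 0 ↔ Comp2 L.H L.u L.θ L.φ L.Q z := by
    rw [Comp2, hL.curv_21, neg_eq_zero, mul_eq_zero, star_eq_zero, or_iff_right]
    exact mul_ne_zero (exp_ofReal_ne_zero _) (cOf_ne_zero _ _)
  rw [h2, hL.curv_11 hρ]
  constructor
  · rintro ⟨h00, -, -, h11, h21⟩
    rw [h00, add_zero, neg_eq_zero] at h11
    exact ⟨h00, h11, h21⟩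
  · rintro ⟨h00, h11, h21⟩
    refine ⟨h00, rfl, rfl, ?_, h21⟩
    rw [h00, add_zero, neg_eq_zero]
    exact h11

end LocalData

end Flatness

/-! ### Solving ∂_z F = F U, ∂_z̄ F = F V for matrices. -/

noncomputable section MatrixODE

open Complex

variable {z : ℂ}

/-- The one-form `U dz + V dz̄` with values in a complex algebra, depending on `(U, V)`. -/
def oneForm (R : Type*) [NormedRing R] [NormedAlgebra ℂ R] : R × R →L[ℝ] (ℂ →L[ℝ] R) :=
  (ContinuousLinearMap.lsmul ℝ ℂ : ℂ →L[ℝ] R →L[ℝ] R).flip.comp (ContinuousLinearMap.fst ℝ R R) +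
    ((ContinuousLinearMap.lsmul ℝ ℂ : ℂ →L[ℝ] R →L[ℝ] R).comp (conjCLE : ℂ →L[ℝ] ℂ)).flip.comp
      (ContinuousLinearMap.snd ℝ R R)

theorem oneForm_apply {R : Type*} [NormedRing R] [NormedAlgebra ℂ R] (p : R × R) (v : ℂ) :
    oneForm R p v = v • p.1 + star v • p.2 := rfl

/-- Local solvability of `∂_z F = F U`, `∂_z̄ F = F V` in a complex Banach algebra. -/
theorem exists_flat_section_complex {R : Type*} [NormedRing R] [NormedAlgebra ℂ R]
    [CompleteSpace R] {U V : ℂ → R}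
    (hU : ∀ᶠ w in 𝓝 z, ContDiffAt ℝ ∞ U w) (hV : ∀ᶠ w in 𝓝 z, ContDiffAt ℝ ∞ V w)
    (flat : ∀ᶠ w in 𝓝 z, ∃ U₁ U₂ V₁ V₂ : R, (∀ v, fderiv ℝ U w v = v • U₁ + star v • U₂) ∧
      (∀ v, fderiv ℝ V w v = v • V₁ + star v • V₂) ∧ V w * U w + U₂ = U w * V w + V₁) :
    ∃ F : ℂ → R, F z = 1 ∧ ∀ᶠ w in 𝓝 z, ContDiffAt ℝ ∞ F w ∧
      ∀ v, fderiv ℝ F w v = F w * (v • U w + star v • V w) := by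
  let Ω : ℂ → ℂ →L[ℝ] R := fun w => oneForm R (U w, V w)
  have hΩ : ∀ᶠ w in 𝓝 z, ContDiffAt ℝ ∞ Ω w := by
    filter_upwards [hU, hV] with w hu hv
    exact (oneForm R).contDiff.contDiffAt.comp w (hu.prodMk hv)
  have hfl : ∀ᶠ w in 𝓝 z, ∀ v v', Ω w v * Ω w v' + fderiv ℝ Ω w v v' =
      Ω w v' * Ω w v + fderiv ℝ Ω w v' v := by
    filter_upwards [hU, hV, flat] with w hu hv hf v v'
    obtain ⟨U₁, U₂, V₁, V₂, h1, h2, h3⟩ := hf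
    have hd : ∀ v v', fderiv ℝ Ω w v v' = v' • fderiv ℝ U w v + star v' • fderiv ℝ V w v := by
      intro v v'
      have : HasFDerivAt Ω ((oneForm R).comp ((fderiv ℝ U w).prod (fderiv ℝ V w))) w :=
        (oneForm R).hasFDerivAt.comp w ((hu.differentiableAt (by simp)).hasFDerivAt.prodMk
          (hv.differentiableAt (by simp)).hasFDerivAt)
      rw [this.fderiv]
      exact oneForm_apply _ _
    rw [hd, hd, h1, h1, h2, h2]
    simp only [Ω, oneForm_apply]
    -- The terms in v v' and in conj v conj v' are symmetric, so only ∂_z̄ U and ∂_z V enter the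
    -- flatness condition.
    have h3' : V₁ = V w * U w + U₂ - U w * V w := by rw [h3]; abel
    rw [h3']
    simp only [mul_add, add_mul, smul_add, smul_sub, smul_mul_assoc, mul_smul_comm]
    module
  obtain ⟨F, hF1, hF⟩ := exists_flat_section Ω z (hΩ.self_of_nhds.of_le (by
    simpa using (WithTop.coe_le_coe.2 le_top : ((2 : ℕ∞) : WithTop ℕ∞) ≤ ∞))) hfl
  refine ⟨F, hF1, ?_⟩
  filter_upwards [hΩ, hF.eventually_nhds] with w hw hFw
  refine ⟨contDiffAt_of_flat_section hw hFw, fun v => ?_⟩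
  rw [hFw.self_of_nhds.fderiv]
  rfl

attribute [local instance] Matrix.linftyOpNormedRing Matrix.linftyOpNormedAlgebra

/-- A matrix entry as a continuous linear functional. -/
def entryL (i j : Fin 3) : Mat3 →L[ℝ] ℂ :=
  LinearMap.toContinuousLinearMap (Matrix.entryLinearMap ℝ ℂ i j)

/-- Entrywise smoothness refers to no norm; the operator norm is only a local choice that makes the
matrices a Banach algebra, and this translates between the two. -/
theorem smoothM_iff {F : ℂ → Mat3} : SmoothM F z ↔ ContDiffAt ℝ ∞ F z := by
  constructor
  · intro h
    have e : F = fun w => ∑ i, ∑ j, F w i j • Matrix.single i j (1 : ℂ) := by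
      ext1 w
      conv_lhs => rw [Matrix.matrix_eq_sum_single (F w)]
      simp [Matrix.smul_single]
    rw [e]
    exact ContDiffAt.sum fun i _ => ContDiffAt.sum fun j _ => (h i j).smul contDiffAt_const
  · exact fun h i j => (entryL i j).contDiff.contDiffAt.comp z h

theorem fderiv_entry {F : ℂ → Mat3} (h : DifferentiableAt ℝ F z) (i j : Fin 3) (v : ℂ) :
    fderiv ℝ (fun w => F w i j) z v = fderiv ℝ F z v i j := by
  have h1 : HasFDerivAt (fun w => F w i j) _ z := (entryL i j).hasFDerivAt.comp z h.hasFDerivAt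
  rw [h1.fderiv]
  rfl

theorem SmoothM.fderiv_eq {F : ℂ → Mat3} (h : SmoothM F z) (v : ℂ) :
    fderiv ℝ F z v = v • dzM F z + star v • dzbarM F z := by
  have hd : DifferentiableAt ℝ F z := (smoothM_iff.1 h).differentiableAt (by simp)
  ext i j
  rw [← fderiv_entry hd i j v, fderiv_eq_dz_dzbar]
  simp [dzM, dzbarM]
  ring

/-- Local solvability of `∂_z F = F U`, `∂_z̄ F = F V`. -/
theorem exists_matrix_solution {U V : ℂ → Mat3} (hU : ∀ᶠ w in 𝓝 z, SmoothM U w)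
    (hV : ∀ᶠ w in 𝓝 z, SmoothM V w)
    (flat : ∀ᶠ w in 𝓝 z, V w * U w + dzbarM U w = U w * V w + dzM V w) (F₀ : Mat3) :
    ∃ F : ℂ → Mat3, F z = F₀ ∧ ∀ᶠ w in 𝓝 z, SmoothM F w ∧ dzM F w = F w * U w ∧
      dzbarM F w = F w * V w := by
  obtain ⟨F, hF1, hF⟩ := exists_flat_section_complex (hU.mono fun w h => smoothM_iff.1 h)
    (hV.mono fun w h => smoothM_iff.1 h) (by
      filter_upwards [hU, hV, flat] with w hu hv hf
      exact ⟨_, _, _, _, hu.fderiv_eq, hv.fderiv_eq, hf⟩)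
  -- The coefficients multiply F on the right, so a constant left factor preserves the system and
  -- arranges the initial value.
  refine ⟨fun w => F₀ * F w, by simp [hF1], ?_⟩
  filter_upwards [hF] with w hw
  have hd : DifferentiableAt ℝ F w := hw.1.differentiableAt (by simp)
  have hs : SmoothM (fun w => F₀ * F w) w := smoothM_iff.2 (contDiffAt_const.mul hw.1)
  have hGv : ∀ i j v, fderiv ℝ (fun w => (F₀ * F w) i j) w v =
      v * (F₀ * F w * U w) i j + star v * (F₀ * F w * V w) i j := by
    intro i j v
    have h1 : HasFDerivAt (fun w => F₀ * F w) _ w := hd.hasFDerivAt.const_mul F₀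
    rw [fderiv_entry h1.differentiableAt, h1.fderiv]
    have h2 : F₀ * fderiv ℝ F w v = v • (F₀ * F w * U w) + star v • (F₀ * F w * V w) := by
      refine (congrArg (fun B => F₀ * B) (hw.2 v)).trans ?_
      simp only [mul_add, Matrix.mul_smul, mul_assoc]
    exact congrFun (congrFun h2 i) j
  refine ⟨hs, ?_, ?_⟩
  · ext i j
    simp only [dzM, dz, Matrix.of_apply, hGv]
    simp
    linear_combination ((F₀ * F w * V w) i j / 2 - (F₀ * F w * U w) i j / 2) * I_mul_I
  · ext i j
    simp only [dzbarM, dzbar, Matrix.of_apply, hGv]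
    simp
    linear_combination ((F₀ * F w * U w) i j / 2 - (F₀ * F w * V w) i j / 2) * I_mul_I

theorem SmoothM.inv {F : ℂ → Mat3} (h : SmoothM F z) (hu : IsUnit (F z)) :
    SmoothM (fun w => (F w)⁻¹) z := by
  obtain ⟨u, hu⟩ := hu
  rw [smoothM_iff] at h ⊢
  have h1 : ContDiffAt ℝ ∞ (Ring.inverse : Mat3 → Mat3) (F z) := hu ▸ contDiffAt_ringInverse ℝ u
  have h2 : (fun w => (F w)⁻¹) = Ring.inverse ∘ F := by
    ext1 w
    exact Matrix.nonsing_inv_eq_ringInverse (A := F w)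
  rw [h2]
  exact h1.comp z h

theorem SmoothM.eventually_isUnit {F : ℂ → Mat3} (h : SmoothM F z) (hu : IsUnit (F z)) :
    ∀ᶠ w in 𝓝 z, IsUnit (F w) :=
  (smoothM_iff.1 h).continuousAt.eventually (Units.isOpen.mem_nhds hu)

end MatrixODE

/-! ### Local existence and uniqueness of lifts. -/

noncomputable section LocalTheory

open Complex

variable {z : ℂ}

/-- Two solutions of `∂_z F = F U`, `∂_z̄ F = F V` differ by a constant factor. -/
theorem matrix_solution_unique {U V F E G : ℂ → Mat3} (hEF : ∀ᶠ w in 𝓝 z, E w * F w = 1)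
    (hE : ∀ᶠ w in 𝓝 z, SmoothM E w)
    (hF : ∀ᶠ w in 𝓝 z, SmoothM F w ∧ dzM F w = F w * U w ∧ dzbarM F w = F w * V w)
    (hG : ∀ᶠ w in 𝓝 z, SmoothM G w ∧ dzM G w = G w * U w ∧ dzbarM G w = G w * V w) :
    ∀ᶠ w in 𝓝 z, G w = G z * E z * F w := by
  -- With E the inverse of F, differentiating E F = 1 gives ∂_z E = -U E and ∂_z̄ E = -V E; hence
  -- both derivatives of G E vanish and G E is locally constant.
  have hd : ∀ᶠ w in 𝓝 z, dzM (fun w => G w * E w) w = 0 ∧ dzbarM (fun w => G w * E w) w = 0 := by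
    filter_upwards [hEF.eventually_nhds, hE, hF, hG] with w h1 h2 h3 h4
    have hFE : F w * E w = 1 := mul_eq_one_comm.1 h1.self_of_nhds
    have e1 : dzM (fun w => E w * F w) w = 0 := by
      rw [dzM_congr h1]; ext i j; exact dz_const _
    have e2 : dzbarM (fun w => E w * F w) w = 0 := by
      rw [dzbarM_congr h1]; ext i j; exact dzbar_const _
    rw [dzM_mul h2.diffM h3.1.diffM, h3.2.1, ← mul_assoc, h1.self_of_nhds, one_mul] at e1
    rw [dzbarM_mul h2.diffM h3.1.diffM, h3.2.2, ← mul_assoc, h1.self_of_nhds, one_mul] at e2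
    have e3 : dzM E w = -(U w * E w) := by
      have := congrArg (fun B => B * E w) e1
      simp only [add_mul, mul_assoc, hFE, mul_one, zero_mul] at this
      exact eq_neg_of_add_eq_zero_left this
    have e4 : dzbarM E w = -(V w * E w) := by
      have := congrArg (fun B => B * E w) e2
      simp only [add_mul, mul_assoc, hFE, mul_one, zero_mul] at this
      exact eq_neg_of_add_eq_zero_left this
    rw [dzM_mul h4.1.diffM h2.diffM, dzbarM_mul h4.1.diffM h2.diffM, e3, e4, h4.2.1, h4.2.2]
    constructor <;> rw [mul_neg, mul_assoc, add_neg_cancel]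
  have hc : ∀ i j, ∀ᶠ w in 𝓝 z, (G w * E w) i j = (G z * E z) i j := by
    intro i j
    refine eventually_eq_of_dz_eq_zero (f := fun w => (G w * E w) i j) ?_ ?_ ?_
    · filter_upwards [hE, hG] with w h2 h4
      exact (h4.1.diffM.mul h2.diffM) i j
    · exact hd.mono fun w hw => congrFun (congrFun hw.1 i) j
    · exact hd.mono fun w hw => congrFun (congrFun hw.2 i) j
  have hc' : ∀ᶠ w in 𝓝 z, ∀ i j, (G w * E w) i j = (G z * E z) i j :=
    Filter.eventually_all.2 fun i => Filter.eventually_all.2 fun j => hc i j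
  filter_upwards [hc', hEF] with w hw h1
  have : G w * E w = G z * E z := by ext i j; exact hw i j
  rw [← this, mul_assoc, h1, mul_one]

/-- Complex conjugation of a matrix, followed by exchanging the last two rows. -/
def conjSwapRow (A : Mat3) : Mat3 := (A.map star).submatrix ![0, 2, 1] id

theorem conjSwapRow_apply (A : Mat3) (i j : Fin 3) :
    conjSwapRow A i j = star (A (![0, 2, 1] i) j) := rfl

theorem conjSwapRow_mul_conjSwapCol (A B : Mat3) :
    conjSwapRow A * conjSwapCol B = conjSwap (A * B) := by
  ext i j
  simp [conjSwapCol_apply, conjSwap_apply, conjSwapRow_apply, Matrix.mul_apply, Fin.sum_univ_three]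

theorem conjSwapCol_mul_conjSwapRow (A B : Mat3) :
    conjSwapCol A * conjSwapRow B = (A * B).map star := by
  ext i j
  simp [conjSwapCol_apply, conjSwapRow_apply, Matrix.mul_apply, Fin.sum_univ_three]
  ring

theorem conjSwap_one : conjSwap 1 = 1 := by
  ext i j
  rw [conjSwap_apply]
  fin_cases i <;> fin_cases j <;> simp [Matrix.one_apply]

/-- The conjugated and swapped matrix is another left inverse of F, and inverses are unique. So the
inverse of a real frame has a real first row and conjugate second and third rows. -/
theorem conjSwapRow_eq_self {E F : Mat3} (h : E * F = 1) (hF : conjSwapCol F = F) :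
    conjSwapRow E = E := by
  have h1 : conjSwapRow E * F = 1 := by
    conv_lhs => rw [← hF]
    rw [conjSwapRow_mul_conjSwapCol, h, conjSwap_one]
  calc conjSwapRow E = conjSwapRow E * (F * E) := by rw [mul_eq_one_comm.1 h, mul_one]
    _ = E := by rw [← mul_assoc, h1, one_mul]

theorem SmoothAt.smoothM_coframe {L : LocalData} {s : ℂ → CM5} (h : SmoothAt s z)
    (hL : L.RegularAt z) : SmoothM (coframe L s) z := by
  have h1 := hL.contDiffAt_a.mul hL.contDiffAt_c
  have h2 := hL.contDiffAt_a.mul hL.contDiffAt_c.star_comp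
  intro i j
  fin_cases i
  · exact h.duC j
  · exact (h1.inv (mul_ne_zero hL.a_ne_zero (cOf_ne_zero _ _))).mul (h.etaC j).star_comp
  · exact (h2.inv (mul_ne_zero hL.a_ne_zero (star_cOf_ne_zero _ _))).mul (h.etaC j)

/-- A point of the quadric with given coordinates. -/
def toCM5 (x χ : Vec) : CM5 :=
  if h : x ⬝ᵥ χ = 1 then ⟨(x, χ), h⟩ else ⟨(![1, 0, 0], ![1, 0, 0]), by simp [CM5]⟩

theorem toCM5_coe {x χ : Vec} (h : x ⬝ᵥ χ = 1) : (toCM5 x χ : Vec × Vec) = (x, χ) := by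
  rw [toCM5, dif_pos h]

/-- `s` is a smooth lift near `z` with the invariants of `L`. -/
structure GoodAt (L : LocalData) (s : ℂ → CM5) (z : ℂ) : Prop where
  smooth : SmoothAt s z
  adapted : AdaptedAt L s z

/-- Local existence of a lift with prescribed invariants. -/
theorem exists_local_lift {L : LocalData} {ρ : ℂ → ℂ} (hL : ∀ᶠ w in 𝓝 z, L.RegularAt w)
    (hρ : ∀ᶠ w in 𝓝 z, ContDiffAt ℝ ∞ ρ w) (flat : ∀ᶠ w in 𝓝 z, L.FlatAt ρ w) :
    ∃ s : ℂ → CM5, ∀ᶠ w in 𝓝 z, GoodAt L s w ∧ rhoOf s w = ρ w := by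
  -- Any invertible matrix with real first column and conjugate second and third columns would
  -- serve; here the determinant is 2i.
  let F₀ : Mat3 := !![1, 0, 0; 0, 1, 1; 0, -I, I]
  have hF₀ : conjSwapCol F₀ = F₀ := by
    ext i j
    fin_cases i <;> fin_cases j <;> simp [conjSwapCol_apply, F₀]
  have hF₀u : IsUnit F₀ := by
    rw [Matrix.isUnit_iff_isUnit_det, isUnit_iff_ne_zero, Matrix.det_fin_three]
    simp [F₀]
  obtain ⟨F, hF0, hF⟩ := exists_matrix_solution (U := L.connZ ρ) (V := L.connZbar ρ)
    ((hL.and hρ).mono fun w hw => hw.1.smoothM_connZ hw.2)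
    ((hL.and hρ).mono fun w hw => hw.1.smoothM_connZbar hw.2) flat F₀
  have hu : ∀ᶠ w in 𝓝 z, IsUnit (F w) :=
    hF.self_of_nhds.1.eventually_isUnit (hF0 ▸ hF₀u)
  have hE : ∀ᶠ w in 𝓝 z, SmoothM (fun w => (F w)⁻¹) w :=
    (hF.and hu).mono fun w hw => hw.1.1.inv hw.2
  have hEF : ∀ᶠ w in 𝓝 z, (F w)⁻¹ * F w = 1 := hu.mono fun w hw =>
    Matrix.nonsing_inv_mul _ ((Matrix.isUnit_iff_isUnit_det _).1 hw)
  -- The conjugated and swapped solution solves the same system with the same initial value, so by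
  -- uniqueness the reality condition propagates.
  have hreal : ∀ᶠ w in 𝓝 z, conjSwapCol (F w) = F w := by
    have := matrix_solution_unique (G := fun w => conjSwapCol (F w)) hEF hE hF
      (hF.mono fun w hw => ⟨fun i j => (hw.1 _ _).star_comp, by
        rw [dzM_conjSwapCol, hw.2.2, conjSwapCol_mul, LocalData.conjSwap_connZbar], by
        rw [dzbarM_conjSwapCol, hw.2.1, conjSwapCol_mul]; rfl⟩)
    filter_upwards [this] with w hw
    have h1 := hEF.self_of_nhds
    rw [hF0] at hw h1
    rw [hw, hF₀, mul_eq_one_comm.1 h1, one_mul]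
  -- The lift is the first column of F with the first row of its inverse; both are real, and the (0,
  -- 0) entry of the product of inverse and F gives ⟨x, χ⟩ = 1. The default value of `toCM5` is
  -- never met near z.
  let s : ℂ → CM5 := fun w => toCM5 (fun i => (F w i 0).re) (fun i => ((F w)⁻¹ 0 i).re)
  have hco : ∀ᶠ w in 𝓝 z, (∀ i, ptC s w i = F w i 0) ∧ (∀ i, duC s w i = (F w)⁻¹ 0 i) ∧
      (s w : Vec × Vec) = (fun i => (F w i 0).re, fun i => ((F w)⁻¹ 0 i).re) := by
    filter_upwards [hreal, hEF] with w h1 h2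
    have h3 := conjSwapRow_eq_self h2 h1
    have hx : ∀ i, (((F w i 0).re : ℝ) : ℂ) = F w i 0 := fun i =>
      conj_eq_iff_re.1 (congrFun (congrFun h1 i) 0)
    have hχ : ∀ i, ((((F w)⁻¹ 0 i).re : ℝ) : ℂ) = (F w)⁻¹ 0 i := fun i =>
      conj_eq_iff_re.1 (congrFun (congrFun h3 0) i)
    have h4 : (fun i => (F w i 0).re) ⬝ᵥ (fun i => ((F w)⁻¹ 0 i).re) = 1 := by
      have h5 := congrFun (congrFun h2 0) 0
      rw [Matrix.mul_apply] at h5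
      apply ofReal_injective
      rw [← ofReal_dotProduct]
      simp only [hx, hχ]
      rw [dotProduct_comm]
      exact h5
    have h6 : (s w : Vec × Vec) = _ := toCM5_coe h4
    refine ⟨fun i => ?_, fun i => ?_, h6⟩
    · rw [← hx]; simp only [ptC, h6]
    · rw [← hχ]; simp only [duC, h6]
  have hsm : ∀ᶠ w in 𝓝 z, SmoothAt s w := by
    filter_upwards [hco.eventually_nhds, hF, hE] with w h1 h2 h3
    have h4 : ContDiffAt ℝ ∞
        (fun w => ((fun i => (F w i 0).re, fun i => ((F w)⁻¹ 0 i).re) : Vec × Vec)) w :=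
      (contDiffAt_pi.2 fun i => reCLM.contDiff.contDiffAt.comp w (h2.1 i 0)).prodMk
        (contDiffAt_pi.2 fun i => reCLM.contDiff.contDiffAt.comp w (h3 0 i))
    exact h4.congr_of_eventuallyEq (h1.mono fun w hw => hw.2.2)
  have hrx : ∀ᶠ w in 𝓝 z, rhoOf s w = ρ w ∧ (∀ i, xiC s w i = F w i 1) ∧
      (∀ j, etaC s w j = L.a w * star (cOf L.θ w) * (F w)⁻¹ 2 j) := by
    filter_upwards [hco.eventually_nhds, hF, hsm, hEF.eventually_nhds, hE, hL]
      with w h1 h2 h3 h4 h5 h6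
    have h4' := h4.self_of_nhds
    have d1 : ∀ i, dzV (ptC s) w i = (F w * L.connZ ρ w) i 0 := by
      intro i
      rw [← h2.2.1]
      exact dz_congr (h1.mono fun q hq => hq.1 i)
    have d2 : ∀ j, dzV (duC s) w j = -(L.connZ ρ w * (F w)⁻¹) 0 j := by
      intro j
      have e1 : dzM (fun w => (F w)⁻¹ * F w) w = 0 := by
        rw [dzM_congr h4]; ext i j; exact dz_const _
      rw [dzM_mul h5.diffM h2.1.diffM, h2.2.1, ← mul_assoc, h4', one_mul] at e1
      have e3 : dzM (fun w => (F w)⁻¹) w = -(L.connZ ρ w * (F w)⁻¹) := by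
        have := congrArg (fun B => B * (F w)⁻¹) e1
        simp only [add_mul, mul_assoc, mul_eq_one_comm.1 h4', mul_one, zero_mul] at this
        exact eq_neg_of_add_eq_zero_left this
      rw [← Matrix.neg_apply, ← e3]
      exact dz_congr (h1.mono fun q hq => hq.2.1 j)
    have hρ' : rhoOf s w = ρ w := by
      have : rhoOf s w = ((F w)⁻¹ * (F w * L.connZ ρ w)) 0 0 := by
        rw [rhoOf_eq, dotProduct_comm, Matrix.mul_apply, dotProduct]
        refine Finset.sum_congr rfl fun i _ => ?_
        rw [d1, h1.self_of_nhds.2.1]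
      rw [this, ← mul_assoc, h4', one_mul]
      rfl
    refine ⟨hρ', fun i => ?_, fun j => ?_⟩
    · rw [xiC_eq h3.diffAt, Pi.sub_apply, Pi.smul_apply, d1, h1.self_of_nhds.1, hρ']
      simp [Matrix.mul_apply, Fin.sum_univ_three, LocalData.connZ]
      ring
    · rw [etaC_eq h3.diffAt, Pi.add_apply, Pi.smul_apply, d2, h1.self_of_nhds.2.1, hρ']
      simp [Matrix.mul_apply, Fin.sum_univ_three, LocalData.connZ]
  refine ⟨s, ?_⟩
  filter_upwards [hrx.eventually_nhds, hsm, hF, hEF, hreal, hL] with w h1 h2 h3 h4 h5 h6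
  -- Each pairing is now an entry of a matrix product in which the inverse of F cancels F, so the
  -- invariants are read off the connection matrices.
  have hp : ∀ (i : Fin 3) (v : Fin 3 → ℂ) (B : Mat3) (k : Fin 3), (∀ i, v i = (F w * B) i k) →
      ∀ η : Fin 3 → ℂ, ∀ m : ℂ, (∀ j, η j = m * (F w)⁻¹ i j) → v ⬝ᵥ η = m * B i k := by
    intro i v B k hv η m hη
    have : B i k = ((F w)⁻¹ * (F w * B)) i k := by rw [← mul_assoc, h4, one_mul]
    rw [this, Matrix.mul_apply, Finset.mul_sum, dotProduct]
    refine Finset.sum_congr rfl fun j _ => ?_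
    rw [hv, hη]
    ring
  obtain ⟨hρw, hξ, hη⟩ := h1.self_of_nhds
  have hη' : ∀ j, star (etaC s w) j = L.a w * cOf L.θ w * (F w)⁻¹ 1 j := by
    intro j
    rw [Pi.star_apply, hη]
    have := congrFun (congrFun (conjSwapRow_eq_self h4 h5) 1) j
    rw [conjSwapRow_apply] at this
    rw [← this]
    simp only [star_mul', L.star_a, star_star]
    rfl
  have hξ1 : ∀ i, xiC s w i = (F w * 1) i 1 := fun i => by rw [mul_one, hξ]
  have dξ : ∀ i, dzV (xiC s) w i = (F w * L.connZ ρ w) i 1 := by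
    intro i
    rw [← h3.2.1]
    exact dz_congr (h1.mono fun q hq => hq.2.1 i)
  have dξ' : ∀ i, dzbarV (xiC s) w i = (F w * L.connZbar ρ w) i 1 := by
    intro i
    rw [← h3.2.2]
    exact dzbar_congr (h1.mono fun q hq => hq.2.1 i)
  have ha := h6.a_ne_zero
  have hc := star_cOf_ne_zero L.θ w
  refine ⟨⟨h2, ⟨?_, ?_, ?_, ?_⟩⟩, hρw⟩
  · rw [hp 2 _ _ 1 hξ1 _ _ hη]; simp
  · rw [hp 1 _ _ 1 hξ1 _ _ hη']; simp [LocalData.a]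
  · rw [hp 2 _ _ 1 dξ' _ _ hη, LocalData.connZbar_eq]
    change L.a w * star (cOf L.θ w) * ((star (cOf L.θ w))⁻¹ * L.φ w) = L.a w * L.φ w
    field_simp
  · rw [hp 2 _ _ 1 dξ _ _ hη, LocalData.connZ]
    change L.a w * star (cOf L.θ w) * ((L.a w * star (cOf L.θ w))⁻¹ * L.Q w) = L.Q w
    rw [mul_inv_cancel_left₀ (mul_ne_zero ha hc)]

theorem frame_actL {s : ℂ → CM5} (hs : DiffAt s z) (A : GL3) :
    frame (fun q => actL A (s q)) z = A.1.map ofReal * frame s z := by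
  have h2 : star ((A.1.map ofReal) *ᵥ xiC s z) = (A.1.map ofReal) *ᵥ star (xiC s z) := by
    ext i
    simp [Matrix.mulVec, dotProduct]
  ext i j
  fin_cases j
  · exact congrFun (ptC_actL A) i
  · exact congrFun (xiC_actL hs A) i
  · change star (xiC (fun q => actL A (s q)) z) i = _
    rw [xiC_actL hs A, h2]
    rfl

theorem map_ofReal_injective {A B : Matrix (Fin 3) (Fin 3) ℝ}
    (h : A.map ofReal = B.map ofReal) : A = B := by
  ext i j
  exact ofReal_injective (congrFun (congrFun h i) j)

theorem frame_congr {s s' : ℂ → CM5} (h : s =ᶠ[𝓝 z] s') : frame s z = frame s' z := by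
  have h1 : xiC s z = xiC s' z := by
    have e1 : (fun q => (s q).1.1) =ᶠ[𝓝 z] fun q => (s' q).1.1 :=
      h.mono fun q hq => by simp only [hq]
    ext i
    simp only [xiC, xi, dx, e1.fderiv_eq, h.self_of_nhds]
  have h2 : ptC s z = ptC s' z := by ext i; simp only [ptC, h.self_of_nhds]
  rw [frame, frame, h1, h2]

/-- The linear map relating two lifts is unique. -/
theorem actL_injective {L : LocalData} {s : ℂ → CM5} (hs : GoodAt L s z)
    (hH : L.H = 1 ∨ L.H = -1) {A B : GL3}
    (h : ∀ᶠ w in 𝓝 z, actL A (s w) = actL B (s w)) : A = B := by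
  have e1 := frame_congr h
  rw [frame_actL hs.smooth.diffAt, frame_actL hs.smooth.diffAt] at e1
  have e2 := congrArg (fun M => M * coframe L s z) e1
  have e3 := mul_eq_one_comm.1 (hs.adapted.coframe_mul_frame hs.smooth.diffAt hH)
  simp only [mul_assoc, e3, mul_one] at e2
  exact Units.ext (map_ofReal_injective e2)

/-- The swaps of columns and rows cancel in the product, so both reality conditions together make it
equal to its conjugate. -/
theorem frame_mul_coframe_real {L : LocalData} {s s' : ℂ → CM5} (hs : GoodAt L s z)
    (hH : L.H = 1 ∨ L.H = -1) : ∃ A : Matrix (Fin 3) (Fin 3) ℝ,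
      frame s' z * coframe L s z = A.map ofReal := by
  have h1 := conjSwapRow_eq_self (hs.adapted.coframe_mul_frame hs.smooth.diffAt hH)
    conjSwapCol_frame
  have h2 : (frame s' z * coframe L s z).map star = frame s' z * coframe L s z := by
    rw [← conjSwapCol_mul_conjSwapRow, h1, conjSwapCol_frame]
  refine ⟨(frame s' z * coframe L s z).map re, ?_⟩
  ext i j
  exact (conj_eq_iff_re.1 (congrFun (congrFun h2 i) j)).symm

/-- Local uniqueness of a lift with prescribed invariants. -/
theorem local_lift_unique {L : LocalData} {s s' : ℂ → CM5} (hL : ∀ᶠ w in 𝓝 z, L.RegularAt w)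
    (hs : ∀ᶠ w in 𝓝 z, GoodAt L s w) (hs' : ∀ᶠ w in 𝓝 z, GoodAt L s' w)
    (hρ : ∀ᶠ w in 𝓝 z, rhoOf s' w = rhoOf s w) :
    ∃ A : GL3, ∀ᶠ w in 𝓝 z, s' w = actL A (s w) := by
  have hH := hL.self_of_nhds.sign
  have hEF : ∀ᶠ w in 𝓝 z, coframe L s w * frame s w = 1 := hs.mono fun w hw =>
    hw.adapted.coframe_mul_frame hw.smooth.diffAt hH
  have hEF' : ∀ᶠ w in 𝓝 z, coframe L s' w * frame s' w = 1 := hs'.mono fun w hw =>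
    hw.adapted.coframe_mul_frame hw.smooth.diffAt hH
  have hE : ∀ᶠ w in 𝓝 z, SmoothM (coframe L s) w :=
    (hs.and hL).mono fun w hw => hw.1.smooth.smoothM_coframe hw.2
  have hsol : ∀ {σ : ℂ → CM5}, (∀ᶠ w in 𝓝 z, GoodAt L σ w) → ∀ᶠ w in 𝓝 z, SmoothM (frame σ) w ∧
      dzM (frame σ) w = frame σ w * L.connZ (rhoOf σ) w ∧
      dzbarM (frame σ) w = frame σ w * L.connZbar (rhoOf σ) w := by
    intro σ hσ
    filter_upwards [hσ.eventually_nhds, hL] with w h1 h2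
    have h3 := h1.mono fun q hq => hq.adapted
    exact ⟨h1.self_of_nhds.smooth.smoothM_frame,
      AdaptedAt.dzM_frame h3 h1.self_of_nhds.smooth h2,
      AdaptedAt.dzbarM_frame h3 h1.self_of_nhds.smooth h2⟩
  have hF' : ∀ᶠ w in 𝓝 z, SmoothM (frame s') w ∧
      dzM (frame s') w = frame s' w * L.connZ (rhoOf s) w ∧
      dzbarM (frame s') w = frame s' w * L.connZbar (rhoOf s) w := by
    filter_upwards [hsol hs', hρ] with w h1 h2
    have e1 : L.connZ (rhoOf s') w = L.connZ (rhoOf s) w := by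
      simp only [LocalData.connZ, h2]
    have e2 : L.connZbar (rhoOf s') w = L.connZbar (rhoOf s) w := by
      simp only [LocalData.connZbar, e1]
    rw [← e1, ← e2]
    exact h1
  have hu := matrix_solution_unique hEF hE (hsol hs) hF'
  have hFE := mul_eq_one_comm.1 hEF.self_of_nhds
  obtain ⟨A, hA⟩ := frame_mul_coframe_real (s' := s') hs.self_of_nhds hH
  obtain ⟨B, hB⟩ := frame_mul_coframe_real (s' := s) hs'.self_of_nhds hH
  have hBA : B.map ofReal * A.map ofReal = (1 : Mat3) := by
    rw [← hA, ← hB, ← mul_assoc, mul_assoc (frame s z), hEF'.self_of_nhds, mul_one, hFE]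
  have hBA' : B * A = 1 := by
    apply map_ofReal_injective
    have e1 : (B * A).map ofReal = B.map ofReal * A.map ofReal :=
      Matrix.map_mul (f := (ofRealHom : ℝ →+* ℂ))
    have e2 : (1 : Matrix (Fin 3) (Fin 3) ℝ).map ofReal = (1 : Mat3) :=
      Matrix.map_one _ ofReal_zero ofReal_one
    rw [e1, e2, hBA]
  refine ⟨⟨A, B, mul_eq_one_comm.1 hBA', hBA'⟩, ?_⟩
  filter_upwards [hu, hEF, hEF'] with w h1 h2 h3
  rw [hA] at h1
  -- The dual frame transforms by the inverse matrix; its first row then gives the χ component, as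
  -- the first column of the frame gives x.
  have h4 : coframe L s' w = coframe L s w * B.map ofReal := by
    have e1 : coframe L s w * B.map ofReal * frame s' w = 1 := by
      rw [h1, ← mul_assoc, mul_assoc (coframe L s w), hBA, mul_one, h2]
    calc coframe L s' w = coframe L s w * B.map ofReal * frame s' w * coframe L s' w := by
          rw [e1, one_mul]
      _ = _ := by rw [mul_assoc, mul_eq_one_comm.1 h3, mul_one]
  apply Subtype.ext
  refine Prod.ext ?_ ?_
  · ext i
    apply ofReal_injective
    have := congrFun (congrFun h1 i) 0
    refine this.trans ?_
    simp only [actL, Matrix.mulVec, dotProduct, Matrix.mul_apply]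
    push_cast
    rfl
  · ext j
    apply ofReal_injective
    have := congrFun (congrFun h4 0) j
    refine this.trans ?_
    simp only [actL, Matrix.vecMul, dotProduct, Matrix.mul_apply]
    push_cast
    rfl

end LocalTheory

/-! ### Normalized lifts and the canonical form ρ. -/

noncomputable section Normalization

open Complex

variable {z : ℂ}

/-! ### Normalized lifts -/

/-- Liouville's formula. Applied to the frame, it turns a normalization of the determinant into an
equation for the trace of the connection, hence for ρ. -/
theorem dz_det {F : ℂ → Mat3} {U : Mat3} (hF : DiffM F z) (h : dzM F z = F z * U) :
    dz (fun w => (F w).det) z = U.trace * (F z).det := by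
  have e : ∀ i j, dz (fun w => F w i j) z = F z i 0 * U 0 j + F z i 1 * U 1 j + F z i 2 * U 2 j := by
    intro i j
    have := congrFun (congrFun h i) j
    rwa [Matrix.mul_apply, Fin.sum_univ_three] at this
  have d : ∀ i j k, DifferentiableAt ℝ (fun w => F w 0 i * F w 1 j * F w 2 k) z := fun i j k =>
    ((hF 0 i).fun_mul (hF 1 j)).fun_mul (hF 2 k)
  have m : ∀ i j k, dz (fun w => F w 0 i * F w 1 j * F w 2 k) z =
      dz (fun w => F w 0 i) z * F z 1 j * F z 2 k + F z 0 i * dz (fun w => F w 1 j) z * F z 2 k +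
        F z 0 i * F z 1 j * dz (fun w => F w 2 k) z := by
    intro i j k
    rw [dz_mul ((hF 0 i).fun_mul (hF 1 j)) (hF 2 k), dz_mul (hF 0 i) (hF 1 j)]
    ring
  have p : (fun w => (F w).det) = fun w => F w 0 0 * F w 1 1 * F w 2 2 + F w 0 1 * F w 1 2 * F w 2 0
      + F w 0 2 * F w 1 0 * F w 2 1 - (F w 0 0 * F w 1 2 * F w 2 1 + F w 0 1 * F w 1 0 * F w 2 2
      + F w 0 2 * F w 1 1 * F w 2 0) := by
    ext1 w
    rw [Matrix.det_fin_three]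
    ring
  rw [p, dz_sub (((d _ _ _).fun_add (d _ _ _)).fun_add (d _ _ _))
    (((d _ _ _).fun_add (d _ _ _)).fun_add (d _ _ _)),
    dz_add ((d _ _ _).fun_add (d _ _ _)) (d _ _ _), dz_add (d _ _ _) (d _ _ _),
    dz_add ((d _ _ _).fun_add (d _ _ _)) (d _ _ _), dz_add (d _ _ _) (d _ _ _)]
  simp only [m, e]
  rw [Matrix.det_fin_three, Matrix.trace_fin_three]
  ring

theorem det_conjSwapCol (A : Mat3) : (conjSwapCol A).det = -star A.det := by
  simp [Matrix.det_fin_three, conjSwapCol_apply]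
  ring

/-- Conjugation exchanges two columns of the frame, so its determinant is purely imaginary and
|det|² = -det² can be differentiated as a polynomial in det. -/
theorem star_det_frame (s : ℂ → CM5) (z : ℂ) : star (frame s z).det = -(frame s z).det := by
  conv_rhs => rw [← conjSwapCol_frame, det_conjSwapCol]
  rw [neg_neg]

theorem ofReal_normSq_det_frame (s : ℂ → CM5) (z : ℂ) :
    ((normSq (frame s z).det : ℝ) : ℂ) = -(frame s z).det ^ 2 := by
  rw [normSq_eq_conj_mul_self]
  change star _ * _ = _
  rw [star_det_frame]
  ring

theorem SmoothAt.contDiffAt_det_frame {s : ℂ → CM5} (h : SmoothAt s z) :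
    ContDiffAt ℝ ∞ (fun w => (frame s w).det) z := by
  have h' := h.smoothM_frame
  simp only [Matrix.det_fin_three]
  exact (((((((h' _ _).mul (h' _ _)).mul (h' _ _)).sub (((h' _ _).mul (h' _ _)).mul (h' _ _))).sub
    (((h' _ _).mul (h' _ _)).mul (h' _ _))).add (((h' _ _).mul (h' _ _)).mul (h' _ _))).add
    (((h' _ _).mul (h' _ _)).mul (h' _ _))).sub (((h' _ _).mul (h' _ _)).mul (h' _ _))

theorem SmoothAt.contDiffAt_normSq_det_frame {s : ℂ → CM5} (h : SmoothAt s z) :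
    ContDiffAt ℝ ∞ (fun w => normSq (frame s w).det) z := by
  have h' := h.contDiffAt_det_frame
  have h1 := reCLM.contDiff.contDiffAt.comp z h'
  have h2 := imCLM.contDiff.contDiffAt.comp z h'
  exact (h1.mul h1).add (h2.mul h2)

/-- The canonical form `-(∂_z log c + (c⁻¹ + c̄⁻¹) φ) / 3`. -/
def LocalData.rhoCan (L : LocalData) (z : ℂ) : ℂ :=
  -(dz (fun w => log (cOf L.θ w)) z +
    ((cOf L.θ z)⁻¹ * L.φ z + (star (cOf L.θ z))⁻¹ * L.φ z)) / 3

theorem LocalData.RegularAt.contDiffAt_rhoCan {L : LocalData} (h : L.RegularAt z) :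
    ContDiffAt ℝ ∞ L.rhoCan z :=
  ((h.contDiffAt_log_c.dz.add (((h.contDiffAt_c.inv (cOf_ne_zero _ _)).mul h.φ).add
    ((h.contDiffAt_c.star_comp.inv (star_cOf_ne_zero _ _)).mul h.φ))).neg).div_const 3

/-- In the imaginary part of (b) the norms and ∂_z∂_z̄ u drop out, and ∂_z(c⁻¹ conj φ) is the
conjugate of ∂_z̄(conj(c)⁻¹ φ). The rest is 3 (Im ∂_z̄ ρ - He^u Im c) = 0 for the canonical ρ. -/
theorem LocalData.RegularAt.compRho_rhoCan {L : LocalData} (h : L.RegularAt z)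
    (h1 : Comp1 L.H L.u L.θ L.φ L.Q z) : CompRho L.H L.u L.θ L.rhoCan z := by
  have s1 : ContDiffAt ℝ ∞ (fun w => (cOf L.θ w)⁻¹ * L.φ w) z :=
    (h.contDiffAt_c.inv (cOf_ne_zero _ _)).mul h.φ
  have s2 : ContDiffAt ℝ ∞ (fun w => (star (cOf L.θ w))⁻¹ * L.φ w) z :=
    (h.contDiffAt_c.star_comp.inv (star_cOf_ne_zero _ _)).mul h.φ
  have hu := h.u.ofReal_comp'
  have hl := h.contDiffAt_log_c
  have e1 : dzbar L.rhoCan z = (-1 / 3) * (dzbar (dz (fun w => log (cOf L.θ w))) z +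
      (dzbar (fun w => (cOf L.θ w)⁻¹ * L.φ w) z +
        dzbar (fun w => (star (cOf L.θ w))⁻¹ * L.φ w) z)) := by
    have : L.rhoCan = fun w => (-1 / 3) * (dz (fun w => log (cOf L.θ w)) w +
      ((cOf L.θ w)⁻¹ * L.φ w + (star (cOf L.θ w))⁻¹ * L.φ w)) := by
      ext1 w; rw [LocalData.rhoCan]; ring
    have d1 := s1.differentiableAt (n := ∞) (by simp)
    have d2 := s2.differentiableAt (n := ∞) (by simp)
    have d3 := hl.dz.differentiableAt (n := ∞) (by simp)
    rw [this, dzbar_const_mul _ (d3.fun_add (d1.fun_add d2)), dzbar_add d3 (d1.fun_add d2),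
      dzbar_add d1 d2]
  have e2 : dzbar (fun w => (star (cOf L.θ w))⁻¹ * L.φ w) z =
      star (dz (fun w => (cOf L.θ w)⁻¹ * star (L.φ w)) z) := by
    rw [← dzbar_star]
    simp [star_mul']
  have e3 : dz (dzbar (fun w => log (cOf L.θ w) + (L.u w : ℂ))) z =
      dzbar (dz (fun w => log (cOf L.θ w))) z + dz (dzbar (fun w => (L.u w : ℂ))) z := by
    rw [← dz_dzbar_comm hl, ← dz_add (hl.dzbar.differentiableAt (by simp))
      (hu.dzbar.differentiableAt (by simp))]
    refine dz_congr ?_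
    filter_upwards [hl.eventually_differentiableAt, hu.eventually_differentiableAt] with w h1 h2
    exact dzbar_add h1 h2
  have e4 : (dz (dzbar (fun w => (L.u w : ℂ))) z).im = 0 := by
    rw [← conj_eq_iff_im]
    change star _ = _
    rw [← dzbar_star, dz_dzbar_comm hu]
    congr 1
    ext1 w
    rw [dzbar_ofReal, star_star]
  rw [Comp1, e3] at h1
  have h2 := congrArg im h1
  simp only [add_im, sub_im, ofReal_im, zero_im, e4, mul_assoc,
    Complex.star_def, conj_im, mul_im, ofReal_re, ofReal_im] at h2
  rw [CompRho, e1, e2]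
  simp only [Complex.star_def, mul_im, add_im, conj_im] at h2 ⊢
  norm_num at h2 ⊢
  linarith

/-- The lift `s` is normalized at `z`. -/
def NormalizedAt (L : LocalData) (s : ℂ → CM5) (z : ℂ) : Prop :=
  normSq (frame s z).det = Real.exp (2 * L.u z)

/-- Taking the logarithmic derivative of |det F|² = e^{2u} gives trace U = ∂_z u. The trace contains
3ρ, so the equation determines ρ. -/
theorem NormalizedAt.rhoOf_eq {L : LocalData} {s : ℂ → CM5} (hL : L.RegularAt z)
    (hs : ∀ᶠ w in 𝓝 z, GoodAt L s w) (hn : ∀ᶠ w in 𝓝 z, NormalizedAt L s w) :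
    rhoOf s z = L.rhoCan z := by
  have h0 := hs.self_of_nhds
  have hd : dz (fun w => (frame s w).det) z = _ := dz_det h0.smooth.smoothM_frame.diffM
    (AdaptedAt.dzM_frame (hs.mono fun w hw => hw.adapted) h0.smooth hL)
  have hdd := h0.smooth.contDiffAt_det_frame.differentiableAt (by simp)
  have hu := hL.u.ofReal_comp'.differentiableAt (n := ∞) (by simp)
  have hne : (((Real.exp (2 * L.u z)) : ℝ) : ℂ) ≠ 0 := exp_ofReal_ne_zero _
  have e1 : dz (fun w => -((frame s w).det * (frame s w).det)) z =
      dz (fun w => ((Real.exp (2 * L.u w) : ℝ) : ℂ)) z := by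
    refine dz_congr (hn.mono fun w hw => ?_)
    change _ = ((Real.exp (2 * L.u w) : ℝ) : ℂ)
    rw [← hw, ofReal_normSq_det_frame]
    ring
  have e0 : -((frame s z).det * (frame s z).det) = ((Real.exp (2 * L.u z) : ℝ) : ℂ) := by
    rw [← hn.self_of_nhds, ofReal_normSq_det_frame]
    ring
  have e2 : dz (fun w => ((2 * L.u w : ℝ) : ℂ)) z = 2 * dz (fun w => (L.u w : ℂ)) z := by
    rw [← dz_const_mul 2 hu]
    simp
  have hu2 : DifferentiableAt ℝ (fun w => ((2 * L.u w : ℝ) : ℂ)) z := by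
    simpa using hu.const_mul (2 : ℂ)
  rw [dz_neg, dz_mul hdd hdd, hd, dz_exp_ofReal hu2, e2, ← e0, LocalData.trace_connZ] at e1
  have e3 : dz L.ell z = dz (fun w => log (cOf L.θ w)) z + dz (fun w => (L.u w : ℂ)) z :=
    dz_add (hL.contDiffAt_log_c.differentiableAt (by simp)) hu
  rw [← e0] at hne
  have e4 := mul_left_cancel₀ hne (show _ = _ from by
    linear_combination e1 / 2 : -((frame s z).det * (frame s z).det) *
      (3 * rhoOf s z + dz L.ell z + ((cOf L.θ z)⁻¹ + (star (cOf L.θ z))⁻¹) * L.φ z) =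
      -((frame s z).det * (frame s z).det) * dz (fun w => (L.u w : ℂ)) z)
  rw [LocalData.rhoCan]
  rw [e3] at e4
  linear_combination e4 / 3

/-- The lift `s` multiplied by `e^τ`. -/
def rescale (τ : ℂ → ℝ) (s : ℂ → CM5) (z : ℂ) : CM5 :=
  ⟨(Real.exp (τ z) • (s z).1.1, (Real.exp (τ z))⁻¹ • (s z).1.2), by
    have h : (s z).1.1 ⬝ᵥ (s z).1.2 = 1 := (s z).2
    have h' := (Real.exp_pos (τ z)).ne'
    simp [CM5, h, h']⟩

theorem proj_rescale (τ : ℂ → ℝ) (s : ℂ → CM5) (z : ℂ) : proj (rescale τ s z) = proj (s z) :=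
  (proj_eq_proj_iff _ _).2 ⟨_, (Real.exp_pos (τ z)).ne', rfl, rfl⟩

theorem SmoothAt.rescale {τ : ℂ → ℝ} {s : ℂ → CM5} (hτ : ContDiffAt ℝ ∞ τ z)
    (hs : SmoothAt s z) : SmoothAt (rescale τ s) z := by
  have h1 := Real.contDiff_exp.contDiffAt.comp z hτ
  exact (h1.smul hs.fst).prodMk ((h1.inv (Real.exp_pos (τ z)).ne').smul hs.snd)

theorem rescaledAt_rescale {τ : ℂ → ℝ} (s : ℂ → CM5) (hτ : DifferentiableAt ℝ τ z) :
    RescaledAt s (rescale τ s) (fun w => Real.exp (τ w)) z :=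
  ⟨hτ.exp, .of_forall fun w => ⟨(Real.exp_pos (τ w)).ne', rfl, rfl⟩⟩

theorem RescaledAt.frame {s s' : ℂ → CM5} {t : ℂ → ℝ} (h : RescaledAt s s' t z)
    (hs : DiffAt s z) : frame s' z = (t z : ℂ) • frame s z := by
  have h1 := h.eventually.self_of_nhds.2.1
  have h2 := h.xiC hs
  ext i j
  fin_cases j
  · change ((s' z).1.1 i : ℂ) = (t z : ℂ) * ((s z).1.1 i : ℂ)
    rw [h1]
    simp
  · exact congrFun h2 i
  · change star (DefiniteSurface.xiC s' z i) = (t z : ℂ) * star (DefiniteSurface.xiC s z i)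
    rw [h2]
    simp

theorem GoodAt.det_frame_ne_zero {L : LocalData} {s : ℂ → CM5} (h : GoodAt L s z)
    (hH : L.H = 1 ∨ L.H = -1) : (frame s z).det ≠ 0 := by
  have e := congrArg Matrix.det (h.adapted.coframe_mul_frame h.smooth.diffAt hH)
  rw [Matrix.det_mul, Matrix.det_one] at e
  exact right_ne_zero_of_mul_eq_one e

/-- A lift with given invariants can be normalized. -/
theorem exists_normalized {L : LocalData} {s : ℂ → CM5} (hL : ∀ᶠ w in 𝓝 z, L.RegularAt w)
    (hs : ∀ᶠ w in 𝓝 z, GoodAt L s w) : ∃ s' : ℂ → CM5, (∀ w, proj (s' w) = proj (s w)) ∧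
      ∀ᶠ w in 𝓝 z, GoodAt L s' w ∧ NormalizedAt L s' w ∧ rhoOf s' w = L.rhoCan w := by
  -- All three frame vectors scale by e^τ, so |det F|² scales by e^{6τ}; this τ makes it e^{2u}.
  let τ : ℂ → ℝ := fun w => (2 * L.u w - Real.log (normSq (frame s w).det)) / 6
  have hτ : ∀ᶠ w in 𝓝 z, ContDiffAt ℝ ∞ τ w := by
    filter_upwards [hL, hs] with w h1 h2
    have h3 : normSq (frame s w).det ≠ 0 := by
      simpa using h2.det_frame_ne_zero h1.sign
    exact ((contDiffAt_const.mul h1.u).sub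
      (h2.smooth.contDiffAt_normSq_det_frame.log h3)).div_const 6
  have hr : ∀ᶠ w in 𝓝 z, RescaledAt s (rescale τ s) (fun w => Real.exp (τ w)) w :=
    hτ.mono fun w hw => rescaledAt_rescale s (hw.differentiableAt (by simp))
  have hg : ∀ᶠ w in 𝓝 z, GoodAt L (rescale τ s) w := by
    filter_upwards [hτ, hs, hr.eventually_nhds] with w h1 h2 h3
    exact ⟨h2.smooth.rescale h1, h2.adapted.rescale h2.smooth h3⟩
  have hn : ∀ᶠ w in 𝓝 z, NormalizedAt L (rescale τ s) w := by
    filter_upwards [hr, hs, hL] with w h1 h2 h3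
    have h4 : 0 < normSq (frame s w).det := normSq_pos.2 (h2.det_frame_ne_zero h3.sign)
    rw [NormalizedAt, h1.frame h2.smooth.diffAt, Matrix.det_smul, normSq_mul, map_pow,
      normSq_ofReal, Fintype.card_fin, ← Real.exp_add, ← Real.exp_nat_mul]
    have h5 : normSq (frame s w).det = Real.exp (Real.log (normSq (frame s w).det)) :=
      (Real.exp_log h4).symm
    refine (congrArg (fun y => _ * y) h5).trans ?_
    rw [← Real.exp_add]
    congr 1
    simp only [τ]
    push_cast
    ring
  refine ⟨rescale τ s, proj_rescale τ s, ?_⟩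
  filter_upwards [hg.eventually_nhds, hn.eventually_nhds, hL] with w h1 h2 h3
  exact ⟨h1.self_of_nhds, h2.self_of_nhds, NormalizedAt.rhoOf_eq h3 h1 h2⟩

end Normalization

/-! ### From coordinates to the surface. -/

noncomputable section Surfaces

open Complex

variable {M : Type*} [TopologicalSpace M]

/-! ### Changes of charts and data in a chart -/

theorem eventually_mem_source {e e' : OpenPartialHomeomorph M ℂ} {z : ℂ}
    (hz : z ∈ e.target) (hz' : e.symm z ∈ e'.source) :
    ∀ᶠ w in 𝓝 z, w ∈ e.target ∧ e.symm w ∈ e'.source :=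
  Filter.Eventually.and (e.open_target.mem_nhds hz)
    ((e.continuousAt_symm hz).eventually (e'.open_source.mem_nhds hz'))

theorem comp_symm_eventuallyEq {e e' : OpenPartialHomeomorph M ℂ} {z : ℂ}
    (hz : z ∈ e.target) (hz' : e.symm z ∈ e'.source) {X : Type*} (s : M → X) :
    s ∘ e.symm =ᶠ[𝓝 z] (s ∘ e'.symm) ∘ (e' ∘ e.symm) := by
  filter_upwards [eventually_mem_source hz hz'] with w hw
  simp [e'.left_inv hw.2]

/-- The coefficients of the data in a chart. -/
def DefiniteSurface.SurfaceData.loc (D : SurfaceData M) (e : OpenPartialHomeomorph M ℂ) :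
    LocalData := ⟨D.H, D.u e, D.θ ∘ e.symm, D.φ e, D.Q e⟩

theorem cOf_comp_symm (D : SurfaceData M) {e e' : OpenPartialHomeomorph M ℂ} {z : ℂ}
    (hz' : e.symm z ∈ e'.source) :
    cOf (D.loc e).θ z = cOf (D.loc e').θ ((e' ∘ e.symm) z) := by
  simp [cOf, SurfaceData.loc, e'.left_inv hz']

variable [ChartedSpace ℂ M]

theorem analyticAt_transition [IsManifold (modelWithCornersSelf ℂ ℂ) ω M]
    {e e' : OpenPartialHomeomorph M ℂ} (he : e ∈ atlas ℂ M) (he' : e' ∈ atlas ℂ M) {z : ℂ}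
    (hz : z ∈ e.target) (hz' : e.symm z ∈ e'.source) : AnalyticAt ℂ (e' ∘ e.symm) z := by
  have h := HasGroupoid.compatible (G := contDiffGroupoid ω (modelWithCornersSelf ℂ ℂ)) he he'
  rw [contDiffGroupoid, mem_groupoid_of_pregroupoid] at h
  have h2 : ContDiffOn ℂ ω (e' ∘ e.symm) (e.symm ≫ₕ e').source := by
    simpa [contDiffPregroupoid] using h.1
  have h3 : z ∈ (e.symm ≫ₕ e').source := by
    rw [OpenPartialHomeomorph.trans_source]; exact ⟨hz, hz'⟩
  exact (h2.contDiffAt ((e.symm ≫ₕ e').open_source.mem_nhds h3)).analyticAt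

theorem DefiniteSurface.SurfaceData.IsGeometric.regularAt {D : SurfaceData M} (hD : D.IsGeometric)
    {e : OpenPartialHomeomorph M ℂ} (he : e ∈ atlas ℂ M) {z : ℂ} (hz : z ∈ e.target) :
    (D.loc e).RegularAt z where
  sign := hD.sign
  u := (hD.smooth_u e he).contDiffAt (e.open_target.mem_nhds hz)
  θ := (hD.smooth_θ e he).contDiffAt (e.open_target.mem_nhds hz)
  range_θ := hD.range_θ _
  φ := (hD.form_φ.1 e he).contDiffAt (e.open_target.mem_nhds hz)
  Q := (hD.form_Q.1 e he).contDiffAt (e.open_target.mem_nhds hz)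

section Congr

variable {s s' : ℂ → CM5} {z : ℂ}

theorem xiC_congr (h : s =ᶠ[𝓝 z] s') : xiC s z = xiC s' z := by
  ext i; exact congrFun (congrFun (frame_congr h) i) 1

theorem etaC_congr (h : s =ᶠ[𝓝 z] s') : etaC s z = etaC s' z := by
  have e1 : (fun q => (s q).1.2) =ᶠ[𝓝 z] fun q => (s' q).1.2 := h.mono fun q hq => by simp only [hq]
  ext i
  simp only [DefiniteSurface.etaC, DefiniteSurface.eta, dχ, e1.fderiv_eq, h.self_of_nhds]

theorem rhoOf_congr (h : s =ᶠ[𝓝 z] s') : rhoOf s z = rhoOf s' z := by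
  rw [rhoOf, rhoOf, h.self_of_nhds]
  congr 1
  ext i
  exact dz_congr (h.mono fun w hw => by simp only [hw])

theorem AdaptedAt.congr {L : LocalData} (h : AdaptedAt L s z) (h' : s' =ᶠ[𝓝 z] s) :
    AdaptedAt L s' z := by
  have e1 : xiC s' =ᶠ[𝓝 z] xiC s := h'.eventuallyEq_nhds.mono fun w hw => xiC_congr hw
  have e2 := etaC_congr h'
  have e3 : dzV (xiC s') z = dzV (xiC s) z := by
    ext i; exact dz_congr (e1.mono fun w hw => congrFun hw i)
  have e4 : dzbarV (xiC s') z = dzbarV (xiC s) z := by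
    ext i; exact dzbar_congr (e1.mono fun w hw => congrFun hw i)
  constructor
  · rw [e1.self_of_nhds, e2, h.null]
  · rw [e1.self_of_nhds, e2, h.pair]
  · rw [e4, e2, h.mean]
  · rw [e3, e2, h.cubic]

theorem GoodAt.congr {L : LocalData} (h : GoodAt L s z) (h' : s' =ᶠ[𝓝 z] s) : GoodAt L s' z :=
  ⟨h.smooth.congr h', h.adapted.congr h'⟩

end Congr

theorem SmoothAt.comp {s : ℂ → CM5} {τ : ℂ → ℂ} {z : ℂ} (hτ : AnalyticAt ℂ τ z)
    (hs : SmoothAt s (τ z)) : SmoothAt (s ∘ τ) z :=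
  ContDiffAt.comp (g := fun q => (s q : Vec × Vec)) z hs (hτ.contDiffAt.restrict_scalars ℝ)

/-- The pairings pick up |τ'|², |τ'|²τ' and τ'³, which are the factors of e^u, e^u φ and Q, while c
is a function on the surface. -/
theorem GoodAt.transition [IsManifold (modelWithCornersSelf ℂ ℂ) ω M] {D : SurfaceData M}
    (hD : D.IsGeometric) {e e' : OpenPartialHomeomorph M ℂ} (he : e ∈ atlas ℂ M)
    (he' : e' ∈ atlas ℂ M) {z : ℂ} (hz : z ∈ e.target) (hz' : e.symm z ∈ e'.source)
    {s : ℂ → CM5} (h : GoodAt (D.loc e') s ((e' ∘ e.symm) z)) :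
    GoodAt (D.loc e) (s ∘ (e' ∘ e.symm)) z := by
  have hτ := analyticAt_transition he he' hz hz'
  obtain ⟨h1, h2, h3, h4⟩ := pairings_comp hτ h.smooth h.adapted.null
  have hm : ((Real.exp ((D.loc e).u z) : ℝ) : ℂ) = (Real.exp ((D.loc e').u ((e' ∘ e.symm) z)) : ℝ) *
      (‖deriv (e' ∘ e.symm) z‖ ^ 2 : ℝ) := by
    rw [← ofReal_mul]
    exact congrArg ofReal (hD.metric e he e' he' z hz hz')
  have hφ : (D.loc e).φ z = (D.loc e').φ ((e' ∘ e.symm) z) * deriv (e' ∘ e.symm) z := by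
    have := hD.form_φ.2 e he e' he' z hz hz'
    rwa [pow_one] at this
  have hQ : (D.loc e).Q z = (D.loc e').Q ((e' ∘ e.symm) z) * deriv (e' ∘ e.symm) z ^ 3 :=
    hD.form_Q.2 e he e' he' z hz hz'
  have hH : (D.loc e).H = (D.loc e').H := rfl
  refine ⟨SmoothAt.comp hτ h.smooth, h1, ?_, ?_, ?_⟩
  · rw [h2, h.adapted.pair, hm, cOf_comp_symm D hz', hH]; ring
  · rw [h3, h.adapted.mean, hm, hφ, hH]; ring
  · rw [h4, h.adapted.cubic, hQ]; ring

/-! ### The invariants of an immersion with a lift -/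

theorem DefiniteSurface.IsLift.smoothAt {f : M → DP2} {s : M → CM5} (h : IsLift f s)
    {e : OpenPartialHomeomorph M ℂ} (he : e ∈ atlas ℂ M) {z : ℂ} (hz : z ∈ e.target) :
    SmoothAt (s ∘ e.symm) z := (h.2 e he).contDiffAt (e.open_target.mem_nhds hz)

theorem DefiniteSurface.IsLift.isLocalLiftAt {f : M → DP2} {s : M → CM5} (h : IsLift f s)
    {e : OpenPartialHomeomorph M ℂ} (he : e ∈ atlas ℂ M) {z : ℂ} (hz : z ∈ e.target) :
    IsLocalLiftAt (f ∘ e.symm) (s ∘ e.symm) z :=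
  ⟨h.smoothAt he hz, .of_forall fun w => h.1 (e.symm w)⟩

theorem DefiniteSurface.HasInvariants.invariantsAt {f : M → DP2} {D : SurfaceData M} (h : HasInvariants f D)
    {e : OpenPartialHomeomorph M ℂ} (he : e ∈ atlas ℂ M) {z : ℂ} (hz : z ∈ e.target)
    {s : ℂ → CM5} (hs : IsLocalLiftAt (f ∘ e.symm) s z) : InvariantsAt (D.loc e) s z :=
  ⟨h.metric e he z hz s hs, h.angle e he z hz s hs, h.meanCurvature e he z hz s hs,
    h.cubic e he z hz s hs⟩

theorem DefiniteSurface.HasInvariants.goodAt {f : M → DP2} {D : SurfaceData M} (h : HasInvariants f D)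
    {e : OpenPartialHomeomorph M ℂ} (he : e ∈ atlas ℂ M) {z : ℂ} (hz : z ∈ e.target)
    {s : ℂ → CM5} (hs : IsLocalLiftAt (f ∘ e.symm) s z) : GoodAt (D.loc e) s z :=
  ⟨hs.1, ((invariantsAt_iff (L := D.loc e) h.sign).1 (h.invariantsAt he hz hs)).1⟩

theorem real_sign_mul_self {H : ℝ} (h : H = 1 ∨ H = -1) : H * H = 1 := by
  rcases h with rfl | rfl <;> simp

/-- Invariants computed from smooth lifts are smooth. -/
theorem regularAt_of_goodAt {L : LocalData} {s : ℂ → CM5} {z : ℂ} (hH : L.H = 1 ∨ L.H = -1)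
    (hθ : ∀ᶠ w in 𝓝 z, L.θ w ∈ Set.Ioo 0 Real.pi) (h : ∀ᶠ w in 𝓝 z, GoodAt L s w) :
    L.RegularAt z := by
  have hs := h.self_of_nhds.smooth
  have hξ := hs.xiC
  have hη := hs.etaC
  have sP : ContDiffAt ℝ ∞ (fun w => xiC s w ⬝ᵥ star (etaC s w)) z :=
    ContDiffAt.sum (s := Finset.univ) (f := fun i w => xiC s w i * star (etaC s w i))
      fun i _ => (hξ i).mul (hη i).star_comp
  have sM : ContDiffAt ℝ ∞ (fun w => dzbarV (xiC s) w ⬝ᵥ etaC s w) z :=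
    ContDiffAt.sum (s := Finset.univ) (f := fun i w => dzbar (fun q => xiC s q i) w * etaC s w i)
      fun i _ => (hξ i).dzbar.mul (hη i)
  have sC : ContDiffAt ℝ ∞ (fun w => dzV (xiC s) w ⬝ᵥ etaC s w) z :=
    ContDiffAt.sum (s := Finset.univ) (f := fun i w => dz (fun q => xiC s q i) w * etaC s w i)
      fun i _ => (hξ i).dz.mul (hη i)
  have sRe := reCLM.contDiff.contDiffAt.comp z sP
  have sIm := imCLM.contDiff.contDiffAt.comp z sP
  have key : ∀ w, GoodAt L s w → (xiC s w ⬝ᵥ star (etaC s w)).re = L.H * Real.exp (L.u w) ∧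
      (xiC s w ⬝ᵥ star (etaC s w)).im =
        L.H * Real.exp (L.u w) * Real.tan (L.θ w - Real.pi / 2) := by
    intro w hw
    rw [hw.adapted.pair, mul_assoc, re_ofReal_mul, re_ofReal_mul, im_ofReal_mul, im_ofReal_mul,
      cOf_re, cOf, add_im, one_im, I_mul_im, ofReal_re, mul_one, mul_assoc, zero_add]
    exact ⟨rfl, rfl⟩
  have hu : ContDiffAt ℝ ∞ L.u z := by
    -- Because Re c = 1 and H² = 1, the number e^u is H times the real part of ⟨ξ_z, conj η_z⟩; the
    -- imaginary part then yields θ.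
    have h1 : ContDiffAt ℝ ∞ (fun w => Real.log (L.H * (xiC s w ⬝ᵥ star (etaC s w)).re)) z := by
      refine (contDiffAt_const.mul sRe).log ?_
      change L.H * (xiC s z ⬝ᵥ star (etaC s z)).re ≠ 0
      rw [(key z h.self_of_nhds).1, ← mul_assoc, real_sign_mul_self hH, one_mul]
      exact (Real.exp_pos _).ne'
    refine h1.congr_of_eventuallyEq (h.mono fun w hw => ?_)
    simp only
    rw [(key w hw).1, ← mul_assoc, real_sign_mul_self hH, one_mul, Real.log_exp]
  have hexp : ContDiffAt ℝ ∞ (fun w => L.H * Real.exp (-L.u w)) z :=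
    contDiffAt_const.mul (Real.contDiff_exp.contDiffAt.comp z hu.neg)
  have hinv : ∀ w, L.H * Real.exp (-L.u w) * (L.H * Real.exp (L.u w)) = 1 := fun w => by
    rw [mul_mul_mul_comm, real_sign_mul_self hH, ← Real.exp_add]
    simp
  refine ⟨hH, hu, ?_, hθ.self_of_nhds, ?_, ?_⟩
  · have h1 : ContDiffAt ℝ ∞ (fun w => Real.arctan (L.H * Real.exp (-L.u w) *
        (xiC s w ⬝ᵥ star (etaC s w)).im) + Real.pi / 2) z :=
      (Real.contDiff_arctan.contDiffAt.comp z (hexp.mul sIm)).add contDiffAt_const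
    refine h1.congr_of_eventuallyEq ((h.and hθ).mono fun w hw => ?_)
    simp only
    rw [(key w hw.1).2, ← mul_assoc, hinv, one_mul, Real.arctan_tan]
    · ring
    · linarith [hw.2.1]
    · linarith [hw.2.2]
  · refine (hexp.ofReal_comp'.mul sM).congr_of_eventuallyEq (h.mono fun w hw => ?_)
    simp only
    rw [hw.adapted.mean, ← ofReal_mul, ← mul_assoc, ← ofReal_mul, hinv, ofReal_one, one_mul]
  · exact sC.congr_of_eventuallyEq (h.mono fun w hw => hw.adapted.cubic.symm)

/-- Smoothness comes from expressing the invariants through the lift, the transformation laws from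
`pairings_comp`, and the equations from the flatness of the frame's connection. -/
theorem compatible_of_isLift [IsManifold (modelWithCornersSelf ℂ ℂ) ω M] {f : M → DP2}
    {s : M → CM5} {D : SurfaceData M} (hs : IsLift f s) (h : HasInvariants f D) :
    D.IsGeometric ∧ D.CompatibleRho (fun e => rhoOf (s ∘ e.symm)) ∧ D.Compatible := by
  have hG : ∀ e ∈ atlas ℂ M, ∀ z ∈ e.target, GoodAt (D.loc e) (s ∘ e.symm) z :=
    fun e he z hz => h.goodAt he hz (hs.isLocalLiftAt he hz)
  have hθ : ∀ e ∈ atlas ℂ M, ∀ z ∈ e.target, (D.loc e).θ z ∈ Set.Ioo 0 Real.pi :=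
    fun e he z hz => (h.invariantsAt he hz (hs.isLocalLiftAt he hz)).range_θ
  have hG' : ∀ e ∈ atlas ℂ M, ∀ z ∈ e.target, ∀ᶠ w in 𝓝 z, GoodAt (D.loc e) (s ∘ e.symm) w :=
    fun e he z hz => Filter.eventually_of_mem (e.open_target.mem_nhds hz) (hG e he)
  have hR : ∀ e ∈ atlas ℂ M, ∀ z ∈ e.target, (D.loc e).RegularAt z :=
    fun e he z hz => regularAt_of_goodAt h.sign
      (Filter.eventually_of_mem (e.open_target.mem_nhds hz) (hθ e he)) (hG' e he z hz)
  have hsign := ofReal_sign_mul_self h.sign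
  have hT : ∀ e ∈ atlas ℂ M, ∀ e' ∈ atlas ℂ M, ∀ z ∈ e.target, e.symm z ∈ e'.source →
      Real.exp (D.u e z) = Real.exp (D.u e' (e' (e.symm z))) * ‖deriv (e' ∘ e.symm) z‖ ^ 2 ∧
      D.φ e z = D.φ e' (e' (e.symm z)) * deriv (e' ∘ e.symm) z ^ 1 ∧
      D.Q e z = D.Q e' (e' (e.symm z)) * deriv (e' ∘ e.symm) z ^ 3 := by
    intro e he e' he' z hz hz'
    have hτ := analyticAt_transition he he' hz hz'
    have g : GoodAt (D.loc e') (s ∘ e'.symm) ((e' ∘ e.symm) z) := hG e' he' _ (e'.map_source hz')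
    have g' := ((hG e he z hz).congr (comp_symm_eventuallyEq hz hz' s).symm).adapted
    obtain ⟨h1, h2, h3, h4⟩ := pairings_comp hτ g.smooth g.adapted.null
    rw [g'.pair] at h2
    rw [g'.mean] at h3
    rw [g'.cubic] at h4
    rw [g.adapted.pair] at h2
    rw [g.adapted.mean] at h3
    rw [g.adapted.cubic] at h4
    have hm : Real.exp (D.u e z) =
        Real.exp (D.u e' (e' (e.symm z))) * ‖deriv (e' ∘ e.symm) z‖ ^ 2 := by
      -- The real part isolates the metric because Re c = 1 in every chart.
      have h5 := congrArg re h2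
      simp only [mul_assoc, re_ofReal_mul, cOf_re, mul_one] at h5
      change D.H * Real.exp (D.u e z) = _ * (D.H * Real.exp (D.u e' (e' (e.symm z)))) at h5
      have h6 := congrArg (fun y => D.H * y) h5
      linear_combination h6 + (Real.exp (D.u e' (e' (e.symm z))) * ‖deriv (e' ∘ e.symm) z‖ ^ 2 -
        Real.exp (D.u e z)) * real_sign_mul_self h.sign
    refine ⟨hm, ?_, ?_⟩
    · have hm' := congrArg ofReal hm
      rw [ofReal_mul] at hm'
      change (D.H : ℂ) * (Real.exp (D.u e z) : ℝ) * D.φ e z = _ * _ *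
        ((D.H : ℂ) * (Real.exp (D.u e' (e' (e.symm z))) : ℝ) * D.φ e' (e' (e.symm z))) at h3
      have hne : (D.H : ℂ) * (Real.exp (D.u e z) : ℝ) ≠ 0 :=
        mul_ne_zero (left_ne_zero_of_mul_eq_one hsign) (exp_ofReal_ne_zero _)
      refine mul_left_cancel₀ hne (h3.trans ?_)
      rw [hm']
      ring
    · exact h4.trans (mul_comm _ _)
  have hF : ∀ e ∈ atlas ℂ M, ∀ z ∈ e.target, CompRho D.H (D.u e) (D.θ ∘ e.symm)
      (rhoOf (s ∘ e.symm)) z ∧ Comp1 D.H (D.u e) (D.θ ∘ e.symm) (D.φ e) (D.Q e) z ∧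
      Comp2 D.H (D.u e) (D.θ ∘ e.symm) (D.φ e) (D.Q e) z := fun e he z hz =>
    ((hR e he z hz).flatAt_iff (hG e he z hz).smooth.rhoOf).1
      (AdaptedAt.flatAt ((hG' e he z hz).mono fun w hw => hw.adapted)
        ((hG' e he z hz).mono fun w hw => hw.smooth)
        (Filter.eventually_of_mem (e.open_target.mem_nhds hz) (hR e he)))
  refine ⟨⟨h.sign, ?_, ?_, ?_, ?_, ⟨?_, ?_⟩, ⟨?_, ?_⟩⟩, fun e he z hz => (hF e he z hz).1,
    fun e he z hz => (hF e he z hz).2⟩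
  · exact fun e he z hz => (hR e he z hz).u.contDiffWithinAt
  · exact fun e he e' he' z hz hz' => (hT e he e' he' z hz hz').1
  · exact fun e he z hz => (hR e he z hz).θ.contDiffWithinAt
  · intro p
    have := hθ _ (chart_mem_atlas ℂ p) _ (mem_chart_target ℂ p)
    rwa [show (D.loc (chartAt ℂ p)).θ (chartAt ℂ p p) = D.θ p by
      simp [SurfaceData.loc]] at this
  · exact fun e he z hz => (hR e he z hz).φ.contDiffWithinAt
  · exact fun e he e' he' z hz hz' => (hT e he e' he' z hz hz').2.1
  · exact fun e he z hz => (hR e he z hz).Q.contDiffWithinAt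
  · exact fun e he e' he' z hz hz' => (hT e he e' he' z hz hz').2.2

end Surfaces

/-! ### Congruence of immersions and gluing of lifts. -/

noncomputable section GlobalLifts

open Complex

/-! ### Smooth local lifts -/

/-- The point of the quadric over the same point of `DP2` whose `i`-th coordinate is `1`. -/
def coordNormalize (i : Fin 3) (c : CM5) : CM5 :=
  if h : c.1.1 i ≠ 0 then ⟨((c.1.1 i)⁻¹ • c.1.1, c.1.1 i • c.1.2), by
    have h1 : c.1.1 ⬝ᵥ c.1.2 = 1 := c.2
    simp [CM5, h1, h]⟩ else c

theorem coordNormalize_coe {i : Fin 3} {c : CM5} (h : c.1.1 i ≠ 0) :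
    (coordNormalize i c : Vec × Vec) = ((c.1.1 i)⁻¹ • c.1.1, c.1.1 i • c.1.2) := by
  rw [coordNormalize, dif_pos h]

theorem proj_coordNormalize {i : Fin 3} {c : CM5} (h : c.1.1 i ≠ 0) :
    proj (coordNormalize i c) = proj c :=
  (proj_eq_proj_iff _ _).2 ⟨(c.1.1 i)⁻¹, inv_ne_zero h, by rw [coordNormalize_coe h],
    by rw [coordNormalize_coe h, inv_inv]⟩

/-- The representative with i-th coordinate 1 depends only on the point of `DP2`. -/
theorem coordNormalize_eq {i : Fin 3} {c c' : CM5} (h : c.1.1 i ≠ 0) (hc : proj c' = proj c) :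
    coordNormalize i c' = coordNormalize i c ∧ c'.1.1 i ≠ 0 := by
  obtain ⟨t, ht, h1, h2⟩ := (proj_eq_proj_iff _ _).1 hc
  have h' : c'.1.1 i ≠ 0 := by
    rw [h1]; exact mul_ne_zero ht h
  refine ⟨Subtype.ext ?_, h'⟩
  rw [coordNormalize_coe h, coordNormalize_coe h', h1, h2, Pi.smul_apply, smul_smul, smul_smul,
    smul_eq_mul]
  congr 2 <;> field_simp

theorem SmoothAt.coordNormalize {i : Fin 3} {s : ℂ → CM5} {z : ℂ} (hs : SmoothAt s z)
    (h : (s z).1.1 i ≠ 0) : SmoothAt (fun w => coordNormalize i (s w)) z := by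
  have hi := hs.fst_apply i
  have h1 : ContDiffAt ℝ ∞
      (fun w => (((s w).1.1 i)⁻¹ • (s w).1.1, (s w).1.1 i • (s w).1.2)) z :=
    ((hi.inv h).smul hs.fst).prodMk (hi.smul hs.snd)
  refine h1.congr_of_eventuallyEq ?_
  filter_upwards [hi.continuousAt.eventually_ne h] with w hw
  exact coordNormalize_coe hw

/-- C^∞ at one point does not give C^∞ at nearby points for an arbitrary lift. The
coordinate-normalized lift is the same for every choice of lift, so it inherits smoothness at each
nearby point from a lift chosen there. -/
theorem exists_eventually_isLocalLiftAt {F : ℂ → DP2} {z : ℂ} (h : ∀ᶠ w in 𝓝 z, SmoothNear F w) :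
    ∃ s : ℂ → CM5, ∀ᶠ w in 𝓝 z, IsLocalLiftAt F s w := by
  obtain ⟨s, hs⟩ := h.self_of_nhds
  have hsm : SmoothAt s z := hs.1
  obtain ⟨i, hi⟩ := Function.ne_iff.1 (CM5.fst_ne_zero (s z))
  refine ⟨fun w => coordNormalize i (s w), ?_⟩
  filter_upwards [h, hs.2.eventually_nhds,
    ((hsm.fst_apply i).continuousAt.eventually_ne hi).eventually_nhds] with w ⟨σ, hσ⟩ h1 h2
  have h3 : ∀ᶠ q in 𝓝 w, coordNormalize i (s q) = coordNormalize i (σ q) ∧ (s q).1.1 i ≠ 0 ∧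
      (σ q).1.1 i ≠ 0 ∧ proj (s q) = F q := by
    filter_upwards [h1, h2, hσ.2] with q e1 e2 e3
    have := coordNormalize_eq e2 (e3.trans e1.symm)
    exact ⟨this.1.symm, e2, this.2, e1⟩
  refine ⟨(SmoothAt.coordNormalize (s := σ) hσ.1 h3.self_of_nhds.2.2.1).congr
    (h3.mono fun q hq => hq.1), h3.mono fun q hq => ?_⟩
  rw [proj_coordNormalize hq.2.1, hq.2.2.2]

variable {M : Type*} [TopologicalSpace M] [ChartedSpace ℂ M]

theorem exists_normalized_lift {f : M → DP2} {D : SurfaceData M} (hf : IsImmersionDP2 f)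
    (h : HasInvariants f D) (hD : D.IsGeometric) {e : OpenPartialHomeomorph M ℂ}
    (he : e ∈ atlas ℂ M) {z : ℂ} (hz : z ∈ e.target) :
    ∃ s : ℂ → CM5, ∀ᶠ w in 𝓝 z, proj (s w) = f (e.symm w) ∧ GoodAt (D.loc e) s w ∧
      NormalizedAt (D.loc e) s w ∧ rhoOf s w = (D.loc e).rhoCan w := by
  have ht : ∀ᶠ w in 𝓝 z, w ∈ e.target := e.open_target.mem_nhds hz
  obtain ⟨s, hs⟩ := exists_eventually_isLocalLiftAt (ht.mono fun w hw => (hf e he w hw).1)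
  obtain ⟨s', h1, h2⟩ := exists_normalized (s := s) (ht.mono fun w hw => hD.regularAt he hw)
    ((ht.and hs).mono fun w hw => h.goodAt he hw.1 hw.2)
  refine ⟨s', ?_⟩
  filter_upwards [h2, hs] with w hw hsw
  exact ⟨(h1 w).trans hsw.2.self_of_nhds, hw⟩

/-! ### Congruence of immersions with the same invariants -/

/-- The special linear matrix `det A • A`, for `det A = ± 1`. -/
def toSL (A : Matrix (Fin 3) (Fin 3) ℝ) (h : A.det ^ 2 = 1) :
    Matrix.SpecialLinearGroup (Fin 3) ℝ :=
  ⟨A.det • A, by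
    rw [Matrix.det_smul, Fintype.card_fin]
    linear_combination (A.det ^ 2 + 1) * h⟩

/-- In odd dimension a matrix of determinant -1 becomes special linear after a change of sign, and
scaling does not alter the projective action. -/
theorem proj_actL_toSL (A : GL3) (h : A.1.det ^ 2 = 1) (s : CM5) :
    proj (actL A s) = act (toSL A.1 h) (proj s) := by
  rw [← proj_actL]
  have h1 : A.1.det ≠ 0 := fun h0 => by simp [h0] at h
  have hA : A.1 * A.2 = 1 := A.val_inv
  have h3 : (slToGL (toSL A.1 h)).2 = A.1.det⁻¹ • A.2 := by
    have e : (slToGL (toSL A.1 h)).2 * (A.1.det • A.1) = 1 := (slToGL (toSL A.1 h)).inv_val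
    calc (slToGL (toSL A.1 h)).2
        = (slToGL (toSL A.1 h)).2 * (A.1.det • A.1) * (A.1.det⁻¹ • A.2) := by
          simp only [mul_assoc, Matrix.smul_mul, Matrix.mul_smul, hA, smul_smul,
            inv_mul_cancel₀ h1, one_smul, mul_one]
      _ = _ := by rw [e, one_mul]
  refine (proj_eq_proj_iff _ _).2 ⟨A.1.det⁻¹, inv_ne_zero h1, ?_, ?_⟩
  · change A.1 *ᵥ s.1.1 = A.1.det⁻¹ • ((A.1.det • A.1) *ᵥ s.1.1)
    rw [Matrix.smul_mulVec, smul_smul, inv_mul_cancel₀ h1, one_smul]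
  · change s.1.2 ᵥ* A.2 = A.1.det⁻¹⁻¹ • (s.1.2 ᵥ* (slToGL (toSL A.1 h)).2)
    rw [h3, Matrix.vecMul_smul, smul_smul, inv_inv, mul_inv_cancel₀ h1, one_smul]

theorem det_map_ofReal (A : Matrix (Fin 3) (Fin 3) ℝ) : (A.map ofReal).det = (A.det : ℂ) := by
  simp [Matrix.det_fin_three]

/-- Normalized lifts of both maps have the same ρ, so a constant matrix relates them; comparing |det
F| = e^u for both makes its determinant ±1. -/
theorem exists_eventually_eq_act {f f' : M → DP2} {D : SurfaceData M} (hf : IsImmersionDP2 f)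
    (h : HasInvariants f D) (hf' : IsImmersionDP2 f') (h' : HasInvariants f' D)
    (hD : D.IsGeometric) (p : M) :
    ∃ A : Matrix.SpecialLinearGroup (Fin 3) ℝ, ∀ᶠ q in 𝓝 p, f' q = act A (f q) := by
  have he := chart_mem_atlas ℂ p
  have hz := mem_chart_target ℂ p
  have hp := mem_chart_source ℂ p
  set e := chartAt ℂ p
  obtain ⟨s, hs⟩ := exists_normalized_lift hf h hD he hz
  obtain ⟨s', hs'⟩ := exists_normalized_lift hf' h' hD he hz
  have ht : ∀ᶠ w in 𝓝 (e p), w ∈ e.target := e.open_target.mem_nhds hz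
  obtain ⟨A, hA⟩ := local_lift_unique (ht.mono fun w hw => hD.regularAt he hw)
    (hs.mono fun w hw => hw.2.1) (hs'.mono fun w hw => hw.2.1)
    ((hs.and hs').mono fun w hw => hw.2.2.2.2.trans hw.1.2.2.2.symm)
  have hdet : A.1.det ^ 2 = 1 := by
    have e1 := frame_congr hA
    have g := hs.self_of_nhds
    have g' := hs'.self_of_nhds
    rw [frame_actL g.2.1.smooth.diffAt] at e1
    have n := g.2.2.1
    have n' := g'.2.2.1
    rw [NormalizedAt, e1, Matrix.det_mul, det_map_ofReal, normSq_mul, normSq_ofReal, n] at n'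
    rw [sq]
    exact mul_right_cancel₀ (Real.exp_pos _).ne' (n'.trans (one_mul _).symm)
  refine ⟨toSL A.1 hdet, ?_⟩
  have hc := (e.continuousAt hp).eventually (hs.and (hs'.and hA))
  filter_upwards [hc, e.open_source.mem_nhds hp] with q hq hqs
  have e1 : e.symm (e q) = q := e.left_inv hqs
  have e2 := hq.1.1
  have e3 := hq.2.1.1
  rw [e1] at e2 e3
  rw [← e2, ← e3, hq.2.2, proj_actL_toSL A hdet]

/-- If A and B agree on the image near one point, then the lifts A s and B s differ by a scaling.
Since the frame is invertible, B = tA with t real, and the determinants give t³ = 1. -/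
theorem act_injective {f : M → DP2} {D : SurfaceData M} (hf : IsImmersionDP2 f)
    (h : HasInvariants f D) {p : M} {A B : Matrix.SpecialLinearGroup (Fin 3) ℝ}
    (hAB : ∀ᶠ q in 𝓝 p, act A (f q) = act B (f q)) : A = B := by
  have he := chart_mem_atlas ℂ p
  have hz := mem_chart_target ℂ p
  have hp := mem_chart_source ℂ p
  set e := chartAt ℂ p
  obtain ⟨s, hs⟩ := (hf e he (e p) hz).1
  have hg := h.goodAt he hz hs
  have hsy : e.symm (e p) = p := e.left_inv hp
  have hl : IsLocalLiftAt (act A ∘ (f ∘ e.symm)) (fun q => actL (slToGL B) (s q)) (e p) := by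
    refine ⟨SmoothAt.actL hs.1 _, ?_⟩
    have hc := (e.continuousAt_symm hz).eventually (by rw [hsy]; exact hAB)
    filter_upwards [hs.2, hc] with w h1 h2
    rw [proj_actL, h1]
    exact h2.symm
  obtain ⟨t, -, ht⟩ := (hs.act A).rescaled hl
  have e1 := ht.self_of_nhds.frame (hg.smooth.diffAt.actL _)
  rw [frame_actL hg.smooth.diffAt, frame_actL hg.smooth.diffAt, ← Matrix.smul_mul] at e1
  have e2 := mul_eq_one_comm.1 (hg.adapted.coframe_mul_frame hg.smooth.diffAt h.sign)
  have e3 := congrArg (fun M => M * coframe (D.loc e) s (e p)) e1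
  simp only [mul_assoc, e2, mul_one] at e3
  have e4 : (B : Matrix (Fin 3) (Fin 3) ℝ) = t (e p) • (A : Matrix (Fin 3) (Fin 3) ℝ) := by
    apply map_ofReal_injective
    refine e3.trans ?_
    ext i j
    change (t (e p) : ℂ) * (((A : Matrix (Fin 3) (Fin 3) ℝ) i j : ℝ) : ℂ) = _
    simp
  have e5 := congrArg Matrix.det e4
  rw [Matrix.det_smul, Fintype.card_fin, A.det_coe, B.det_coe, mul_one] at e5
  have e6 : t (e p) = 1 := by
    -- This is t³ - 1 = (t - 1)(t² + t + 1) with the square completed, so t = 1 is the only real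
    -- root.
    have : (t (e p) - 1) * ((t (e p) + 1 / 2) ^ 2 + 3 / 4) = 0 := by linear_combination -e5
    rcases mul_eq_zero.1 this with h0 | h0
    · linarith
    · nlinarith [sq_nonneg (t (e p) + 1 / 2)]
  rw [e6, one_smul] at e4
  exact Subtype.ext e4.symm

/-- Two immersions with the same invariants differ by an element of `SL(3, ℝ)`. -/
theorem exists_eq_act [PreconnectedSpace M] [Nonempty M] {f f' : M → DP2} {D : SurfaceData M}
    (hf : IsImmersionDP2 f) (h : HasInvariants f D) (hf' : IsImmersionDP2 f')
    (h' : HasInvariants f' D) (hD : D.IsGeometric) :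
    ∃ A : Matrix.SpecialLinearGroup (Fin 3) ℝ, f' = act A ∘ f := by
  choose A hA using exists_eventually_eq_act hf h hf' h' hD
  have hc : IsLocallyConstant A := by
    refine (IsLocallyConstant.iff_eventually_eq A).2 fun p => ?_
    filter_upwards [(hA p).eventually_nhds] with q hq
    exact act_injective hf h ((hA q).mp (hq.mono fun y h1 h2 => h2.symm.trans h1))
  obtain ⟨p⟩ := ‹Nonempty M›
  refine ⟨A p, funext fun q => ?_⟩
  rw [hc.apply_eq_of_preconnectedSpace p q]
  exact (hA q).self_of_nhds

/-! ### Global lifts with prescribed invariants -/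

/-- The map `s` is, at `q`, a smooth lift with invariants `D` and the form `ρ`. -/
def LiftGoodAt (D : SurfaceData M) (ρ : OpenPartialHomeomorph M ℂ → ℂ → ℂ) (s : M → CM5) (q : M) :
    Prop := ∀ e ∈ atlas ℂ M, q ∈ e.source →
      GoodAt (D.loc e) (s ∘ e.symm) (e q) ∧ rhoOf (s ∘ e.symm) (e q) = ρ e (e q)

section LiftGood

variable {D : SurfaceData M} {ρ : OpenPartialHomeomorph M ℂ → ℂ → ℂ} {s s' : M → CM5} {p : M}

theorem LiftGoodAt.congr (h : LiftGoodAt D ρ s p) (h' : s' =ᶠ[𝓝 p] s) : LiftGoodAt D ρ s' p := by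
  intro e he hp
  have h1 : s' ∘ e.symm =ᶠ[𝓝 (e p)] s ∘ e.symm :=
    h'.comp_tendsto (by
      have := e.continuousAt_symm (e.map_source hp)
      rwa [ContinuousAt, e.left_inv hp] at this)
  exact ⟨(h e he hp).1.congr h1, (rhoOf_congr h1).trans (h e he hp).2⟩

theorem LiftGoodAt.actL (h : LiftGoodAt D ρ s p) (A : GL3) :
    LiftGoodAt D ρ (fun q => actL A (s q)) p := fun e he hp =>
  have h1 := (h e he hp).1
  ⟨⟨h1.smooth.actL A, h1.adapted.actL h1.smooth A⟩,
    (rhoOf_actL h1.smooth.diffAt A).trans (h e he hp).2⟩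

theorem eventually_chart (h : ∀ᶠ q in 𝓝 p, LiftGoodAt D ρ s q) :
    ∀ᶠ w in 𝓝 (chartAt ℂ p p), GoodAt (D.loc (chartAt ℂ p)) (s ∘ (chartAt ℂ p).symm) w ∧
      rhoOf (s ∘ (chartAt ℂ p).symm) w = ρ (chartAt ℂ p) w := by
  have hz := mem_chart_target ℂ p
  have h1 := ((chartAt ℂ p).continuousAt_symm hz).eventually
    (by rw [(chartAt ℂ p).left_inv (mem_chart_source ℂ p)]; exact h)
  filter_upwards [h1, (chartAt ℂ p).open_target.mem_nhds hz] with w hw hwt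
  have := hw _ (chart_mem_atlas ℂ p) ((chartAt ℂ p).map_target hwt)
  rwa [(chartAt ℂ p).right_inv hwt] at this

theorem exists_eventually_eq_actL (hD : D.IsGeometric) (h : ∀ᶠ q in 𝓝 p, LiftGoodAt D ρ s q)
    (h' : ∀ᶠ q in 𝓝 p, LiftGoodAt D ρ s' q) :
    ∃ A : GL3, ∀ᶠ q in 𝓝 p, s' q = actL A (s q) := by
  have he := chart_mem_atlas ℂ p
  have hz := mem_chart_target ℂ p
  have hp := mem_chart_source ℂ p
  have h1 := eventually_chart h
  have h2 := eventually_chart h'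
  obtain ⟨A, hA⟩ := local_lift_unique
    (Filter.eventually_of_mem ((chartAt ℂ p).open_target.mem_nhds hz)
      fun w hw => hD.regularAt he hw) (h1.mono fun w hw => hw.1) (h2.mono fun w hw => hw.1)
    ((h1.and h2).mono fun w hw => hw.2.2.trans hw.1.2.symm)
  refine ⟨A, ?_⟩
  filter_upwards [((chartAt ℂ p).continuousAt hp).eventually hA,
    (chartAt ℂ p).open_source.mem_nhds hp] with q hq hqs
  simpa [(chartAt ℂ p).left_inv hqs] using hq

theorem LiftGoodAt.actL_injective (h : LiftGoodAt D ρ s p) (hH : D.H = 1 ∨ D.H = -1) {A B : GL3}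
    (hAB : ∀ᶠ q in 𝓝 p, _root_.actL A (s q) = _root_.actL B (s q)) : A = B := by
  have hp := mem_chart_source ℂ p
  refine _root_.actL_injective (h _ (chart_mem_atlas ℂ p) hp).1 hH ?_
  exact ((chartAt ℂ p).continuousAt_symm (mem_chart_target ℂ p)).eventually
    (by rw [(chartAt ℂ p).left_inv hp]; exact hAB)

/-- The lift is solved for in one chart; the transformation laws of the data and of ρ carry its
properties to all other charts. -/
theorem exists_eventually_liftGoodAt [IsManifold (modelWithCornersSelf ℂ ℂ) ω M]
    (hD : D.IsGeometric) (hC : D.Compatible) (hρ : IsDifferential 1 ρ)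
    (hCρ : D.CompatibleRho ρ) (p : M) : ∃ s : M → CM5, ∀ᶠ q in 𝓝 p, LiftGoodAt D ρ s q := by
  have he := chart_mem_atlas ℂ p
  have hz := mem_chart_target ℂ p
  have hp := mem_chart_source ℂ p
  set e := chartAt ℂ p
  have ht : ∀ᶠ w in 𝓝 (e p), w ∈ e.target := e.open_target.mem_nhds hz
  have hρs : ∀ w ∈ e.target, ContDiffAt ℝ ∞ (ρ e) w := fun w hw =>
    (hρ.1 e he).contDiffAt (e.open_target.mem_nhds hw)
  obtain ⟨σ, hσ⟩ := exists_local_lift (L := D.loc e) (ρ := ρ e)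
    (ht.mono fun w hw => hD.regularAt he hw) (ht.mono hρs)
    (ht.mono fun w hw => ((hD.regularAt he hw).flatAt_iff (hρs w hw)).2
      ⟨hCρ e he w hw, hC e he w hw⟩)
  refine ⟨σ ∘ e, ?_⟩
  filter_upwards [(e.continuousAt hp).eventually hσ, e.open_source.mem_nhds hp]
    with q hq hqs e' he' hq'
  have h1 : e'.symm (e' q) = q := e'.left_inv hq'
  have h2 : e' q ∈ e'.target := e'.map_source hq'
  have h3 : e'.symm (e' q) ∈ e.source := by rw [h1]; exact hqs
  have h4 : (e ∘ e'.symm) (e' q) = e q := congrArg e h1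
  rw [← h4] at hq
  refine ⟨GoodAt.transition hD he' he h2 h3 hq.1, ?_⟩
  have h5 := hρ.2 e' he' e he (e' q) h2 h3
  rw [pow_one] at h5
  rw [h5, mul_comm]
  refine (rhoOf_comp (analyticAt_transition he' he h2 h3).differentiableAt.hasDerivAt
    hq.1.smooth.diffAt).trans ?_
  rw [hq.2]
  rfl

/-- On a simply connected surface, local lifts can be glued. -/
theorem exists_global_lift [IsManifold (modelWithCornersSelf ℂ ℂ) ω M] [SimplyConnectedSpace M]
    (hD : D.IsGeometric) (hC : D.Compatible) (hρ : IsDifferential 1 ρ)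
    (hCρ : D.CompatibleRho ρ) : ∃ s : M → CM5, ∀ q, LiftGoodAt D ρ s q := by
  have _ : LocallyPathConnectedSpace M := ChartedSpace.locallyPathConnectedSpace ℂ M
  choose s hs using exists_eventually_liftGoodAt hD hC hρ hCρ
  choose U hU hUo hpU using fun p => eventually_nhds_iff.1 (hs p)
  have hev : ∀ i x, x ∈ U i → ∀ᶠ q in 𝓝 x, LiftGoodAt D ρ (s i) q := fun i x hx =>
    Filter.eventually_of_mem ((hUo i).mem_nhds hx) (hU i)
  have hg : ∀ i j x, ∃ A : GL3, x ∈ U i → x ∈ U j → ∀ᶠ q in 𝓝 x, s i q = _root_.actL A (s j q) := by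
    intro i j x
    by_cases h : x ∈ U i ∧ x ∈ U j
    · obtain ⟨A, hA⟩ := exists_eventually_eq_actL hD (hev j x h.2) (hev i x h.1)
      exact ⟨A, fun _ _ => hA⟩
    · exact ⟨1, fun h1 h2 => absurd ⟨h1, h2⟩ h⟩
  choose g hg using hg
  have huniq : ∀ i x, x ∈ U i → ∀ A B : GL3,
      (∀ᶠ q in 𝓝 x, _root_.actL A (s i q) = _root_.actL B (s i q)) → A = B := fun i x hx A B h =>
    (hU i x hx).actL_injective hD.sign h
  obtain ⟨b, hb, hbloc⟩ := exists_trivialization_of_locallyConstant_cocycle U hUo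
    (fun x => ⟨x, hpU x⟩) g
    (fun i x hx => huniq i x hx _ _ ((hg i i x hx hx).mono fun q hq => by rw [← hq, actL_one]))
    (fun i j k x hi hj hk => huniq k x hk _ _ (by
      filter_upwards [hg i j x hi hj, hg j k x hj hk, hg i k x hi hk] with q h1 h2 h3
      rw [actL_mul, ← h2, ← h1, h3]))
    (fun i j x hi hj => by
      filter_upwards [(hg i j x hi hj).eventually_nhds, (hUo i).mem_nhds hi, (hUo j).mem_nhds hj]
        with y hy hyi hyj
      refine huniq j y hyj _ _ ?_
      filter_upwards [hy, hg i j y hyi hyj] with q h1 h2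
      rw [← h1, ← h2])
  -- The matrices b correct the local lifts so that they agree on overlaps; hence near x this is the
  -- constant b x x applied to the single lift s x.
  refine ⟨fun x => _root_.actL (b x x) (s x x), fun x => ?_⟩
  refine ((hU x x (hpU x)).actL (b x x)).congr ?_
  filter_upwards [(hUo x).mem_nhds (hpU x), hbloc x x (hpU x)] with y hy hby
  rw [← hby, ← hb x y y hy (hpU y), actL_mul]
  rw [(hg x y y hy (hpU y)).self_of_nhds]

theorem LiftGoodAt.at_target (h : ∀ q, LiftGoodAt D ρ s q) {e : OpenPartialHomeomorph M ℂ}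
    (he : e ∈ atlas ℂ M) {z : ℂ} (hz : z ∈ e.target) :
    GoodAt (D.loc e) (s ∘ e.symm) z ∧ rhoOf (s ∘ e.symm) z = ρ e z := by
  have := h (e.symm z) e he (e.map_target hz)
  rwa [e.right_inv hz] at this

theorem LiftGoodAt.isLift (h : ∀ q, LiftGoodAt D ρ s q) : IsLift (fun q => proj (s q)) s :=
  ⟨fun _ => rfl, fun _ he _ hz => (LiftGoodAt.at_target h he hz).1.smooth.contDiffWithinAt⟩

theorem LiftGoodAt.hasInvariants (hD : D.IsGeometric) (h : ∀ q, LiftGoodAt D ρ s q) :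
    HasInvariants (fun q => proj (s q)) D := by
  have key : ∀ e ∈ atlas ℂ M, ∀ z ∈ e.target, ∀ σ : ℂ → CM5,
      IsLocalLiftAt ((fun q => proj (s q)) ∘ e.symm) σ z → InvariantsAt (D.loc e) σ z := by
    intro e he z hz σ hσ
    have h1 := (LiftGoodAt.at_target h he hz).1
    obtain ⟨t, -, ht⟩ := ((LiftGoodAt.isLift h).isLocalLiftAt he hz).rescaled hσ
    exact (invariantsAt_iff (L := D.loc e) hD.sign).2
      ⟨h1.adapted.rescale h1.smooth ht, hD.range_θ _⟩
  exact ⟨hD.sign, fun e he z hz σ hσ => (key e he z hz σ hσ).metric,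
    fun e he z hz σ hσ => (key e he z hz σ hσ).angle,
    fun e he z hz σ hσ => (key e he z hz σ hσ).mean,
    fun e he z hz σ hσ => (key e he z hz σ hσ).cubic⟩

/-- Definiteness does it: if ξ(v) = 0 then g(v, v) = 2He^u|v|² vanishes, so v = 0. -/
theorem isImmersionDP2_of_hasInvariants {f : M → DP2} (hs : IsLift f s) (h : HasInvariants f D) :
    IsImmersionDP2 f := by
  refine fun e he z hz => ⟨⟨_, hs.isLocalLiftAt he hz⟩, fun σ hσ v hv _ => ?_⟩
  have h1 := h.metric e he z hz σ hσ v v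
  rw [gForm, hForm, hv, zero_dotProduct, add_zero, zero_div, star_def, mul_conj, ofReal_re] at h1
  have h2 : D.H ≠ 0 := by rcases h.sign with h | h <;> rw [h] <;> norm_num
  have h3 := (Real.exp_pos (D.u e z)).ne'
  simpa [h2, h3] using h1.symm

end LiftGood

/-! ### The canonical form -/

/-- Since c is a function on the surface, ∂_z log c transforms as a form. Replacing log c by log c +
u would break this. -/
theorem isDifferential_rhoCan [IsManifold (modelWithCornersSelf ℂ ℂ) ω M] {D : SurfaceData M}
    (hD : D.IsGeometric) : IsDifferential 1 (fun e => (D.loc e).rhoCan) := by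
  refine ⟨fun e he z hz => (hD.regularAt he hz).contDiffAt_rhoCan.contDiffWithinAt, ?_⟩
  intro e he e' he' z hz hz'
  have hτ := analyticAt_transition he he' hz hz'
  have h1 : dz (fun w => log (cOf (D.loc e).θ w)) z =
      dz (fun w => log (cOf (D.loc e').θ w)) ((e' ∘ e.symm) z) * deriv (e' ∘ e.symm) z := by
    rw [← dz_comp_holo (f := fun w => log (cOf (D.loc e').θ w)) hτ.differentiableAt.hasDerivAt
      ((hD.regularAt he' (e'.map_source hz')).contDiffAt_log_c.differentiableAt (by simp))]
    refine dz_congr ?_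
    filter_upwards [eventually_mem_source hz hz'] with w hw
    rw [cOf_comp_symm D hw.2]
  have h2 : (D.loc e).φ z = (D.loc e').φ ((e' ∘ e.symm) z) * deriv (e' ∘ e.symm) z := by
    have := hD.form_φ.2 e he e' he' z hz hz'
    rwa [pow_one] at this
  rw [pow_one]
  change (D.loc e).rhoCan z = (D.loc e').rhoCan ((e' ∘ e.symm) z) * _
  rw [LocalData.rhoCan, LocalData.rhoCan, h1, h2, cOf_comp_symm D hz']
  ring

theorem compatibleRho_rhoCan {D : SurfaceData M} (hD : D.IsGeometric) (hC : D.Compatible) :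
    D.CompatibleRho (fun e => (D.loc e).rhoCan) := fun e he z hz =>
  (hD.regularAt he hz).compRho_rhoCan (hC e he z hz).1

end GlobalLifts

/-! ### The theorem. -/

theorem theorem4p1 {M : Type*} [TopologicalSpace M] [T2Space M] [ChartedSpace ℂ M]
    [IsManifold (modelWithCornersSelf ℂ ℂ) ω M] :
    (∀ (f : M → DP2) (s : M → CM5) (D : SurfaceData M),
      IsImmersionDP2 f → IsLift f s → HasInvariants f D →
        D.IsGeometric ∧ D.CompatibleRho (fun e => rhoOf (s ∘ e.symm)) ∧ D.Compatible) ∧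
    (SimplyConnectedSpace M → ∀ D : SurfaceData M, D.IsGeometric → D.Compatible →
      ∃ f : M → DP2, IsImmersionDP2 f ∧ HasInvariants f D ∧
        (∃ s : M → CM5, IsLift f s) ∧
        (∀ ρ : OpenPartialHomeomorph M ℂ → ℂ → ℂ, IsDifferential 1 ρ → D.CompatibleRho ρ →
          ∃ s : M → CM5, IsLift f s ∧
            ∀ e ∈ atlas ℂ M, ∀ z ∈ e.target, rhoOf (s ∘ e.symm) z = ρ e z) ∧
        (∀ f' : M → DP2, IsImmersionDP2 f' → HasInvariants f' D →
          ∃ A : Matrix.SpecialLinearGroup (Fin 3) ℝ, IsIsometryDP2 (act A) ∧ f' = act A ∘ f)) := by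
  refine ⟨fun f s D _ hs h => compatible_of_isLift hs h, fun hM D hD hC => ?_⟩
  have _ : Nonempty M := PathConnectedSpace.nonempty
  -- The canonical form supplies the solution of (a) required to construct the immersion.
  obtain ⟨s, hs⟩ := exists_global_lift hD hC (isDifferential_rhoCan hD)
    (compatibleRho_rhoCan hD hC)
  have hl := LiftGoodAt.isLift hs
  have hi := LiftGoodAt.hasInvariants hD hs
  have him := isImmersionDP2_of_hasInvariants hl hi
  refine ⟨_, him, hi, ⟨s, hl⟩, fun ρ hρ hCρ => ?_, fun f' hf' h' => ?_⟩
  · obtain ⟨s', hs'⟩ := exists_global_lift hD hC hρ hCρ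
    have hl' := LiftGoodAt.isLift hs'
    have hi' := LiftGoodAt.hasInvariants hD hs'
    -- The lift built from ρ belongs to an immersion congruent to the first one. Moving the lift by
    -- the congruence makes it a lift of that immersion, and a constant linear map leaves ρ
    -- unchanged.
    obtain ⟨A, hA⟩ := exists_eq_act (isImmersionDP2_of_hasInvariants hl' hi') hi' him hi hD
    have hs'' : ∀ q, LiftGoodAt D ρ (fun q => actL (slToGL A) (s' q)) q := fun q =>
      (hs' q).actL _
    refine ⟨_, ⟨fun q => ?_, (LiftGoodAt.isLift hs'').2⟩,
      fun e he z hz => (LiftGoodAt.at_target hs'' he hz).2⟩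
    rw [proj_actL]
    exact (congrFun hA q).symm
  · obtain ⟨A, hA⟩ := exists_eq_act him hi hf' h' hD
    exact ⟨A, isIsometryDP2_act A, hA⟩
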